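/- Let $A$ be a simple C*-algebra (nonzero, with no nontrivial closed two-sided ideals; not necessarily unital or separable) which is not of type I, let $G$ be a finite group, and let $\alpha\colon G\to\operatorname{Aut}(A)$ be an action with the weak tracial Rokhlin property: for every $\varepsilon>0$, every finite set $F\subseteq A$ and all positive $x,y\in A$ with $\|x\|=1$, there are pairwise orthogonal positive contractions $f_g\in A$ ($g\in G$) such that, with $f=\sum_{g\in G}f_g$, (1) $\|af_g-f_ga\|<\varepsilon$ for all $g\in G$, $a\in F$; (2) $\|\alpha_g(f_h)-f_{gh}\|<\varepsilon$ for all $g,h\in G$; (3) $(y^2-yfy-\varepsilon)_+\precsim_A x$; (4) $\|fxf\|>1-\varepsilon$. Here $a\precsim_A b$ (Cuntz subequivalence) means that $a=\lim_n w_nbw_n^*$ for some sequence $(w_n)$. For a C*-algebra $B$, let $\operatorname{Cu}(B)$ be the set of classes $[a]$ of positive elements $a$ of $B\otimes\mathcal K$ under $a\sim b\iff a\precsim b\precsim a$ (in $B\otimes\mathcal K$), ordered by $[a]\le[b]\iff a\precsim b$, with addition $[a]+[b]=[a\oplus b]$. Let $A^\alpha$ be the fixed point algebra and $\iota\colon A^\alpha\to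 A$ the inclusion. Then $\operatorname{Cu}(A^\alpha)$ and $\operatorname{Cu}(A)$ are $\operatorname{Cu}$-semigroups, and the map $\operatorname{Cu}(\iota)\colon\operatorname{Cu}(A^\alpha)\to\operatorname{Cu}(A)$, $[a]\mapsto[(\iota\otimes\operatorname{id}_{\mathcal K})(a)]$, is a $\operatorname{Cu}$-morphism, that is, it preserves zero, addition, the order, the compact containment relation $\ll$ and suprema of increasing sequences. Moreover, $\operatorname{Cu}(\iota)$ is injective on $$\operatorname{Cu}_+(A^\alpha)=\{[a]\colon a\in(A^\alpha\otimes\mathcal K)_+ \text{ is purely positive}\},$$ where a positive element $a$ of a C*-algebra $B$ is purely positive if it is not Cuntz equivalent to any projection in $M_\infty(B)=\bigcup_nM_n(B)$. (A $\operatorname{Cu}$-semigroup is a positively ordered abelian monoid in which (O1) every increasing sequence has a supremum; (O2) every element is the supremum of a sequence $x_0\ll x_1\ll x_2\ll\cdots$; (O3) $x'\ll x$ and $y'\ll y$ imply $x'+y'\ll x+y$; (O4) suprema of increasing sequences are additive. Here $x\ll y$ means that every increasing sequence $(y_n)$ with $y\le\sup_ny_n$ satisfies $x\le y_n$ for some $n$.)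 -/

import Mathlib

open Filter Topology

noncomputable section

namespace CuntzSemigroup

/-! ### Completion of a pre-C⋆-algebra -/

section Completion

open UniformSpace UniformSpace.Completion

variable {E : Type*} [NonUnitalNormedRing E]

/-- The continuous extension of the multiplication of a normed ring to its completion. -/
abbrev completionMul : Mul (Completion E) :=
  ⟨Function.curry <| ((isDenseInducing_coe (α := E)).prodMap isDenseInducing_coe).extend
    (((↑) : E → Completion E) ∘ Function.uncurry (· * ·))⟩

attribute [local instance] completionMul

theorem completion_coe_mul (a b : E) :
    ((a * b : E) : Completion E) = (a : Completion E) * (b : Completion E) :=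
  ((isDenseInducing_coe.prodMap isDenseInducing_coe).extend_eq
      ((continuous_coe E).comp (@continuous_mul E _ _ _)) (a, b)).symm

theorem completion_continuousMul : ContinuousMul (Completion E) where
  continuous_mul := by
    let m := (AddMonoidHom.mul : E →+ E →+ E).compr₂ toCompl
    have : Continuous fun p : E × E => m p.1 p.2 := (continuous_coe E).comp continuous_mul
    have di : IsDenseInducing (toCompl : E → Completion E) := isDenseInducing_coe
    exact (di.extend_Z_bilin di this :)

attribute [local instance] completion_continuousMul

/-- The completion of a normed ring is a normed ring. -/
abbrev completionNonUnitalNormedRing : NonUnitalNormedRing (Completion E) :=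
  { (inferInstance : NormedAddCommGroup (Completion E)),
    (completionMul : Mul (Completion E)) with
    zero_mul a := Completion.induction_on a (isClosed_eq (by fun_prop) continuous_const)
      fun a => by rw [← coe_zero, ← completion_coe_mul, zero_mul]
    mul_zero a := Completion.induction_on a (isClosed_eq (by fun_prop) continuous_const)
      fun a => by rw [← coe_zero, ← completion_coe_mul, mul_zero]
    mul_assoc a b c := Completion.induction_on₃ a b c (isClosed_eq (by fun_prop) (by fun_prop))
      fun a b c => by
        rw [← completion_coe_mul, ← completion_coe_mul, ← completion_coe_mul,
          ← completion_coe_mul, mul_assoc]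
    left_distrib a b c :=
      Completion.induction_on₃ a b c (isClosed_eq (by fun_prop) (by fun_prop))
        fun a b c => by
          rw [← coe_add, ← completion_coe_mul, ← completion_coe_mul, ← completion_coe_mul,
            ← coe_add, mul_add]
    right_distrib a b c :=
      Completion.induction_on₃ a b c (isClosed_eq (by fun_prop) (by fun_prop))
        fun a b c => by
          rw [← coe_add, ← completion_coe_mul, ← completion_coe_mul, ← completion_coe_mul,
            ← coe_add, add_mul]
    norm_mul_le x y := by
      induction x, y using induction_on₂ with
      | hp => apply isClosed_le <;> fun_prop
      | ih x y => simpa only [← completion_coe_mul, norm_coe] using norm_mul_le x y }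

variable [StarRing E]

theorem uniformContinuous_star_pre [CStarRing E] : UniformContinuous (star : E → E) :=
  (AddMonoidHomClass.isometry_of_norm (starAddEquiv : E ≃+ E)
    (fun x => norm_star x)).uniformContinuous

/-- The involution of the completion, extended by continuity. -/
abbrev completionStar : Star (Completion E) := ⟨Completion.map star⟩

attribute [local instance] completionStar

theorem completion_coe_star [CStarRing E] (a : E) : ((star a : E) : Completion E) = star (a : Completion E) :=
  (Completion.map_coe uniformContinuous_star_pre a).symm

theorem completion_continuous_star : Continuous (star : Completion E → Completion E) :=
  Completion.continuous_map

variable [CStarRing E] [NormedSpace ℂ E] [IsScalarTower ℂ E E] [SMulCommClass ℂ E E] [StarModule ℂ E]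

/-- The completion of a pre-C⋆-algebra is a C⋆-algebra. -/
abbrev completionCStarAlgebra : NonUnitalCStarAlgebra (Completion E) :=
  letI : NonUnitalNormedRing (Completion E) := completionNonUnitalNormedRing
  have hs : Continuous (star : Completion E → Completion E) := completion_continuous_star
  letI : StarRing (Completion E) :=
    { star_involutive := fun a => by
        refine Completion.induction_on a (isClosed_eq (hs.comp hs) continuous_id) fun a => ?_
        rw [← completion_coe_star, ← completion_coe_star, star_star]
      star_mul := fun a b => by
        refine Completion.induction_on₂ a b
          (isClosed_eq (hs.comp (by fun_prop)) ?_) fun a b => ?_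
        · exact (hs.comp continuous_snd).mul (hs.comp continuous_fst)
        · rw [← completion_coe_mul, ← completion_coe_star, ← completion_coe_star,
            ← completion_coe_star, ← completion_coe_mul, star_mul]
      star_add := fun a b => by
        refine Completion.induction_on₂ a b
          (isClosed_eq (hs.comp (by fun_prop)) ?_) fun a b => ?_
        · exact (hs.comp continuous_fst).add (hs.comp continuous_snd)
        · rw [← coe_add, ← completion_coe_star, ← completion_coe_star,
            ← completion_coe_star, ← coe_add, star_add] }
  { (inferInstance : NonUnitalNormedRing (Completion E)),
    (inferInstance : StarRing (Completion E)),
    (inferInstance : NormedSpace ℂ (Completion E)) with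
    norm_mul_self_le := fun a => by
      refine Completion.induction_on a (isClosed_le (by fun_prop) ?_) fun a => ?_
      · exact continuous_norm.comp (hs.mul continuous_id)
      · rw [← completion_coe_star, ← completion_coe_mul, norm_coe, norm_coe]
        exact CStarRing.norm_mul_self_le a
    complete := (inferInstance : CompleteSpace (Completion E)).complete
    smul_assoc := fun c a b => by
      refine Completion.induction_on₂ a b (isClosed_eq ?_ ?_) fun a b => ?_
      · exact (continuous_fst.const_smul c).mul continuous_snd
      · exact (continuous_fst.mul continuous_snd).const_smul c
      · simp only [smul_eq_mul]
        rw [← coe_smul, ← completion_coe_mul, ← completion_coe_mul, ← coe_smul, smul_mul_assoc]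
    smul_comm := fun c a b => by
      refine Completion.induction_on₂ a b (isClosed_eq ?_ ?_) fun a b => ?_
      · exact (continuous_fst.mul continuous_snd).const_smul c
      · exact continuous_fst.mul (continuous_snd.const_smul c)
      · simp only [smul_eq_mul]
        rw [← coe_smul, ← completion_coe_mul, ← completion_coe_mul, ← coe_smul, mul_smul_comm]
    star_smul := fun c a => by
      refine Completion.induction_on a (isClosed_eq ?_ ?_) fun a => ?_
      · exact hs.comp (continuous_const_smul c)
      · exact (continuous_const_smul (star c)).comp hs
      · rw [← coe_smul, ← completion_coe_star, ← completion_coe_star, ← coe_smul, star_smul] }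

end Completion

/-! ### Moving matrix entries along an injection of index sets -/

section Spread

variable {A : Type*} {ι κ : Type*} {σ : ι → κ}

/-- The matrix with entry `f i j` at `(σ i, σ j)` and zeros elsewhere (for injective `σ`). -/
def spread [Zero A] (σ : ι → κ) (f : ι → ι → A) (k l : κ) : A :=
  Function.extend (Prod.map σ σ) (fun p => f p.1 p.2) 0 (k, l)

theorem spread_apply [Zero A] (hσ : Function.Injective σ) (f : ι → ι → A) (i j : ι) :
    spread σ f (σ i) (σ j) = f i j :=
  (hσ.prodMap hσ).extend_apply (fun p : ι × ι => f p.1 p.2) 0 (i, j)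

theorem spread_of_left [Zero A] (f : ι → ι → A) {k : κ} (hk : ∀ i, σ i ≠ k) (l : κ) :
    spread σ f k l = 0 :=
  Function.extend_apply' _ _ _ (by rintro ⟨⟨i, j⟩, h⟩; exact hk i (Prod.ext_iff.1 h).1)

theorem spread_of_right [Zero A] (f : ι → ι → A) (k : κ) {l : κ} (hl : ∀ i, σ i ≠ l) :
    spread σ f k l = 0 :=
  Function.extend_apply' _ _ _ (by rintro ⟨⟨i, j⟩, h⟩; exact hl j (Prod.ext_iff.1 h).2)

theorem spread_cases (σ : ι → κ) (k l : κ) :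
    (∃ i j, σ i = k ∧ σ j = l) ∨ (∀ i, σ i ≠ k) ∨ ∀ i, σ i ≠ l := by
  by_cases hk : ∃ i, σ i = k
  · by_cases hl : ∃ j, σ j = l
    · obtain ⟨i, hi⟩ := hk
      obtain ⟨j, hj⟩ := hl
      exact Or.inl ⟨i, j, hi, hj⟩
    · exact Or.inr (Or.inr fun i hi => hl ⟨i, hi⟩)
  · exact Or.inr (Or.inl fun i hi => hk ⟨i, hi⟩)

theorem spread_ne_zero [Zero A] (hσ : Function.Injective σ) {f : ι → ι → A} {k l : κ}
    (h : spread σ f k l ≠ 0) : ∃ i j, σ i = k ∧ σ j = l ∧ f i j ≠ 0 := by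
  obtain ⟨i, j, rfl, rfl⟩ | hk | hl := spread_cases σ k l
  · exact ⟨i, j, rfl, rfl, by rwa [spread_apply hσ] at h⟩
  · exact absurd (spread_of_left f hk l) h
  · exact absurd (spread_of_right f k hl) h

theorem spread_zero [Zero A] (hσ : Function.Injective σ) (k l : κ) :
    spread σ (fun _ _ => (0 : A)) k l = 0 := by
  by_contra h
  obtain ⟨i, j, -, -, h⟩ := spread_ne_zero hσ h
  exact h rfl

theorem spread_add [AddZeroClass A] (hσ : Function.Injective σ) (f g : ι → ι → A) (k l : κ) :
    spread σ (fun i j => f i j + g i j) k l = spread σ f k l + spread σ g k l := by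
  obtain ⟨i, j, rfl, rfl⟩ | hk | hl := spread_cases σ k l
  · simp only [spread_apply hσ]
  · simp only [spread_of_left _ hk, add_zero]
  · simp only [spread_of_right _ _ hl, add_zero]

theorem spread_smul [AddMonoid A] [DistribSMul ℂ A] (hσ : Function.Injective σ) (c : ℂ)
    (f : ι → ι → A) (k l : κ) :
    spread σ (fun i j => c • f i j) k l = c • spread σ f k l := by
  obtain ⟨i, j, rfl, rfl⟩ | hk | hl := spread_cases σ k l
  · simp only [spread_apply hσ]
  · simp only [spread_of_left _ hk, smul_zero]
  · simp only [spread_of_right _ _ hl, smul_zero]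

theorem spread_star [AddMonoid A] [StarAddMonoid A] (hσ : Function.Injective σ)
    (f : ι → ι → A) (k l : κ) :
    spread σ (fun i j => star (f j i)) k l = star (spread σ f l k) := by
  obtain ⟨i, j, rfl, rfl⟩ | hk | hl := spread_cases σ k l
  · simp only [spread_apply hσ]
  · simp only [spread_of_left _ hk, spread_of_right _ _ hk, star_zero]
  · simp only [spread_of_left _ hl, spread_of_right _ _ hl, star_zero]

theorem spread_mul [NonUnitalNonAssocSemiring A] (hσ : Function.Injective σ)
    (f g : ι → ι → A) (s : Finset ι) (t : Finset κ) (hst : ∀ i ∈ s, σ i ∈ t)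
    (hf : ∀ i j, f i j ≠ 0 → j ∈ s) (k l : κ) :
    spread σ (fun i j => ∑ m ∈ s, f i m * g m j) k l =
      ∑ m ∈ t, spread σ f k m * spread σ g m l := by
  obtain ⟨i, j, rfl, rfl⟩ | hk | hl := spread_cases σ k l
  · rw [spread_apply hσ]
    refine Finset.sum_of_injOn σ hσ.injOn (fun i hi => hst i hi) (fun m _ hm => ?_)
      (fun m _ => by rw [spread_apply hσ, spread_apply hσ])
    by_cases h0 : spread σ f (σ i) m = 0
    · rw [h0, zero_mul]
    · obtain ⟨i', j', -, rfl, h⟩ := spread_ne_zero hσ h0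
      exact absurd ⟨j', hf i' j' h, rfl⟩ hm
  · simp only [spread_of_left _ hk, zero_mul, Finset.sum_const_zero]
  · simp only [spread_of_right _ _ hl, mul_zero, Finset.sum_const_zero]

end Spread

/-! ### The ⋆-algebra of finitely supported infinite matrices -/

section FinMat

attribute [local instance] CStarAlgebra.spectralOrder CStarAlgebra.spectralOrderedRing

variable (A : Type*) [NonUnitalCStarAlgebra A]

/-- Infinite matrices over `A` with finitely many nonzero entries. -/
def finMatSubmodule : Submodule ℂ (ℕ → ℕ → A) where
  carrier := {x | ∃ s : Finset ℕ, ∀ i j, x i j ≠ 0 → i ∈ s ∧ j ∈ s}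
  zero_mem' := ⟨∅, by simp⟩
  add_mem' := by
    rintro x y ⟨s, hs⟩ ⟨t, ht⟩
    refine ⟨s ∪ t, fun i j h => ?_⟩
    by_cases hx : x i j = 0
    · have hy : y i j ≠ 0 := by
        intro hy
        exact h (by simp [hx, hy])
      exact ⟨Finset.mem_union_right _ (ht i j hy).1, Finset.mem_union_right _ (ht i j hy).2⟩
    · exact ⟨Finset.mem_union_left _ (hs i j hx).1, Finset.mem_union_left _ (hs i j hx).2⟩
  smul_mem' := by
    rintro c x ⟨s, hs⟩
    refine ⟨s, fun i j h => hs i j fun hx => h (by simp [hx])⟩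

/-- `M_∞(A)`, the increasing union of the matrix algebras `M_n(A)` along the upper left corner
embeddings. -/
def FinMat : Type _ := finMatSubmodule A

instance : AddCommGroup (FinMat A) := inferInstanceAs (AddCommGroup (finMatSubmodule A))
instance : Module ℂ (FinMat A) := inferInstanceAs (Module ℂ (finMatSubmodule A))

variable {A}

namespace FinMat

/-- The entries of a finitely supported matrix. -/
def entry (x : FinMat A) : ℕ → ℕ → A := Subtype.val x

/-- The nonzero entries of `x` lie in the rows and columns indexed by `s`. -/
def SuppOn (x : FinMat A) (s : Finset ℕ) : Prop := ∀ i j, x.entry i j ≠ 0 → i ∈ s ∧ j ∈ s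

theorem exists_suppOn (x : FinMat A) : ∃ s, SuppOn x s := Subtype.property x

theorem ext' {x y : FinMat A} (h : ∀ i j, x.entry i j = y.entry i j) : x = y :=
  Subtype.ext (funext fun i => funext fun j => h i j)

theorem SuppOn.mono {x : FinMat A} {s t : Finset ℕ} (h : SuppOn x s) (hst : s ⊆ t) :
    SuppOn x t := fun i j hij => ⟨hst (h i j hij).1, hst (h i j hij).2⟩

/-- The matrix with given entries. -/
def mk (f : ℕ → ℕ → A) (s : Finset ℕ) (h : ∀ i j, f i j ≠ 0 → i ∈ s ∧ j ∈ s) : FinMat A :=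
  ⟨f, s, h⟩

@[simp] theorem entry_mk (f : ℕ → ℕ → A) (s h) : (mk f s h).entry = f := rfl
@[simp] theorem entry_zero (i j : ℕ) : (0 : FinMat A).entry i j = 0 := rfl
@[simp] theorem entry_add (x y : FinMat A) (i j : ℕ) :
    (x + y).entry i j = x.entry i j + y.entry i j := rfl
@[simp] theorem entry_smul (c : ℂ) (x : FinMat A) (i j : ℕ) :
    (c • x).entry i j = c • x.entry i j := rfl

/-- The finite submatrix of `x` on the rows and columns indexed by `s`. -/
def corner (s : Finset ℕ) : FinMat A →ₗ[ℂ] CStarMatrix s s A where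
  toFun x := CStarMatrix.ofMatrix fun i j => x.entry i j
  map_add' _ _ := rfl
  map_smul' _ _ := rfl

@[simp] theorem corner_apply (s : Finset ℕ) (x : FinMat A) (i j : s) :
    corner s x i j = x.entry i j := rfl

theorem corner_inj {x y : FinMat A} {s : Finset ℕ} (hx : SuppOn x s) (hy : SuppOn y s)
    (h : corner s x = corner s y) : x = y := by
  refine ext' fun i j => ?_
  by_cases hij : i ∈ s ∧ j ∈ s
  · exact congrFun (congrFun h ⟨i, hij.1⟩) ⟨j, hij.2⟩
  · rw [not_imp_comm.1 (hx i j) hij, not_imp_comm.1 (hy i j) hij]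

theorem finite_supp (x y : FinMat A) (i j : ℕ) :
    (Function.support fun k => x.entry i k * y.entry k j).Finite := by
  obtain ⟨s, hs⟩ := x.exists_suppOn
  refine s.finite_toSet.subset fun k hk => (hs i k fun h => hk ?_).2
  simp [h]

/-- Matrix multiplication. -/
instance : Mul (FinMat A) where
  mul x y := ⟨fun i j => ∑ᶠ k, x.entry i k * y.entry k j, by
    obtain ⟨s, hs⟩ := x.exists_suppOn
    obtain ⟨t, ht⟩ := y.exists_suppOn
    refine ⟨s ∪ t, fun i j h => ?_⟩
    obtain ⟨k, hk⟩ : ∃ k, x.entry i k * y.entry k j ≠ 0 := by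
      by_contra! h0
      exact h (by simp [h0])
    exact ⟨Finset.mem_union_left _ (hs i k fun h => hk (by simp [h])).1,
      Finset.mem_union_right _ (ht k j fun h => hk (by simp [h])).2⟩⟩

/-- The conjugate transpose. -/
instance : Star (FinMat A) where
  star x := ⟨fun i j => star (x.entry j i), by
    obtain ⟨s, hs⟩ := x.exists_suppOn
    exact ⟨s, fun i j h => (hs j i fun h0 => h (by simp [h0])).symm⟩⟩

theorem entry_mul (x y : FinMat A) (i j : ℕ) :
    (x * y).entry i j = ∑ᶠ k, x.entry i k * y.entry k j := rfl

@[simp] theorem entry_star (x : FinMat A) (i j : ℕ) :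
    (star x).entry i j = star (x.entry j i) := rfl

theorem entry_mul_of_suppOn {x : FinMat A} {s : Finset ℕ} (hx : SuppOn x s) (y : FinMat A)
    (i j : ℕ) : (x * y).entry i j = ∑ k ∈ s, x.entry i k * y.entry k j := by
  rw [entry_mul]
  refine finsum_eq_sum_of_support_subset _ fun k hk => (hx i k fun h => hk ?_).2
  simp [h]

theorem SuppOn.mul {x y : FinMat A} {s : Finset ℕ} (hx : SuppOn x s) (hy : SuppOn y s) :
    SuppOn (x * y) s := fun i j h => by
  obtain ⟨k, hk⟩ : ∃ k, x.entry i k * y.entry k j ≠ 0 := by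
    by_contra! h0
    exact h (by simp [entry_mul, h0])
  exact ⟨(hx i k fun h => hk (by simp [h])).1, (hy k j fun h => hk (by simp [h])).2⟩

theorem SuppOn.add {x y : FinMat A} {s : Finset ℕ} (hx : SuppOn x s) (hy : SuppOn y s) :
    SuppOn (x + y) s := fun i j h => by
  by_cases h0 : x.entry i j = 0
  · exact hy i j fun h1 => h (by simp [h0, h1])
  · exact hx i j h0

theorem SuppOn.star {x : FinMat A} {s : Finset ℕ} (hx : SuppOn x s) : SuppOn (star x) s :=
  fun i j h => (hx j i fun h0 => h (by simp [h0])).symm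

theorem SuppOn.smul {x : FinMat A} {s : Finset ℕ} (hx : SuppOn x s) (c : ℂ) :
    SuppOn (c • x) s := fun i j h => hx i j fun h0 => h (by simp [h0])

theorem suppOn_zero (s : Finset ℕ) : SuppOn (0 : FinMat A) s := fun _ _ h => absurd rfl h

theorem corner_mul {x : FinMat A} {s : Finset ℕ} (hx : SuppOn x s) (y : FinMat A) :
    corner s (x * y) = corner s x * corner s y := by
  ext i j
  rw [CStarMatrix.mul_apply, corner_apply, entry_mul_of_suppOn hx, ← Finset.sum_coe_sort]
  rfl

theorem corner_star (x : FinMat A) (s : Finset ℕ) :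
    corner s (star x) = star (corner s x) := rfl

theorem exists_suppOn₂ (x y : FinMat A) : ∃ s, SuppOn x s ∧ SuppOn y s := by
  obtain ⟨s, hs⟩ := x.exists_suppOn
  obtain ⟨t, ht⟩ := y.exists_suppOn
  exact ⟨s ∪ t, hs.mono Finset.subset_union_left, ht.mono Finset.subset_union_right⟩

theorem exists_suppOn₃ (x y z : FinMat A) : ∃ s, SuppOn x s ∧ SuppOn y s ∧ SuppOn z s := by
  obtain ⟨s, hs, hs'⟩ := exists_suppOn₂ x y
  obtain ⟨t, ht⟩ := z.exists_suppOn
  exact ⟨s ∪ t, hs.mono Finset.subset_union_left, hs'.mono Finset.subset_union_left,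
    ht.mono Finset.subset_union_right⟩

instance : NonUnitalRing (FinMat A) :=
  { (inferInstance : AddCommGroup (FinMat A)), (inferInstance : Mul (FinMat A)) with
    zero_mul := fun x => by
      obtain ⟨s, hx⟩ := x.exists_suppOn
      have h0 := suppOn_zero (A := A) s
      exact corner_inj (h0.mul hx) h0 (by rw [corner_mul h0, map_zero, zero_mul])
    mul_zero := fun x => by
      obtain ⟨s, hx⟩ := x.exists_suppOn
      have h0 := suppOn_zero (A := A) s
      exact corner_inj (hx.mul h0) h0 (by rw [corner_mul hx, map_zero, mul_zero])
    mul_assoc := fun x y z => by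
      obtain ⟨s, hx, hy, hz⟩ := exists_suppOn₃ x y z
      refine corner_inj ((hx.mul hy).mul hz) (hx.mul (hy.mul hz)) ?_
      rw [corner_mul (hx.mul hy), corner_mul hx, corner_mul hx, corner_mul hy, mul_assoc]
    left_distrib := fun x y z => by
      obtain ⟨s, hx, hy, hz⟩ := exists_suppOn₃ x y z
      refine corner_inj (hx.mul (hy.add hz)) ((hx.mul hy).add (hx.mul hz)) ?_
      rw [corner_mul hx, map_add, map_add, corner_mul hx, corner_mul hx, mul_add]
    right_distrib := fun x y z => by
      obtain ⟨s, hx, hy, hz⟩ := exists_suppOn₃ x y z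
      refine corner_inj ((hx.add hy).mul hz) ((hx.mul hz).add (hy.mul hz)) ?_
      rw [corner_mul (hx.add hy), map_add, map_add, corner_mul hx, corner_mul hy, add_mul] }

instance : StarRing (FinMat A) where
  star_involutive x := ext' fun i j => by simp
  star_add x y := ext' fun i j => by simp
  star_mul x y := by
    obtain ⟨s, hx, hy⟩ := exists_suppOn₂ x y
    refine corner_inj (hx.mul hy).star (hy.star.mul hx.star) ?_
    rw [corner_star, corner_mul hx, corner_mul hy.star, corner_star, corner_star, star_mul]

instance : StarModule ℂ (FinMat A) where
  star_smul c x := ext' fun i j => by simp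

instance : IsScalarTower ℂ (FinMat A) (FinMat A) where
  smul_assoc c x y := by
    obtain ⟨s, hx, hy⟩ := exists_suppOn₂ x y
    refine corner_inj ((hx.smul c).mul hy) ((hx.mul hy).smul c) ?_
    rw [smul_eq_mul, smul_eq_mul, corner_mul (hx.smul c), map_smul, map_smul, corner_mul hx,
      smul_mul_assoc]

instance : SMulCommClass ℂ (FinMat A) (FinMat A) where
  smul_comm c x y := by
    obtain ⟨s, hx, hy⟩ := exists_suppOn₂ x y
    refine corner_inj ((hx.mul hy).smul c) (hx.mul (hy.smul c)) ?_
    rw [smul_eq_mul, smul_eq_mul, corner_mul hx, map_smul, map_smul, corner_mul hx,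
      mul_smul_comm]

/-- The embedding of finite matrix algebras induced by an injection of the index sets. -/
def emb {ι κ : Type*} [Fintype ι] [Fintype κ] (f : ι → κ) (hf : Function.Injective f) :
    CStarMatrix ι ι A →⋆ₙₐ[ℂ] CStarMatrix κ κ A where
  toFun M := CStarMatrix.ofMatrix (spread f fun i j => M i j)
  map_smul' c M := by
    ext k l
    exact spread_smul hf c (fun i j => M i j) k l
  map_zero' := by
    ext k l
    exact spread_zero hf k l
  map_add' M N := by
    ext k l
    exact spread_add hf (fun i j => M i j) (fun i j => N i j) k l
  map_mul' M N := by
    ext k l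
    have h1 : (fun i j => (M * N) i j) =
        fun i j => ∑ m ∈ Finset.univ, M i m * N m j := by
      funext i j
      exact CStarMatrix.mul_apply
    rw [CStarMatrix.mul_apply]
    change spread f (fun i j => (M * N) i j) k l = _
    rw [h1]
    exact spread_mul hf (fun i j => M i j) (fun i j => N i j) _ _ (by simp) (by simp) k l
  map_star' M := by
    ext k l
    exact spread_star hf (fun i j => M i j) k l

theorem emb_apply {ι κ : Type*} [Fintype ι] [Fintype κ] (f : ι → κ)
    (hf : Function.Injective f) (M : CStarMatrix ι ι A) (i j : ι) :
    emb f hf M (f i) (f j) = M i j :=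
  spread_apply hf (fun i j => M i j) i j

theorem emb_injective {ι κ : Type*} [Fintype ι] [Fintype κ] (f : ι → κ)
    (hf : Function.Injective f) : Function.Injective (emb (A := A) f hf) := fun M N h => by
  ext i j
  rw [← emb_apply f hf M, h, emb_apply]

theorem norm_emb {ι κ : Type*} [Fintype ι] [Fintype κ] (f : ι → κ)
    (hf : Function.Injective f) (M : CStarMatrix ι ι A) : ‖emb f hf M‖ = ‖M‖ :=
  NonUnitalStarAlgHom.norm_map (emb f hf) (emb_injective f hf) M

/-- Relabelling of rows and columns along an injection `σ : ℕ → ℕ`: conjugation by the isometry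
of `ℓ²(ℕ)` sending the `i`-th basis vector to the `σ i`-th one. -/
def reindex (σ : ℕ → ℕ) (hσ : Function.Injective σ) : FinMat A →⋆ₙₐ[ℂ] FinMat A where
  toFun x := ⟨spread σ x.entry, by
    obtain ⟨s, hs⟩ := x.exists_suppOn
    refine ⟨s.image σ, fun k l h => ?_⟩
    obtain ⟨i, j, rfl, rfl, h'⟩ := spread_ne_zero hσ h
    exact ⟨Finset.mem_image_of_mem σ (hs i j h').1, Finset.mem_image_of_mem σ (hs i j h').2⟩⟩
  map_smul' c x := ext' fun k l => spread_smul hσ c x.entry k l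
  map_zero' := ext' fun k l => spread_zero hσ k l
  map_add' x y := ext' fun k l => spread_add hσ x.entry y.entry k l
  map_mul' x y := by
    obtain ⟨s, hs⟩ := x.exists_suppOn
    refine ext' fun k l => ?_
    have h1 : (x * y).entry = fun i j => ∑ m ∈ s, x.entry i m * y.entry m j := by
      funext i j
      exact entry_mul_of_suppOn hs y i j
    have h2 : ∀ k m, spread σ x.entry k m ≠ 0 → k ∈ s.image σ ∧ m ∈ s.image σ := by
      intro k m h
      obtain ⟨i, j, rfl, rfl, h'⟩ := spread_ne_zero hσ h
      exact ⟨Finset.mem_image_of_mem σ (hs i j h').1, Finset.mem_image_of_mem σ (hs i j h').2⟩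
    refine Eq.trans ?_ (entry_mul_of_suppOn (s := s.image σ)
      (x := ⟨spread σ x.entry, s.image σ, h2⟩) h2 ⟨spread σ y.entry, _⟩ k l).symm
    change spread σ (x * y).entry k l = _
    rw [h1]
    exact spread_mul hσ x.entry y.entry s (s.image σ)
      (fun i hi => Finset.mem_image_of_mem σ hi) (fun i j h => (hs i j h).2) k l
  map_star' x := ext' fun k l => spread_star hσ x.entry k l

theorem entry_reindex (σ : ℕ → ℕ) (hσ : Function.Injective σ) (x : FinMat A) :
    (reindex σ hσ x).entry = spread σ x.entry := rfl

/-- `M_∞(A)` carries the C⋆-norm of any finite matrix algebra containing the given matrix. -/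
instance : Norm (FinMat A) where
  norm x := ‖corner x.exists_suppOn.choose x‖

theorem norm_corner_reindex {σ : ℕ → ℕ} (hσ : Function.Injective σ) {x : FinMat A}
    {s t : Finset ℕ} (hx : SuppOn x s) (hst : ∀ i ∈ s, σ i ∈ t) :
    ‖corner t (reindex σ hσ x)‖ = ‖corner s x‖ := by
  have hf : Function.Injective fun i : s => (⟨σ i, hst i i.2⟩ : t) := fun i j h =>
    Subtype.ext (hσ (congrArg Subtype.val h))
  rw [← norm_emb _ hf (corner s x)]
  congr 1
  ext k l
  change spread σ x.entry k l =
    spread (fun i : s => (⟨σ i, hst i i.2⟩ : t)) (fun i j : s => x.entry i j) k l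
  obtain ⟨i, j, rfl, rfl⟩ | hk | hl := spread_cases (fun i : s => (⟨σ i, hst i i.2⟩ : t)) k l
  · exact (spread_apply hσ x.entry i j).trans
      (spread_apply hf (fun i j : s => x.entry i j) i j).symm
  · rw [spread_of_left _ hk]
    by_contra h
    obtain ⟨i, j, hi, -, h⟩ := spread_ne_zero hσ h
    exact hk ⟨i, (hx i j h).1⟩ (Subtype.ext hi)
  · rw [spread_of_right _ _ hl]
    by_contra h
    obtain ⟨i, j, -, hj, h⟩ := spread_ne_zero hσ h
    exact hl ⟨j, (hx i j h).2⟩ (Subtype.ext hj)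

theorem reindex_id (x : FinMat A) : reindex id Function.injective_id x = x :=
  ext' fun i j => spread_apply Function.injective_id x.entry i j

theorem norm_corner_mono {x : FinMat A} {s t : Finset ℕ} (hx : SuppOn x s) (hst : s ⊆ t) :
    ‖corner t x‖ = ‖corner s x‖ := by
  have := norm_corner_reindex Function.injective_id hx (t := t) fun i hi => hst hi
  rwa [reindex_id] at this

theorem norm_eq {x : FinMat A} {s : Finset ℕ} (hx : SuppOn x s) : ‖x‖ = ‖corner s x‖ := by
  have h := x.exists_suppOn.choose_spec
  rw [← norm_corner_mono hx (t := s ∪ x.exists_suppOn.choose) Finset.subset_union_left,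
    norm_corner_mono h Finset.subset_union_right]
  rfl

theorem normCore : NormedSpace.Core ℂ (FinMat A) where
  norm_nonneg x := norm_nonneg (corner _ x)
  norm_smul c x := by
    obtain ⟨s, hx⟩ := x.exists_suppOn
    rw [norm_eq (hx.smul c), norm_eq hx, map_smul, norm_smul]
  norm_triangle x y := by
    obtain ⟨s, hx, hy⟩ := exists_suppOn₂ x y
    rw [norm_eq (hx.add hy), norm_eq hx, norm_eq hy, map_add]
    exact norm_add_le _ _
  norm_eq_zero_iff x := by
    obtain ⟨s, hx⟩ := x.exists_suppOn
    rw [norm_eq hx, norm_eq_zero]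
    exact ⟨fun h => corner_inj hx (suppOn_zero s) (by rw [h, map_zero]), fun h => by
      rw [h, map_zero]⟩

instance : NormedAddCommGroup (FinMat A) := NormedAddCommGroup.ofCore normCore

instance : NormedSpace ℂ (FinMat A) := NormedSpace.ofCore normCore

instance : NonUnitalNormedRing (FinMat A) :=
  { (inferInstance : NormedAddCommGroup (FinMat A)),
    (inferInstance : NonUnitalRing (FinMat A)) with
    norm_mul_le := fun x y => by
      obtain ⟨s, hx, hy⟩ := exists_suppOn₂ x y
      rw [norm_eq (hx.mul hy), norm_eq hx, norm_eq hy, corner_mul hx]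
      exact norm_mul_le _ _ }

instance : CStarRing (FinMat A) where
  norm_mul_self_le x := by
    obtain ⟨s, hx⟩ := x.exists_suppOn
    rw [norm_eq (hx.star.mul hx), norm_eq hx, corner_mul hx.star, corner_star]
    exact CStarRing.norm_mul_self_le _

theorem norm_reindex (σ : ℕ → ℕ) (hσ : Function.Injective σ) (x : FinMat A) :
    ‖reindex σ hσ x‖ = ‖x‖ := by
  obtain ⟨s, hx⟩ := x.exists_suppOn
  have h : SuppOn (reindex σ hσ x) (s.image σ) := fun k l h => by
    obtain ⟨i, j, rfl, rfl, h'⟩ := spread_ne_zero hσ h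
    exact ⟨Finset.mem_image_of_mem σ (hx i j h').1, Finset.mem_image_of_mem σ (hx i j h').2⟩
  rw [norm_eq h, norm_eq hx,
    norm_corner_reindex hσ hx fun i hi => Finset.mem_image_of_mem σ hi]

/-- Entrywise application of a ⋆-homomorphism. -/
def map {B : Type*} [NonUnitalCStarAlgebra B] (φ : A →⋆ₙₐ[ℂ] B) :
    FinMat A →⋆ₙₐ[ℂ] FinMat B where
  toFun x := ⟨fun i j => φ (x.entry i j), by
    obtain ⟨s, hs⟩ := x.exists_suppOn
    exact ⟨s, fun i j h => hs i j fun h0 => h (by simp only [h0, map_zero])⟩⟩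
  map_smul' c x := ext' fun i j => map_smul φ c (x.entry i j)
  map_zero' := ext' fun i j => map_zero φ
  map_add' x y := ext' fun i j => map_add φ (x.entry i j) (y.entry i j)
  map_mul' x y := ext' fun i j => by
    change φ (∑ᶠ k, x.entry i k * y.entry k j) = ∑ᶠ k, φ (x.entry i k) * φ (y.entry k j)
    simp only [← map_mul]
    exact (φ : A →+ B).map_finsum (finite_supp x y i j)
  map_star' x := ext' fun i j => map_star φ (x.entry j i)

theorem norm_map_le {B : Type*} [NonUnitalCStarAlgebra B] (φ : A →⋆ₙₐ[ℂ] B) (x : FinMat A) :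
    ‖map φ x‖ ≤ ‖x‖ := by
  obtain ⟨s, hx⟩ := x.exists_suppOn
  have h : SuppOn (map φ x) s := fun i j h => hx i j fun h0 => h (by
    change φ (x.entry i j) = 0
    rw [h0, map_zero])
  rw [norm_eq h, norm_eq hx]
  exact NonUnitalStarAlgHom.norm_apply_le (CStarMatrix.mapₙₐ φ) (corner s x)

/-- The upper left corner embedding `A → M_∞(A)`. -/
def single (a : A) : FinMat A :=
  mk (fun i j => if i = 0 ∧ j = 0 then a else 0) {0} fun i j h => by
    by_contra h0
    exact h (if_neg fun h1 => h0 (by simp [h1.1, h1.2]))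

end FinMat

end FinMat
/-! ### The stabilization `A ⊗ K` -/

section Stab

open UniformSpace

variable (A : Type*) [NonUnitalCStarAlgebra A]

/-- The stabilization `A ⊗ K`: the C⋆-algebra inductive limit of the matrix algebras `M_n(A)`,
that is, the completion of `M_∞(A)`. -/
def Stab : Type _ := Completion (FinMat A)

instance : NonUnitalCStarAlgebra (Stab A) := completionCStarAlgebra (E := FinMat A)

variable {A} {B : Type*} [NonUnitalCStarAlgebra B]

namespace Stab

/-- The inclusion of `M_∞(A)` into `A ⊗ K`. -/
def ofFin : FinMat A →⋆ₙₐ[ℂ] Stab A where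
  toFun x := (x : Completion (FinMat A))
  map_smul' c x := Completion.coe_smul c x
  map_zero' := rfl
  map_add' x y := Completion.coe_add x y
  map_mul' x y := completion_coe_mul x y
  map_star' x := completion_coe_star x

theorem norm_ofFin (x : FinMat A) : ‖ofFin x‖ = ‖x‖ := Completion.norm_coe x

theorem continuous_ofFin : Continuous (ofFin : FinMat A → Stab A) :=
  Completion.continuous_coe (FinMat A)

theorem denseRange_ofFin : DenseRange (ofFin : FinMat A → Stab A) :=
  Completion.denseRange_coe

theorem uniformContinuous_of_norm_le {f : FinMat A →⋆ₙₐ[ℂ] FinMat B} (hf : ∀ x, ‖f x‖ ≤ ‖x‖) :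
    UniformContinuous f :=
  (AddMonoidHomClass.lipschitz_of_bound f 1 fun x => by rw [one_mul]; exact hf x).uniformContinuous

/-- The continuous extension of a contractive ⋆-homomorphism to the stabilizations. -/
def lift (f : FinMat A →⋆ₙₐ[ℂ] FinMat B) (hf : ∀ x, ‖f x‖ ≤ ‖x‖) : Stab A →⋆ₙₐ[ℂ] Stab B :=
  let F : Stab A → Stab B := Completion.map f
  have hF : Continuous F := Completion.continuous_map
  have hcoe : ∀ x, F (ofFin x) = ofFin (f x) :=
    Completion.map_coe (uniformContinuous_of_norm_le hf)
  { toFun := F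
    map_smul' := fun c x => by
      refine denseRange_ofFin.induction_on x (isClosed_eq (hF.comp (continuous_const_smul c))
        ((continuous_const_smul c).comp hF)) fun x => ?_
      rw [← map_smul, hcoe, hcoe, map_smul, map_smul]
      rfl
    map_zero' := by
      have := hcoe 0
      rwa [map_zero, map_zero, map_zero] at this
    map_add' := fun x y => by
      refine denseRange_ofFin.induction_on₂ (isClosed_eq (hF.comp continuous_add) ?_)
        (fun x y => ?_) x y
      · exact (hF.comp continuous_fst).add (hF.comp continuous_snd)
      · rw [← map_add, hcoe, hcoe, hcoe, map_add, map_add]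
    map_mul' := fun x y => by
      refine denseRange_ofFin.induction_on₂ (isClosed_eq (hF.comp continuous_mul) ?_)
        (fun x y => ?_) x y
      · exact (hF.comp continuous_fst).mul (hF.comp continuous_snd)
      · rw [← map_mul, hcoe, hcoe, hcoe, map_mul, map_mul]
    map_star' := fun x => by
      refine denseRange_ofFin.induction_on x (isClosed_eq (hF.comp continuous_star)
        (continuous_star.comp hF)) fun x => ?_
      rw [← map_star, hcoe, hcoe, map_star, map_star] }

theorem lift_ofFin (f : FinMat A →⋆ₙₐ[ℂ] FinMat B) (hf : ∀ x, ‖f x‖ ≤ ‖x‖) (x : FinMat A) :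
    lift f hf (ofFin x) = ofFin (f x) :=
  Completion.map_coe (uniformContinuous_of_norm_le hf) x

theorem continuous_lift (f : FinMat A →⋆ₙₐ[ℂ] FinMat B) (hf : ∀ x, ‖f x‖ ≤ ‖x‖) :
    Continuous (lift f hf) := Completion.continuous_map

theorem hom_ext {F H : Stab A → Stab B} (hF : Continuous F) (hH : Continuous H)
    (h : ∀ x, F (ofFin x) = H (ofFin x)) (x : Stab A) : F x = H x :=
  denseRange_ofFin.induction_on x (isClosed_eq hF hH) h

/-- The ⋆-homomorphism `φ ⊗ id : A ⊗ K → B ⊗ K`. -/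
def map (φ : A →⋆ₙₐ[ℂ] B) : Stab A →⋆ₙₐ[ℂ] Stab B :=
  lift (FinMat.map φ) (FinMat.norm_map_le φ)

/-- The endomorphism of `A ⊗ K` given by relabelling rows and columns along `σ`. -/
def reindex (σ : ℕ → ℕ) (hσ : Function.Injective σ) : Stab A →⋆ₙₐ[ℂ] Stab A :=
  lift (FinMat.reindex σ hσ) fun x => (FinMat.norm_reindex σ hσ x).le

theorem reindex_ofFin (σ : ℕ → ℕ) (hσ : Function.Injective σ) (x : FinMat A) :
    reindex σ hσ (ofFin x) = ofFin (FinMat.reindex σ hσ x) := lift_ofFin _ _ x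

theorem continuous_reindex (σ : ℕ → ℕ) (hσ : Function.Injective σ) :
    Continuous (reindex (A := A) σ hσ) := continuous_lift _ _

theorem reindex_reindex (σ τ : ℕ → ℕ) (hσ : Function.Injective σ) (hτ : Function.Injective τ)
    (x : Stab A) : reindex σ hσ (reindex τ hτ x) = reindex (σ ∘ τ) (hσ.comp hτ) x := by
  refine hom_ext ((continuous_reindex σ hσ).comp (continuous_reindex τ hτ))
    (continuous_reindex _ _) (fun x => ?_) x
  change reindex σ hσ (reindex τ hτ (ofFin x)) = _
  rw [reindex_ofFin, reindex_ofFin, reindex_ofFin]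
  congr 1
  refine FinMat.ext' fun k l => ?_
  simp only [FinMat.entry_reindex]
  obtain ⟨i, j, rfl, rfl⟩ | hk | hl := spread_cases σ k l
  · rw [spread_apply hσ]
    obtain ⟨a, b, rfl, rfl⟩ | hk | hl := spread_cases τ i j
    · rw [spread_apply hτ]
      exact (spread_apply (hσ.comp hτ) x.entry a b).symm
    · rw [spread_of_left _ hk, spread_of_left (σ := σ ∘ τ) _ fun a ha => hk a (hσ ha)]
    · rw [spread_of_right _ _ hl, spread_of_right (σ := σ ∘ τ) _ _ fun a ha => hl a (hσ ha)]
  · rw [spread_of_left _ hk, spread_of_left (σ := σ ∘ τ) _ fun a ha => hk (τ a) ha]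
  · rw [spread_of_right _ _ hl, spread_of_right (σ := σ ∘ τ) _ _ fun a ha => hl (τ a) ha]

theorem reindex_mul_reindex (σ τ : ℕ → ℕ) (hσ : Function.Injective σ)
    (hτ : Function.Injective τ) (h : ∀ i j, σ i ≠ τ j) (x y : Stab A) :
    reindex σ hσ x * reindex τ hτ y = 0 := by
  refine denseRange_ofFin.induction_on₂ (p := fun x y : Stab A =>
    reindex σ hσ x * reindex τ hτ y = 0) (isClosed_eq ?_ continuous_const) (fun x y => ?_) x y
  · exact ((continuous_reindex σ hσ).comp continuous_fst).mul
      ((continuous_reindex τ hτ).comp continuous_snd)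
  · rw [reindex_ofFin, reindex_ofFin, ← map_mul, ← map_zero ofFin]
    congr 1
    refine FinMat.ext' fun k l => ?_
    rw [FinMat.entry_mul, FinMat.entry_zero]
    refine finsum_eq_zero_of_forall_eq_zero fun m => ?_
    by_contra h0
    have h1 : spread σ x.entry k m ≠ 0 := fun h1 => h0 (by
      rw [FinMat.entry_reindex, h1, zero_mul])
    have h2 : spread τ y.entry m l ≠ 0 := fun h2 => h0 (by
      rw [FinMat.entry_reindex τ, h2, mul_zero])
    obtain ⟨-, j, -, hj, -⟩ := spread_ne_zero hσ h1
    obtain ⟨i, -, hi, -, -⟩ := spread_ne_zero hτ h2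
    exact h j i (hj.trans hi.symm)

theorem map_reindex (φ : A →⋆ₙₐ[ℂ] B) (σ : ℕ → ℕ) (hσ : Function.Injective σ) (x : Stab A) :
    map φ (reindex σ hσ x) = reindex σ hσ (map φ x) := by
  refine hom_ext ((continuous_lift _ _).comp (continuous_reindex σ hσ))
    ((continuous_reindex σ hσ).comp (continuous_lift _ _)) (fun x => ?_) x
  change map φ (reindex σ hσ (ofFin x)) = reindex σ hσ (map φ (ofFin x))
  rw [reindex_ofFin, map, lift_ofFin, lift_ofFin, reindex_ofFin]
  congr 1
  refine FinMat.ext' fun k l => ?_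
  change φ (spread σ x.entry k l) = spread σ (fun i j => φ (x.entry i j)) k l
  obtain ⟨i, j, rfl, rfl⟩ | hk | hl := spread_cases σ k l
  · rw [spread_apply hσ, spread_apply hσ]
  · rw [spread_of_left _ hk, spread_of_left _ hk, map_zero]
  · rw [spread_of_right _ _ hl, spread_of_right _ _ hl, map_zero]

end Stab

/-- Left multiplication of a finitely supported matrix by the isometry with `i ↦ σ i`. -/
def FinMat.rowShift (σ : ℕ → ℕ) (hσ : Function.Injective σ) (u : FinMat A) : FinMat A :=
  ⟨fun k j => Function.extend σ (fun i => u.entry i j) 0 k, by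
    obtain ⟨s, hs⟩ := u.exists_suppOn
    refine ⟨s ∪ s.image σ, fun k j h => ?_⟩
    by_cases hk : ∃ i, σ i = k
    · obtain ⟨i, rfl⟩ := hk
      replace h : Function.extend σ (fun i => u.entry i j) 0 (σ i) ≠ 0 := h
      rw [hσ.extend_apply] at h
      exact ⟨Finset.mem_union_right _ (Finset.mem_image_of_mem σ (hs i j h).1),
        Finset.mem_union_left _ (hs i j h).2⟩
    · replace h : Function.extend σ (fun i => u.entry i j) 0 k ≠ 0 := h
      rw [Function.extend_apply' _ _ _ hk] at h
      exact absurd rfl h⟩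

theorem FinMat.rowShift_mul (σ : ℕ → ℕ) (hσ : Function.Injective σ) (u x : FinMat A) :
    rowShift σ hσ (u * x) = rowShift σ hσ u * x := by
  refine ext' fun k j => ?_
  change Function.extend σ (fun i => (u * x).entry i j) 0 k =
    ∑ᶠ m, Function.extend σ (fun i => u.entry i m) 0 k * x.entry m j
  by_cases hk : ∃ i, σ i = k
  · obtain ⟨i, rfl⟩ := hk
    simp only [hσ.extend_apply]
    rfl
  · simp only [Function.extend_apply' _ _ _ hk, Pi.zero_apply, zero_mul, finsum_zero]

theorem FinMat.reindex_eq (σ : ℕ → ℕ) (hσ : Function.Injective σ) (x : FinMat A) :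
    reindex σ hσ x = rowShift σ hσ (star (rowShift σ hσ (star x))) := by
  refine ext' fun k l => ?_
  change spread σ x.entry k l = Function.extend σ
    (fun i => star (Function.extend σ (fun j => star (x.entry i j)) 0 l)) 0 k
  obtain ⟨i, j, rfl, rfl⟩ | hk | hl := spread_cases σ k l
  · rw [spread_apply hσ, hσ.extend_apply, hσ.extend_apply, star_star]
  · rw [spread_of_left _ hk, Function.extend_apply' _ _ _ fun ⟨i, hi⟩ => hk i hi]
    rfl
  · rw [spread_of_right _ _ hl]
    by_cases hk : ∃ i, σ i = k
    · obtain ⟨i, rfl⟩ := hk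
      rw [hσ.extend_apply, Function.extend_apply' _ _ _ fun ⟨i, hi⟩ => hl i hi]
      simp
    · rw [Function.extend_apply' _ _ _ hk]
      rfl

theorem FinMat.rowShift_conj (σ : ℕ → ℕ) (hσ : Function.Injective σ) (u x : FinMat A) :
    rowShift σ hσ u * x * star (rowShift σ hσ u) = reindex σ hσ (u * x * star u) := by
  have h : star (u * x * star u) = u * (star x * star u) := by
    rw [star_mul, star_star, star_mul]
  rw [reindex_eq, h, rowShift_mul, star_mul, star_mul, star_star, star_star, rowShift_mul,
    rowShift_mul]

theorem FinMat.star_rowShift_mul_rowShift (σ : ℕ → ℕ) (hσ : Function.Injective σ)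
    (u v : FinMat A) : star (rowShift σ hσ u) * rowShift σ hσ v = star u * v := by
  refine ext' fun i j => ?_
  change (∑ᶠ m, star (Function.extend σ (fun k => u.entry k i) 0 m) *
    Function.extend σ (fun k => v.entry k j) 0 m) = ∑ᶠ k, star (u.entry k i) * v.entry k j
  have h : ∀ m, star (Function.extend σ (fun k => u.entry k i) 0 m) *
      Function.extend σ (fun k => v.entry k j) 0 m = ∑ᶠ _ : m ∈ Set.range σ,
      star (Function.extend σ (fun k => u.entry k i) 0 m) *
        Function.extend σ (fun k => v.entry k j) 0 m := fun m => by
    by_cases hm : m ∈ Set.range σ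
    · simp [hm]
    · rw [Function.extend_apply' _ _ _ hm]
      simp [hm]
  rw [finsum_congr h, finsum_mem_range hσ]
  exact finsum_congr fun k => by rw [hσ.extend_apply, hσ.extend_apply]

theorem FinMat.star_rowShift_conj (σ : ℕ → ℕ) (hσ : Function.Injective σ) (u x : FinMat A) :
    star (rowShift σ hσ u) * reindex σ hσ x * rowShift σ hσ u = star u * x * u := by
  rw [reindex_eq, star_rowShift_mul_rowShift, mul_assoc, star_rowShift_mul_rowShift, star_star,
    mul_assoc]

end Stab

/-! ### Cuntz comparison -/

section Cuntz

variable {B : Type*} [NonUnitalCStarAlgebra B]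

/-- Positive elements of a C⋆-algebra. -/
def IsPos (a : B) : Prop := ∃ c : B, a = star c * c

/-- Cuntz subequivalence of positive elements of a C⋆-algebra: `a = lim wₙ b wₙ*`. -/
def CuntzSub (a b : B) : Prop :=
  ∃ w : ℕ → B, Tendsto (fun n => w n * b * star (w n)) atTop (𝓝 a)

/-- Cuntz equivalence. -/
def CuntzEquiv (a b : B) : Prop := CuntzSub a b ∧ CuntzSub b a

theorem cuntzSub_iff {a b : B} :
    CuntzSub a b ↔ ∀ ε > 0, ∃ w : B, ‖w * b * star w - a‖ < ε := by
  constructor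
  · rintro ⟨w, hw⟩ ε hε
    obtain ⟨n, hn⟩ := ((Metric.tendsto_nhds.1 hw) ε hε).exists
    exact ⟨w n, by rwa [dist_eq_norm] at hn⟩
  · intro h
    choose w hw using fun n : ℕ => h (1 / ((n : ℝ) + 1)) Nat.one_div_pos_of_nat
    refine ⟨w, tendsto_iff_norm_sub_tendsto_zero.2 ?_⟩
    exact squeeze_zero (fun n => norm_nonneg _) (fun n => (hw n).le)
      tendsto_one_div_add_atTop_nhds_zero_nat

theorem exists_approx_conj (a : B) {ε : ℝ} (hε : 0 < ε) : ∃ w : B, ‖w * a * star w - a‖ < ε := by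
  let _ := CStarAlgebra.spectralOrder B
  let _ := CStarAlgebra.spectralOrderedRing B
  have hl := CStarAlgebra.increasingApproximateUnit B
  have h1 : Tendsto (fun e => e * a * e - a) (CStarAlgebra.approximateUnit B) (𝓝 0) := by
    have h2 : Tendsto (fun e => (e * a - a) * e + (a * e - a))
        (CStarAlgebra.approximateUnit B) (𝓝 0) := by
      have h3 : Tendsto (fun e : B => (e * a - a) * e) (CStarAlgebra.approximateUnit B) (𝓝 0) := by
        have h4 := (hl.tendsto_mul_right a).sub_const a
        rw [sub_self] at h4
        refine squeeze_zero_norm' ?_ (tendsto_norm_zero.comp h4)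
        filter_upwards [hl.eventually_norm] with e he
        refine (norm_mul_le _ _).trans ?_
        exact mul_le_of_le_one_right (norm_nonneg _) he
      have h5 := (hl.tendsto_mul_left a).sub_const a
      rw [sub_self] at h5
      simpa using h3.add h5
    refine h2.congr fun e => ?_
    rw [sub_mul]
    abel
  have h6 := (Metric.tendsto_nhds.1 h1 ε hε).and hl.eventually_star_eq
  obtain ⟨e, he, he'⟩ := h6.exists
  refine ⟨e, ?_⟩
  rw [he']
  simpa using he

theorem CuntzSub.refl (a : B) : CuntzSub a a :=
  cuntzSub_iff.2 fun _ hε => exists_approx_conj a hε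

theorem CuntzSub.trans {a b c : B} (hab : CuntzSub a b) (hbc : CuntzSub b c) :
    CuntzSub a c := by
  rw [cuntzSub_iff] at hab hbc ⊢
  intro ε hε
  obtain ⟨w, hw⟩ := hab (ε / 2) (by positivity)
  obtain ⟨v, hv⟩ := hbc (ε / 2 / (‖w‖ * ‖w‖ + 1)) (by positivity)
  refine ⟨w * v, ?_⟩
  have e : w * v * c * star (w * v) - a =
      w * (v * c * star v - b) * star w + (w * b * star w - a) := by
    rw [star_mul]
    simp only [mul_sub, sub_mul, mul_assoc]
    abel
  rw [e]
  refine (norm_add_le _ _).trans_lt ?_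
  have h1 : ‖w * (v * c * star v - b) * star w‖ ≤ ε / 2 := by
    calc ‖w * (v * c * star v - b) * star w‖
        ≤ ‖w‖ * ‖v * c * star v - b‖ * ‖star w‖ :=
          (norm_mul_le _ _).trans (mul_le_mul_of_nonneg_right (norm_mul_le _ _) (norm_nonneg _))
      _ = (‖w‖ * ‖w‖) * ‖v * c * star v - b‖ := by rw [norm_star]; ring
      _ ≤ (‖w‖ * ‖w‖ + 1) * (ε / 2 / (‖w‖ * ‖w‖ + 1)) := by
          gcongr
          linarith
      _ = ε / 2 := by field_simp
  linarith

theorem IsPos.map {C : Type*} [NonUnitalCStarAlgebra C] {a : B} (h : IsPos a)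
    (φ : B →⋆ₙₐ[ℂ] C) : IsPos (φ a) := by
  obtain ⟨c, rfl⟩ := h
  exact ⟨φ c, by rw [map_mul, map_star]⟩

theorem CuntzSub.map {C : Type*} [NonUnitalCStarAlgebra C] {a b : B} (h : CuntzSub a b)
    (φ : B →⋆ₙₐ[ℂ] C) : CuntzSub (φ a) (φ b) := by
  rw [cuntzSub_iff] at h ⊢
  intro ε hε
  obtain ⟨w, hw⟩ := h ε hε
  refine ⟨φ w, lt_of_le_of_lt ?_ hw⟩
  rw [← map_star, ← map_mul, ← map_mul, ← map_sub]
  exact NonUnitalStarAlgHom.norm_apply_le φ _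

end Cuntz

/-! ### The Cuntz semigroup -/

section Cu

variable (A : Type*) [NonUnitalCStarAlgebra A]

/-- The positive elements of `A ⊗ K`, preordered by Cuntz subequivalence. -/
def PosStab : Type _ := {a : Stab A // IsPos a}

instance : Preorder (PosStab A) where
  le a b := CuntzSub a.1 b.1
  le_refl a := CuntzSub.refl a.1
  le_trans _ _ _ hab hbc := hab.trans hbc

/-- The Cuntz semigroup `Cu(A)`: Cuntz equivalence classes of positive elements of `A ⊗ K`,
with the partial order induced by Cuntz subequivalence. -/
def Cu : Type _ := Antisymmetrization (PosStab A) (· ≤ ·)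

instance : PartialOrder (Cu A) :=
  inferInstanceAs (PartialOrder (Antisymmetrization (PosStab A) (· ≤ ·)))

variable {A}

/-- The class `[a]` in `Cu(A)` of a positive element of `A ⊗ K`. -/
def Cu.mk (a : PosStab A) : Cu A := toAntisymmetrization (· ≤ ·) a

theorem Cu.mk_le_mk {a b : PosStab A} : Cu.mk a ≤ Cu.mk b ↔ CuntzSub a.1 b.1 := Iff.rfl

theorem Cu.mk_eq_mk {a b : PosStab A} : Cu.mk a = Cu.mk b ↔ CuntzEquiv a.1 b.1 :=
  le_antisymm_iff

theorem Cu.mk_surjective : Function.Surjective (Cu.mk (A := A)) := Quotient.mk_surjective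

theorem two_mul_injective : Function.Injective fun n : ℕ => 2 * n := fun a b h => by
  simpa using h

theorem two_mul_add_one_injective : Function.Injective fun n : ℕ => 2 * n + 1 := fun a b h => by
  simpa using h

/-- The corner embedding of `A ⊗ K` on the even indices. -/
def evenEmb : Stab A →⋆ₙₐ[ℂ] Stab A := Stab.reindex _ two_mul_injective

/-- The corner embedding of `A ⊗ K` on the odd indices. -/
def oddEmb : Stab A →⋆ₙₐ[ℂ] Stab A := Stab.reindex _ two_mul_add_one_injective

theorem even_mul_odd (x y : Stab A) : evenEmb x * oddEmb y = 0 :=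
  Stab.reindex_mul_reindex _ _ _ _ (fun i j => by lia) x y

theorem odd_mul_even (x y : Stab A) : oddEmb x * evenEmb y = 0 :=
  Stab.reindex_mul_reindex _ _ _ _ (fun i j => by lia) x y

/-- The orthogonal sum `a ⊕ b` in `A ⊗ K`, through the isomorphism `M₂(K) → K` induced by the
partition of `ℕ` into even and odd numbers. -/
def osum (a b : Stab A) : Stab A := evenEmb a + oddEmb b

theorem IsPos.osum {a b : Stab A} (ha : IsPos a) (hb : IsPos b) : IsPos (osum a b) := by
  obtain ⟨c, rfl⟩ := ha
  obtain ⟨d, rfl⟩ := hb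
  refine ⟨CuntzSemigroup.osum c d, ?_⟩
  simp only [CuntzSemigroup.osum, star_add, add_mul, mul_add, ← map_star, even_mul_odd,
    odd_mul_even, map_mul, add_zero, zero_add]

theorem CuntzSub.osum {a b a' b' : Stab A} (h : CuntzSub a a') (h' : CuntzSub b b') :
    CuntzSub (osum a b) (osum a' b') := by
  obtain ⟨w, hw⟩ := h
  obtain ⟨v, hv⟩ := h'
  refine ⟨fun n => CuntzSemigroup.osum (w n) (v n), ?_⟩
  have h1 := (((Stab.continuous_reindex _ two_mul_injective).tendsto a).comp hw).add
    (((Stab.continuous_reindex _ two_mul_add_one_injective).tendsto b).comp hv)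
  refine h1.congr fun n => ?_
  change evenEmb (w n * a' * star (w n)) + oddEmb (v n * b' * star (v n)) = _
  simp only [CuntzSemigroup.osum, star_add, add_mul, mul_add, ← map_star,
    even_mul_odd, odd_mul_even, map_mul, add_zero, zero_add]
  simp only [mul_assoc, even_mul_odd, odd_mul_even, mul_zero, add_zero, zero_add]

theorem cuntzEquiv_reindex (σ : ℕ → ℕ) (hσ : Function.Injective σ) (a : Stab A) :
    CuntzEquiv (Stab.reindex σ hσ a) a := by
  have key : ∀ ε > 0, ∃ u : FinMat A, ‖Stab.ofFin u * a * star (Stab.ofFin u) - a‖ < ε := by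
    intro ε hε
    obtain ⟨w, hw⟩ := exists_approx_conj a hε
    have hc : Continuous fun w : Stab A => ‖w * a * star w - a‖ := by fun_prop
    obtain ⟨u, hu⟩ := Stab.denseRange_ofFin.exists_mem_open
      (isOpen_lt hc (continuous_const (y := ε))) ⟨w, hw⟩
    exact ⟨u, hu⟩
  have e1 : ∀ u : FinMat A, Stab.ofFin (FinMat.rowShift σ hσ u) * a *
      star (Stab.ofFin (FinMat.rowShift σ hσ u)) =
      Stab.reindex σ hσ (Stab.ofFin u * a * star (Stab.ofFin u)) := by
    intro u
    refine Stab.hom_ext (F := fun a => Stab.ofFin (FinMat.rowShift σ hσ u) * a *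
      star (Stab.ofFin (FinMat.rowShift σ hσ u)))
      (H := fun a => Stab.reindex σ hσ (Stab.ofFin u * a * star (Stab.ofFin u)))
      (by fun_prop) ((Stab.continuous_reindex σ hσ).comp (by fun_prop)) (fun x => ?_) a
    simp only [← map_star, ← map_mul]
    rw [Stab.reindex_ofFin, FinMat.rowShift_conj]
  have e2 : ∀ u : FinMat A, star (Stab.ofFin (FinMat.rowShift σ hσ u)) * Stab.reindex σ hσ a *
      Stab.ofFin (FinMat.rowShift σ hσ u) = star (Stab.ofFin u) * a * Stab.ofFin u := by
    intro u
    refine Stab.hom_ext (F := fun a => star (Stab.ofFin (FinMat.rowShift σ hσ u)) *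
      Stab.reindex σ hσ a * Stab.ofFin (FinMat.rowShift σ hσ u))
      (H := fun a => star (Stab.ofFin u) * a * Stab.ofFin u)
      (((Stab.continuous_reindex σ hσ).const_mul _).mul_const _) (by fun_prop) (fun x => ?_) a
    simp only [Stab.reindex_ofFin, ← map_star, ← map_mul]
    rw [FinMat.star_rowShift_conj]
  constructor
  · refine cuntzSub_iff.2 fun ε hε => ?_
    obtain ⟨u, hu⟩ := key ε hε
    refine ⟨Stab.ofFin (FinMat.rowShift σ hσ u), ?_⟩
    rw [e1, ← map_sub]
    exact (NonUnitalStarAlgHom.norm_apply_le _ _).trans_lt hu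
  · refine cuntzSub_iff.2 fun ε hε => ?_
    obtain ⟨u, hu⟩ := key ε hε
    refine ⟨star (Stab.ofFin (FinMat.rowShift σ hσ (star u))), ?_⟩
    rw [star_star, e2, map_star, star_star]
    exact hu

theorem mk_eq_mk_of_reindex (σ : ℕ → ℕ) (hσ : Function.Injective σ) {a b : PosStab A}
    (h : Stab.reindex σ hσ a.1 = b.1) : Cu.mk a = Cu.mk b := by
  have h1 := cuntzEquiv_reindex σ hσ a.1
  rw [h] at h1
  exact Cu.mk_eq_mk.2 ⟨h1.2, h1.1⟩

namespace Cu

instance : Zero (Cu A) := ⟨mk ⟨0, 0, by simp⟩⟩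

instance : Add (Cu A) where
  add := Quotient.map₂ (fun a b => ⟨osum a.1 b.1, a.2.osum b.2⟩) fun _ _ ha _ _ hb =>
    ⟨CuntzSub.osum ha.1 hb.1, CuntzSub.osum ha.2 hb.2⟩

theorem mk_add_mk (a b : PosStab A) : mk a + mk b = mk ⟨osum a.1 b.1, a.2.osum b.2⟩ := rfl

instance : AddCommMonoid (Cu A) where
  add_assoc x y z := by
    obtain ⟨a, rfl⟩ := mk_surjective x
    obtain ⟨b, rfl⟩ := mk_surjective y
    obtain ⟨c, rfl⟩ := mk_surjective z
    have hσ : Function.Injective fun n : ℕ =>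
        if n % 4 = 0 then n / 2 else if n % 4 = 2 then n - 1 else 2 * n + 1 := by
      intro m n h
      dsimp only at h
      split_ifs at h <;> lia
    refine mk_eq_mk_of_reindex _ hσ ?_
    change Stab.reindex _ hσ (evenEmb (evenEmb a.1 + oddEmb b.1) + oddEmb c.1) =
      evenEmb a.1 + oddEmb (evenEmb b.1 + oddEmb c.1)
    simp only [map_add, evenEmb, oddEmb, Stab.reindex_reindex]
    rw [add_assoc]
    congr 1
    · congr 2
      funext n
      simp only [Function.comp_apply]
      split_ifs <;> lia
    · congr 1
      · congr 2
        funext n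
        simp only [Function.comp_apply]
        split_ifs <;> lia
      · congr 2
        funext n
        simp only [Function.comp_apply]
        split_ifs <;> lia
  zero_add x := by
    obtain ⟨a, rfl⟩ := mk_surjective x
    refine mk_eq_mk.2 ?_
    change CuntzEquiv (evenEmb 0 + oddEmb a.1) a.1
    rw [map_zero, zero_add]
    exact cuntzEquiv_reindex _ _ _
  add_zero x := by
    obtain ⟨a, rfl⟩ := mk_surjective x
    refine mk_eq_mk.2 ?_
    change CuntzEquiv (evenEmb a.1 + oddEmb 0) a.1
    rw [map_zero, add_zero]
    exact cuntzEquiv_reindex _ _ _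
  add_comm x y := by
    obtain ⟨a, rfl⟩ := mk_surjective x
    obtain ⟨b, rfl⟩ := mk_surjective y
    have hσ : Function.Injective fun n : ℕ => if n % 2 = 0 then n + 1 else n - 1 := by
      intro m n h
      dsimp only at h
      split_ifs at h <;> lia
    refine mk_eq_mk_of_reindex _ hσ ?_
    change Stab.reindex _ hσ (evenEmb a.1 + oddEmb b.1) = evenEmb b.1 + oddEmb a.1
    simp only [map_add, evenEmb, oddEmb, Stab.reindex_reindex]
    rw [add_comm]
    congr 1
    · congr 2
      funext n
      simp only [Function.comp_apply]
      split_ifs <;> lia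
    · congr 2
      funext n
      simp only [Function.comp_apply]
      split_ifs <;> lia
  nsmul := nsmulRec

end Cu

end Cu
/-! ### The category Cu -/

section CategoryCu

/-- Compact containment: `x ≪ y` if every increasing sequence whose supremum dominates `y`
eventually dominates `x`. -/
def WayBelow {S : Type*} [PartialOrder S] (x y : S) : Prop :=
  ∀ (u : ℕ → S) (s : S), Monotone u → IsLUB (Set.range u) s → y ≤ s → ∃ n, x ≤ u n

/-- A `Cu`-semigroup: a positively ordered abelian monoid with (O1)-(O4). -/
structure IsCuSemigroup (S : Type*) [AddCommMonoid S] [PartialOrder S] : Prop where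
  zero_le : ∀ x : S, 0 ≤ x
  add_le_add : ∀ x y x' y' : S, x ≤ y → x' ≤ y' → x + x' ≤ y + y'
  exists_sup : ∀ u : ℕ → S, Monotone u → ∃ s, IsLUB (Set.range u) s
  exists_wayBelow : ∀ x : S, ∃ u : ℕ → S, (∀ n, WayBelow (u n) (u (n + 1))) ∧
    IsLUB (Set.range u) x
  wayBelow_add : ∀ x' x y' y : S, WayBelow x' x → WayBelow y' y → WayBelow (x' + y') (x + y)
  sup_add : ∀ (u v : ℕ → S) (s t : S), Monotone u → Monotone v → IsLUB (Set.range u) s →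
    IsLUB (Set.range v) t → IsLUB (Set.range fun n => u n + v n) (s + t)

/-- A `Cu`-morphism: a monoid morphism between `Cu`-semigroups which preserves the order,
compact containment and suprema of increasing sequences. -/
structure IsCuMorphism {S T : Type*} [AddCommMonoid S] [PartialOrder S] [AddCommMonoid T]
    [PartialOrder T] (φ : S → T) : Prop where
  source : IsCuSemigroup S
  target : IsCuSemigroup T
  map_zero : φ 0 = 0
  map_add : ∀ x y, φ (x + y) = φ x + φ y
  map_le : ∀ x y, x ≤ y → φ x ≤ φ y
  map_wayBelow : ∀ x y, WayBelow x y → WayBelow (φ x) (φ y)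
  map_sup : ∀ (u : ℕ → S) (s : S), Monotone u → IsLUB (Set.range u) s →
    IsLUB (Set.range fun n => φ (u n)) (φ s)

end CategoryCu

section Functor

variable {A B : Type*} [NonUnitalCStarAlgebra A] [NonUnitalCStarAlgebra B]

/-- `Cu(φ) : Cu(A) → Cu(B)`, `[a] ↦ [(φ ⊗ id)(a)]`. -/
def Cu.map (φ : A →⋆ₙₐ[ℂ] B) : Cu A → Cu B :=
  Quotient.map (fun a => ⟨Stab.map φ a.1, a.2.map (Stab.map φ)⟩)
    fun _ _ h => ⟨CuntzSub.map h.1 _, CuntzSub.map h.2 _⟩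

theorem Cu.map_mk (φ : A →⋆ₙₐ[ℂ] B) (a : PosStab A) :
    Cu.map φ (Cu.mk a) = Cu.mk ⟨Stab.map φ a.1, a.2.map (Stab.map φ)⟩ := rfl

/-- A positive element `a` of `B` is purely positive if it is not Cuntz equivalent (in `B ⊗ K`)
to a projection in `M_∞(B)`. -/
def PurelyPositive (a : B) : Prop :=
  IsPos a ∧ ∀ p : FinMat B, IsStarProjection p →
    ¬ CuntzEquiv (Stab.ofFin (FinMat.single a)) (Stab.ofFin p)

/-- `Cu₊(A)`, the classes of the purely positive elements of `A ⊗ K`. -/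
def CuPlus (A : Type*) [NonUnitalCStarAlgebra A] : Set (Cu A) :=
  {x | ∃ a : PosStab A, PurelyPositive a.1 ∧ x = Cu.mk a}

end Functor

/-! ### Simplicity, type I, and group actions -/

section Actions

/-- A C⋆-algebra is simple if it is nonzero and has no nontrivial closed two-sided ideals. -/
def IsSimpleCStar (A : Type*) [NonUnitalCStarAlgebra A] : Prop :=
  Nontrivial A ∧ ∀ I : TwoSidedIdeal A, IsClosed (I : Set A) → I = ⊥ ∨ I = ⊤

/-- A C⋆-algebra is of type I if every nonzero quotient contains a nonzero abelian positive
element. Here a positive `x` is abelian if the hereditary subalgebra it generates, the closure of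
the set of all `x a x`, is commutative. Positive elements of `A / I` are images of positive
elements `x` of `A`, so the condition is spelled out modulo `I`. -/
def IsTypeI (A : Type*) [NonUnitalCStarAlgebra A] : Prop :=
  ∀ I : TwoSidedIdeal A, IsClosed (I : Set A) → I ≠ ⊤ →
    ∃ x : A, IsPos x ∧ x ∉ I ∧
      ∀ a b : A, (x * a * x) * (x * b * x) - (x * b * x) * (x * a * x) ∈ I

variable {A : Type*} [NonUnitalCStarAlgebra A] {G : Type*} [Group G]

/-- `(a - ε)₊`, by functional calculus. -/
def cutDown (a : A) (ε : ℝ) : A := cfcₙ (fun t : ℝ => max 0 (t - ε)) a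

/-- The weak tracial Rokhlin property of an action of a finite group. -/
def WeakTracialRokhlin [Fintype G] (α : G →* (A ≃⋆ₐ[ℂ] A)) : Prop :=
  ∀ ε : ℝ, 0 < ε → ∀ F : Finset A, ∀ x y : A, IsPos x → IsPos y → ‖x‖ = 1 →
    ∃ f : G → A,
      (∀ g, IsPos (f g) ∧ ‖f g‖ ≤ 1) ∧
      (∀ g h, g ≠ h → f g * f h = 0) ∧
      (∀ g, ∀ a ∈ F, ‖a * f g - f g * a‖ < ε) ∧
      (∀ g h, ‖α g (f h) - f (g * h)‖ < ε) ∧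
      CuntzSub (cutDown (y * y - y * (∑ g, f g) * y) ε) x ∧
      1 - ε < ‖(∑ g, f g) * x * (∑ g, f g)‖

/-- The fixed point algebra `A^α`. -/
def fixedPoints (α : G →* (A ≃⋆ₐ[ℂ] A)) : NonUnitalStarSubalgebra ℂ A where
  carrier := {a | ∀ g, α g a = a}
  add_mem' := fun ha hb g => by rw [map_add, ha g, hb g]
  zero_mem' := fun g => map_zero (α g)
  mul_mem' := fun ha hb g => by rw [map_mul, ha g, hb g]
  smul_mem' := fun c a ha g => by rw [map_smul, ha g]
  star_mem' := fun ha g => by rw [map_star, ha g]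

instance isClosed_fixedPoints (α : G →* (A ≃⋆ₐ[ℂ] A)) :
    IsClosed (fixedPoints α : Set A) := by
  have h : (fixedPoints α : Set A) = ⋂ g, {a | α g a = a} := by
    ext a
    rw [Set.mem_iInter]
    exact Iff.rfl
  rw [h]
  exact isClosed_iInter fun g => isClosed_eq
    (AddMonoidHomClass.isometry_of_norm (α g) fun a => StarAlgEquiv.norm_map (α g) a).continuous
    continuous_id

/-- The inclusion `A^α → A`. -/
def fixedIncl (α : G →* (A ≃⋆ₐ[ℂ] A)) : fixedPoints α →⋆ₙₐ[ℂ] A :=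
  NonUnitalStarSubalgebraClass.subtype (fixedPoints α)

end Actions

end CuntzSemigroup

end

noncomputable section

namespace CuntzSemigroup

/-! ### Elementary Cuntz comparison -/

section Comparison

attribute [local instance] CStarAlgebra.spectralOrder CStarAlgebra.spectralOrderedRing

variable {B : Type*} [NonUnitalCStarAlgebra B]

/-! The point of injectivity is to bring Cuntz comparison in `A ⊗ K` down to the fixed point algebra
`A^α ⊗ K`. Let `a = c* c` and `b` be positive there, `b` purely positive, and `a ≾ b` in `A ⊗ K`.
Then `w (b - δ)₊ w*` is close to `a` for some `w` in `A ⊗ K` and some `δ > 0`. A Rokhlin tower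
`(f_g)`, pairwise orthogonal, almost central and almost permuted by the action, turns `w` into the
fixed element `v = ∑ γ_g(f_1 w)`. Cross terms disappear and `v (b - δ)₊ v*` is close to `c* f² c`,
where `f = ∑ f_g`.

The remainder is close to `c* (1 - f²) c ≤ 2 c* (1 - f) c`, which condition (3) makes small in the
sense of Cuntz comparison. There is room for it because the spectrum of a purely positive `b`
accumulates at `0`: a nonzero `h ≥ 0` obtained from `b` by functional calculus is orthogonal to `(b
- δ)₊`. Once the remainder is `≾ h` in the fixed point algebra, `a ≾ (b - δ)₊ + h ≾ b`, up to a
cut-down of `a`. This is `IsFixedPointEmbedding.cuntzSub_of_map`.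

That the remainder is `≾ h` there is a second descent problem, but with freedom to choose how small
the remainder is: `exists_forall_cuntzSub_stab` finds a nonzero `x` in `A ⊗ K` such that every fixed
element `≾ x` is `≾ h`. After replacing `h` by an element of `A^α` below it, condition (4) gives a
tower element `f_g` with `f_g h f_g` not small, while (1), (2) and orthogonality make `f_g h
α_k(f_g)` small for `k ≠ 1`. A matrix argument over `G`
(`IsFixedPointEmbedding.cuntzSub_of_cuntzSub_conj`) concludes.

Simplicity and the failure of type I serve to pass from `A` to `A ⊗ K` (`hasCentralTowers_stab`).
Towers are repeated along a finite diagonal, so the remainder consists of many copies of a small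
element of `A`, and these must fit below a given `x`. They do because each nonzero hereditary
subalgebra contains some `v ≠ 0` with `v² = 0`, and `v* v`, `v v*` are orthogonal equivalent pieces
(`exists_diag_cuntzSub`).

The statement about `Cu`-morphisms holds for every ⋆-homomorphism. Rørdam's lemma describes `≪`
through the elements `(a - ε)₊`, which homomorphisms preserve, and suprema are limits of Cauchy
sequences of representatives (`exists_sup_of_cuntzSub`). -/

theorem isPos_iff_nonneg {a : B} : IsPos a ↔ 0 ≤ a :=
  CStarAlgebra.nonneg_iff_eq_star_mul_self.symm

theorem CuntzSub.conj (w b : B) : CuntzSub (w * b * star w) b :=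
  cuntzSub_iff.2 fun ε hε => ⟨w, by simpa using hε⟩

theorem CuntzSub.star_conj (w b : B) : CuntzSub (star w * b * w) b := by
  simpa using CuntzSub.conj (star w) b

theorem CuntzSub.zero (b : B) : CuntzSub 0 b := by
  simpa using CuntzSub.conj 0 b

theorem CuntzEquiv.refl (a : B) : CuntzEquiv a a := ⟨.refl a, .refl a⟩

theorem CuntzEquiv.symm {a b : B} (h : CuntzEquiv a b) : CuntzEquiv b a := ⟨h.2, h.1⟩

theorem CuntzEquiv.trans {a b c : B} (h : CuntzEquiv a b) (h' : CuntzEquiv b c) :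
    CuntzEquiv a c := ⟨h.1.trans h'.1, h'.2.trans h.2⟩

/-- The set of elements which are Cuntz subequivalent to a fixed element is closed. -/
theorem CuntzSub.of_forall_near {a b : B}
    (h : ∀ ε > 0, ∃ c, ‖c - a‖ < ε ∧ CuntzSub c b) : CuntzSub a b := by
  refine cuntzSub_iff.2 fun ε hε => ?_
  obtain ⟨c, hc, hcb⟩ := h (ε / 2) (by positivity)
  obtain ⟨w, hw⟩ := cuntzSub_iff.1 hcb (ε / 2) (by positivity)
  refine ⟨w, ?_⟩
  calc ‖w * b * star w - a‖ = ‖(w * b * star w - c) + (c - a)‖ := by congr 1; abel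
    _ ≤ _ := norm_add_le _ _
    _ < ε := by linarith

theorem CuntzSub.smul_left {a b : B} (h : CuntzSub a b) {c : ℝ} (hc : 0 ≤ c) :
    CuntzSub (c • a) b := by
  refine CuntzSub.trans ?_ h
  refine cuntzSub_iff.2 fun ε hε => ?_
  obtain ⟨w, hw⟩ := exists_approx_conj a (ε := ε / (c + 1)) (by positivity)
  refine ⟨(Real.sqrt c) • w, ?_⟩
  have : (Real.sqrt c • w) * a * star (Real.sqrt c • w) - c • a = c • (w * a * star w - a) := by
    rw [star_smul, smul_mul_assoc, smul_mul_assoc, mul_smul_comm, smul_smul, star_trivial,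
      Real.mul_self_sqrt hc, smul_sub]
  rw [this, norm_smul, Real.norm_of_nonneg hc]
  calc c * ‖w * a * star w - a‖ ≤ c * (ε / (c + 1)) := by gcongr
    _ < (c + 1) * (ε / (c + 1)) := by
      have : 0 < ε / (c + 1) := by positivity
      nlinarith
    _ = ε := by field_simp

theorem CuntzSub.smul_right (a : B) {c : ℝ} (hc : 0 < c) : CuntzSub a (c • a) := by
  have := (CuntzSub.refl (c • a)).smul_left (inv_nonneg.2 hc.le)
  rwa [smul_smul, inv_mul_cancel₀ hc.ne', one_smul] at this

theorem norm_cfcₙ_sub_le {a : B} {f g : ℝ → ℝ} (hf : Continuous f) (hf0 : f 0 = 0)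
    (hg : Continuous g) (hg0 : g 0 = 0) {c : ℝ}
    (h : ∀ t ∈ quasispectrum ℝ a, |f t - g t| ≤ c) : ‖cfcₙ f a - cfcₙ g a‖ ≤ c := by
  rw [← cfcₙ_sub f g a hf.continuousOn hf0 hg.continuousOn hg0]
  exact norm_cfcₙ_le h

/-- Put `s = √p`, `g = q (q + δ)⁻¹` and `k = √q (q + δ)⁻¹`. Then `k q k = g²`, so conjugating `q` by
`s k` gives `s g² s`. This tends to `s² = p` as `δ → 0`, since `‖s - g s‖² = ‖(1 - g) p (1 - g)‖ ≤
‖(1 - g) q (1 - g)‖ ≤ δ`. -/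
theorem CuntzSub.of_le {p q : B} (hp : 0 ≤ p) (hpq : p ≤ q) : CuntzSub p q := by
  have hq : 0 ≤ q := hp.trans hpq
  have hqs : IsSelfAdjoint q := .of_nonneg hq
  have hqn := quasispectrum_nonneg_of_nonneg (𝕜 := ℝ) q hq
  set s := CFC.sqrt p with hs
  have hss : s * s = p := CFC.sqrt_mul_sqrt_self p
  have hsa : star s = s := (IsSelfAdjoint.of_nonneg (CFC.sqrt_nonneg p)).star_eq
  obtain ⟨d, hd⟩ := CStarAlgebra.nonneg_iff_eq_star_mul_self.1 (sub_nonneg.2 hpq)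
  -- functional calculus with `t / (t + δ)` and `√t / (t + δ)`
  have key : ∀ δ : ℝ, 0 < δ → ∃ k g : B, IsSelfAdjoint k ∧ IsSelfAdjoint g ∧ k * q * k = g * g ∧
      ‖s - g * s‖ ^ 2 ≤ δ ∧ ‖g‖ ≤ 1 := by
    intro δ hδ
    -- The absolute values only serve to make both functions continuous on all of `ℝ`; the spectrum
    -- of `q` is nonnegative.
    let G : ℝ → ℝ := fun t => |t| / (|t| + δ)
    let K : ℝ → ℝ := fun t => Real.sqrt |t| / (|t| + δ)
    have hpos : ∀ t : ℝ, 0 < |t| + δ := fun t => by positivity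
    have hGc : Continuous G := by
      refine Continuous.div (by fun_prop) (by fun_prop) fun t => (hpos t).ne'
    have hKc : Continuous K := by
      refine Continuous.div (by fun_prop) (by fun_prop) fun t => (hpos t).ne'
    have hG0 : G 0 = 0 := by simp [G]
    have hK0 : K 0 = 0 := by simp [K]
    refine ⟨cfcₙ K q, cfcₙ G q, cfcₙ_predicate K q, cfcₙ_predicate G q, ?_, ?_, ?_⟩
    · have h1 : q = cfcₙ (fun t : ℝ => t) q := (cfcₙ_id' ℝ q).symm
      rw [← cfcₙ_mul G G q hGc.continuousOn hG0 hGc.continuousOn hG0]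
      nth_rw 2 [h1]
      rw [← cfcₙ_mul K (fun t => t) q hKc.continuousOn hK0 (by fun_prop) rfl,
        ← cfcₙ_mul (fun t => K t * t) K q (by fun_prop) (by simp) hKc.continuousOn hK0]
      refine cfcₙ_congr fun t ht => ?_
      have h0 : 0 ≤ t := hqn t ht
      have hp := hpos t
      simp only [G, K, abs_of_nonneg h0] at hp ⊢
      have := Real.mul_self_sqrt h0
      field_simp
      nlinarith
    · have hgs : star (cfcₙ G q) = cfcₙ G q := (cfcₙ_predicate G q : IsSelfAdjoint _)
      set g := cfcₙ G q
      rw [sq, ← CStarRing.norm_self_mul_star]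
      have e1 : (s - g * s) * star (s - g * s) = p - g * p - p * g + g * p * g := by
        rw [star_sub, star_mul, hsa, hgs, ← hss]
        noncomm_ring
      have e2 : (q - g * q - q * g + g * q * g) - (p - g * p - p * g + g * p * g) =
          star (d - d * g) * (d - d * g) := by
        rw [star_sub, star_mul, hgs]
        have : star d * d = q - p := hd.symm
        calc _ = (q - p) - g * (q - p) - (q - p) * g + g * (q - p) * g := by noncomm_ring
          _ = _ := by rw [← this]; noncomm_ring
      have e3 : q - g * q - q * g + g * q * g = cfcₙ (fun t => t - G t * t - t * G t + G t * t * G t) q := by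
        have hid : cfcₙ (fun t : ℝ => t) q = q := cfcₙ_id' ℝ q
        rw [cfcₙ_add (fun t => t - G t * t - t * G t) (fun t => G t * t * G t) q (by fun_prop)
          (by simp) (by fun_prop) (by simp),
          cfcₙ_sub (fun t => t - G t * t) (fun t => t * G t) q (by fun_prop) (by simp)
          (by fun_prop) (by simp), cfcₙ_sub (fun t => t) (fun t => G t * t) q (by fun_prop)
          (by simp) (by fun_prop) (by simp),
          cfcₙ_mul (fun t => G t * t) G q (by fun_prop) (by simp) (by fun_prop) hG0,
          cfcₙ_mul G (fun t => t) q (by fun_prop) hG0 (by fun_prop) rfl,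
          cfcₙ_mul (fun t => t) G q (by fun_prop) rfl (by fun_prop) hG0, hid]
      rw [e1]
      refine (CStarAlgebra.norm_le_norm_of_nonneg_of_le (b := q - g * q - q * g + g * q * g)
        ?_ ?_).trans ?_
      · rw [← e1]; exact mul_star_self_nonneg _
      · rw [← sub_nonneg, e2]; exact star_mul_self_nonneg _
      · rw [e3]
        refine norm_cfcₙ_le fun t ht => ?_
        have h0 : 0 ≤ t := hqn t ht
        have hp := hpos t
        simp only [G, abs_of_nonneg h0] at hp ⊢
        have e : t - t / (t + δ) * t - t * (t / (t + δ)) + t / (t + δ) * t * (t / (t + δ)) =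
            δ * (t * δ / (t + δ) ^ 2) := by field_simp; ring
        rw [e, Real.norm_of_nonneg (by positivity)]
        refine mul_le_of_le_one_right hδ.le ?_
        rw [div_le_one (by positivity)]
        nlinarith
    · refine norm_cfcₙ_le fun t _ => ?_
      rw [Real.norm_of_nonneg (by positivity), div_le_one (hpos t)]
      linarith
  refine cuntzSub_iff.2 fun ε hε => ?_
  -- This `δ` gives `‖s - g s‖ ≤ ε / (4 (‖s‖ + 1))`; the error splits into two terms, each at most
  -- `‖s‖` times this.
  obtain ⟨k, g, hk, hg, hkg, hn, hg1⟩ := key ((ε / (2 * (‖s‖ + 1))) ^ 2 / 4) (by positivity)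
  refine ⟨s * k, ?_⟩
  have hn' : ‖s - g * s‖ ≤ ε / (2 * (‖s‖ + 1)) / 2 := by
    refine le_of_sq_le_sq ?_ (by positivity)
    refine hn.trans (le_of_eq (by ring))
  have e : s * k * q * star (s * k) - p = -(s * (s - g * s)) - (star (s - g * s) * (g * s)) := by
    rw [star_mul, hk.star_eq, hsa, star_sub, star_mul, hg.star_eq, hsa]
    calc s * k * q * (k * s) - p = s * (k * q * k) * s - p := by noncomm_ring
      _ = s * (g * g) * s - s * s := by rw [hkg, hss]
      _ = _ := by noncomm_ring
  rw [e]
  have h1 : ‖s * (s - g * s)‖ ≤ ‖s‖ * (ε / (2 * (‖s‖ + 1)) / 2) :=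
    (norm_mul_le _ _).trans (by gcongr)
  have h2 : ‖star (s - g * s) * (g * s)‖ ≤ (ε / (2 * (‖s‖ + 1)) / 2) * ‖s‖ := by
    refine (norm_mul_le _ _).trans ?_
    rw [norm_star]
    gcongr
    exact (norm_mul_le _ _).trans (mul_le_of_le_one_left (norm_nonneg _) hg1)
  calc _ ≤ ‖-(s * (s - g * s))‖ + ‖star (s - g * s) * (g * s)‖ := norm_sub_le _ _
    _ ≤ ‖s‖ * (ε / (2 * (‖s‖ + 1)) / 2) + (ε / (2 * (‖s‖ + 1)) / 2) * ‖s‖ := by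
      rw [norm_neg]; gcongr
    _ = (‖s‖ / (‖s‖ + 1)) * (ε / 2) := by field_simp; ring
    _ ≤ 1 * (ε / 2) := by
      gcongr
      rw [div_le_one (by positivity)]
      linarith
    _ < ε := by linarith

/-- Comparison of functional calculi: what matters is where the functions are positive. -/
theorem cuntzSub_cfcₙ {a : B} (ha : 0 ≤ a) {φ ψ : ℝ → ℝ} (hφ : Continuous φ) (hφ0 : φ 0 = 0)
    (hψ : Continuous ψ) (hψ0 : ψ 0 = 0) (hφn : ∀ t, 0 ≤ t → 0 ≤ φ t)
    (hψn : ∀ t, 0 ≤ t → 0 ≤ ψ t) (h : ∀ t, 0 ≤ t → 0 < φ t → 0 < ψ t) :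
    CuntzSub (cfcₙ φ a) (cfcₙ ψ a) := by
  have han := quasispectrum_nonneg_of_nonneg (𝕜 := ℝ) a ha
  have hK : IsCompact (quasispectrum ℝ a) := quasispectrum.isCompact a
  refine CuntzSub.of_forall_near fun ε hε => ?_
  -- Near its zeros `φ` need not be dominated by a multiple of `ψ`. The cut-down `φ'` lives on the
  -- compact part of the spectrum where `φ ≥ ε / 2`, and there `ψ` is bounded below.
  let φ' : ℝ → ℝ := fun t => max 0 (φ t - ε / 2)
  have hφ'c : Continuous φ' := by fun_prop
  have hφ'0 : φ' 0 = 0 := by simp [φ', hφ0]; positivity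
  refine ⟨cutDown (cfcₙ φ a) (ε / 2), ?_, ?_⟩
  all_goals
    have e : cutDown (cfcₙ φ a) (ε / 2) = cfcₙ φ' a := by
      rw [cutDown, ← cfcₙ_comp (fun t => max 0 (t - ε / 2)) φ a (by fun_prop) (by simp; positivity)
        (by fun_prop) hφ0]
      rfl
    rw [e]
  · refine (norm_cfcₙ_sub_le hφ'c hφ'0 hφ hφ0 (c := ε / 2) fun t ht => ?_).trans_lt (by linarith)
    have := hφn t (han t ht)
    simp only [φ']
    rcases max_cases 0 (φ t - ε / 2) with h | h <;> rw [h.1, abs_le] <;> constructor <;> linarith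
  · -- a bound `φ' ≤ C ψ` on the quasispectrum
    obtain ⟨C, hC0, hC⟩ : ∃ C : ℝ, 0 ≤ C ∧ ∀ t ∈ quasispectrum ℝ a, φ' t ≤ C * ψ t := by
      have hK' : IsCompact (quasispectrum ℝ a ∩ {t | ε / 2 ≤ φ t}) :=
        hK.inter_right (isClosed_le continuous_const hφ)
      have hcont : ContinuousOn (fun t => φ' t / ψ t)
          (quasispectrum ℝ a ∩ {t | ε / 2 ≤ φ t}) := by
        refine hφ'c.continuousOn.div hψ.continuousOn fun t ht => ?_
        have h1 : ε / 2 ≤ φ t := ht.2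
        exact (h t (han t ht.1) (by linarith)).ne'
      obtain ⟨C, hC⟩ := hK'.bddAbove_image hcont
      refine ⟨max C 0, le_max_right _ _, fun t ht => ?_⟩
      have ht0 := han t ht
      by_cases h1 : ε / 2 ≤ φ t
      · have h2 : φ' t / ψ t ≤ C := hC ⟨t, ⟨ht, h1⟩, rfl⟩
        have h3 : 0 < ψ t := h t ht0 (by linarith)
        rw [div_le_iff₀ h3] at h2
        exact h2.trans (by gcongr; exact le_max_left _ _)
      · have : φ' t = 0 := max_eq_left (by linarith)
        rw [this]
        exact mul_nonneg (le_max_right _ _) (hψn t ht0)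
    refine (CuntzSub.of_le (q := C • cfcₙ ψ a) (cfcₙ_nonneg fun t _ => le_max_left _ _) ?_).trans
      ((CuntzSub.refl _).smul_left hC0)
    rw [← cfcₙ_const_mul C ψ a (by fun_prop) hψ0]
    exact cfcₙ_mono hC

end Comparison

/-! ### The cut-downs `(a - ε)₊` and Rørdam's lemma -/

section CutDown

attribute [local instance] CStarAlgebra.spectralOrder CStarAlgebra.spectralOrderedRing

variable {B C : Type*} [NonUnitalCStarAlgebra B] [NonUnitalCStarAlgebra C]

theorem cutDown_nonneg (a : B) (ε : ℝ) : 0 ≤ cutDown a ε :=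
  cfcₙ_nonneg fun _ _ => le_max_left _ _

theorem isSelfAdjoint_cutDown (a : B) (ε : ℝ) : IsSelfAdjoint (cutDown a ε) :=
  .of_nonneg (cutDown_nonneg a ε)

theorem isPos_cutDown (a : B) (ε : ℝ) : IsPos (cutDown a ε) :=
  isPos_iff_nonneg.2 (cutDown_nonneg a ε)

theorem map_cutDown (φ : B →⋆ₙₐ[ℂ] C) {a : B} (ha : IsSelfAdjoint a) {ε : ℝ} (hε : 0 ≤ ε) :
    φ (cutDown a ε) = cutDown (φ a) ε :=
  NonUnitalStarAlgHomClass.map_cfcₙ φ _ a (by fun_prop) (by simpa using hε)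
    (map_continuous φ) ha (ha.map φ)

theorem norm_cutDown_sub_le {a : B} (ha : 0 ≤ a) {ε : ℝ} (hε : 0 ≤ ε) :
    ‖cutDown a ε - a‖ ≤ ε := by
  have h1 : a = cfcₙ (fun t : ℝ => t) a := (cfcₙ_id' ℝ a).symm
  nth_rw 2 [h1]
  refine norm_cfcₙ_sub_le (by fun_prop) (by simpa using hε) (by fun_prop) rfl fun t ht => ?_
  have := quasispectrum_nonneg_of_nonneg (𝕜 := ℝ) a ha t ht
  rcases max_cases 0 (t - ε) with h | h <;> rw [h.1, abs_le] <;> constructor <;> linarith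

theorem cutDown_cutDown {a : B} (ha : IsSelfAdjoint a) {ε δ : ℝ} (hε : 0 ≤ ε) (hδ : 0 ≤ δ) :
    cutDown (cutDown a ε) δ = cutDown a (ε + δ) := by
  rw [cutDown, cutDown, cutDown, ← cfcₙ_comp (fun t => max 0 (t - δ)) _ a (by fun_prop)
    (by simpa using hδ) (by fun_prop) (by simpa using hε)]
  refine cfcₙ_congr fun t _ => ?_
  simp only [Function.comp_apply]
  simp only [max_def]
  split_ifs <;> linarith

theorem cutDown_le_cutDown (a : B) {ε δ : ℝ} (hδ : 0 ≤ δ) (h : δ ≤ ε) :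
    cutDown a ε ≤ cutDown a δ := by
  refine cfcₙ_mono (fun t _ => ?_) (by fun_prop) (by fun_prop) (by simpa using hδ.trans h)
    (by simpa using hδ)
  gcongr

theorem CuntzSub.cutDown_anti (a : B) {ε δ : ℝ} (hδ : 0 ≤ δ) (h : δ ≤ ε) :
    CuntzSub (cutDown a ε) (cutDown a δ) :=
  .of_le (cutDown_nonneg a ε) (cutDown_le_cutDown a hδ h)

theorem CuntzSub.cutDown_self {a : B} (ha : 0 ≤ a) {ε : ℝ} (hε : 0 ≤ ε) :
    CuntzSub (cutDown a ε) a := by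
  refine .of_le (cutDown_nonneg a ε) ?_
  nth_rw 2 [← cfcₙ_id' ℝ a]
  refine cfcₙ_mono (fun t ht => ?_) (by fun_prop) (by fun_prop) (by simpa using hε) rfl
  have := quasispectrum_nonneg_of_nonneg (𝕜 := ℝ) a ha t ht
  exact max_le this (by linarith)

theorem CuntzSub.of_forall_cutDown {a b : B} (ha : 0 ≤ a)
    (h : ∀ ε > 0, CuntzSub (cutDown a ε) b) : CuntzSub a b :=
  .of_forall_near fun ε hε => ⟨cutDown a (ε / 2),
    (norm_cutDown_sub_le ha (by positivity)).trans_lt (by linarith), h _ (by positivity)⟩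

/-- If `u ≤ s` and `s` is within `ε` of `r`, then `(u - ε)₊ ≾ r`. -/
theorem cuntzSub_cutDown_of_le {u s r : B} (hu : IsSelfAdjoint u) (hr : IsSelfAdjoint r)
    (hus : u ≤ s) {ε : ℝ} (hε : 0 ≤ ε) (hsr : ‖s - r‖ ≤ ε) : CuntzSub (cutDown u ε) r := by
  let φ : ℝ → ℝ := fun t => max 0 (t - ε)
  have hφc : Continuous φ := by fun_prop
  have hφ0 : φ 0 = 0 := by simpa [φ] using hε
  have he0 : 0 ≤ cutDown u ε := cutDown_nonneg u ε
  have hes := (isSelfAdjoint_cutDown u ε).star_eq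
  have hs : IsSelfAdjoint s := by
    have := (IsSelfAdjoint.of_nonneg (sub_nonneg.2 hus)).add hu
    rwa [sub_add_cancel] at this
  set e := cutDown u ε with he
  -- Since `φ³ = φ (t - ε) φ`, one gets `e³ = e u e - ε e² ≤ e s e - ε e² ≤ e r e`, and hence `e ≾
  -- e³ ≾ e r e ≾ r`. Positivity of `r` plays no role.
  have h1 : e * e * e = e * u * e - ε • (e * e) := by
    have hid : cfcₙ (fun t : ℝ => t) u = u := cfcₙ_id' ℝ u
    rw [he, cutDown]
    change cfcₙ φ u * cfcₙ φ u * cfcₙ φ u = cfcₙ φ u * u * cfcₙ φ u - ε • (cfcₙ φ u * cfcₙ φ u)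
    nth_rw 5 [← hid]
    rw [← cfcₙ_mul φ φ u (by fun_prop) hφ0 (by fun_prop) hφ0,
      ← cfcₙ_mul (fun t => φ t * φ t) φ u (by fun_prop) (by simp [hφ0]) (by fun_prop) hφ0,
      ← cfcₙ_mul φ (fun t => t) u (by fun_prop) hφ0 (by fun_prop) rfl,
      ← cfcₙ_mul (fun t => φ t * t) φ u (by fun_prop) (by simp) (by fun_prop) hφ0,
      ← cfcₙ_const_mul ε (fun t => φ t * φ t) u (by fun_prop) (by simp [hφ0]),
      ← cfcₙ_sub (fun t => φ t * t * φ t) (fun t => ε * (φ t * φ t)) u (by fun_prop)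
        (by simp) (by fun_prop) (by simp [hφ0])]
    refine cfcₙ_congr fun t _ => ?_
    simp only [φ]
    rcases max_cases 0 (t - ε) with h | h <;> rw [h.1] <;> ring
  have h2 : e * e * e ≤ e * r * e := by
    have h3 : e * u * e ≤ e * s * e := by
      simpa only [hes] using star_left_conjugate_le_conjugate hus e
    have h4 : e * (s - r) * e ≤ ε • (e * e) := by
      have := CStarAlgebra.star_left_conjugate_le_norm_smul (a := e) (b := s - r) (hs.sub hr)
      rw [hes] at this
      refine this.trans ?_
      have h5 : 0 ≤ e * e := by simpa only [hes] using star_mul_self_nonneg e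
      exact smul_le_smul_of_nonneg_right hsr h5
    rw [h1, sub_le_iff_le_add]
    refine h3.trans ?_
    rw [mul_sub, sub_mul, sub_le_iff_le_add] at h4
    rwa [add_comm]
  have h6 : e * e * e = cfcₙ (fun t : ℝ => t * t * t) e := by
    have hid : cfcₙ (fun t : ℝ => t) e = e := cfcₙ_id' ℝ e
    rw [cfcₙ_mul (fun t => t * t) (fun t => t) e (by fun_prop) (by simp) (by fun_prop) rfl,
      cfcₙ_mul (fun t => t) (fun t => t) e (by fun_prop) rfl (by fun_prop) rfl, hid]
  have h7 : CuntzSub e (e * e * e) := by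
    rw [h6]
    nth_rw 1 [← cfcₙ_id' ℝ e]
    refine cuntzSub_cfcₙ he0 (by fun_prop) rfl (by fun_prop) (by simp) (fun t ht => ht)
      (fun t ht => by positivity) (fun t _ ht => by positivity)
  have h8 : 0 ≤ e * e * e := by
    rw [h6]
    refine cfcₙ_nonneg fun t ht => ?_
    have := quasispectrum_nonneg_of_nonneg (𝕜 := ℝ) e he0 t ht
    positivity
  refine h7.trans ((CuntzSub.of_le h8 h2).trans ?_)
  nth_rw 2 [← hes]
  exact CuntzSub.conj e r

theorem cuntzSub_cutDown_of_norm_sub_le {a b : B} (ha : IsSelfAdjoint a) (hb : IsSelfAdjoint b)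
    {ε : ℝ} (h : ‖a - b‖ ≤ ε) : CuntzSub (cutDown a ε) b :=
  cuntzSub_cutDown_of_le ha hb le_rfl ((norm_nonneg _).trans h) h

/-- Rørdam's lemma. -/
theorem CuntzSub.exists_conj_cutDown {a b : B} (hb : 0 ≤ b) (h : CuntzSub a b) {ε : ℝ}
    (hε : 0 < ε) : ∃ δ > 0, ∃ w : B, ‖w * cutDown b δ * star w - a‖ < ε := by
  obtain ⟨w, hw⟩ := cuntzSub_iff.1 h (ε / 2) (by positivity)
  -- With this `δ`, replacing `b` by `(b - δ)₊` moves `w b w*` by at most `ε / 2`.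
  refine ⟨ε / 2 / (‖w‖ * ‖w‖ + 1), by positivity, w, ?_⟩
  set δ := ε / 2 / (‖w‖ * ‖w‖ + 1) with hδ
  have h1 : ‖w * (cutDown b δ - b) * star w‖ ≤ ε / 2 := by
    calc ‖w * (cutDown b δ - b) * star w‖ ≤ ‖w‖ * ‖cutDown b δ - b‖ * ‖star w‖ :=
          (norm_mul_le _ _).trans (mul_le_mul_of_nonneg_right (norm_mul_le _ _) (norm_nonneg _))
      _ = (‖w‖ * ‖w‖) * ‖cutDown b δ - b‖ := by rw [norm_star]; ring
      _ ≤ (‖w‖ * ‖w‖ + 1) * (ε / 2 / (‖w‖ * ‖w‖ + 1)) := by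
          gcongr
          · linarith
          · exact norm_cutDown_sub_le hb (by positivity)
      _ = ε / 2 := by field_simp
  calc ‖w * cutDown b δ * star w - a‖
      = ‖w * (cutDown b δ - b) * star w + (w * b * star w - a)‖ := by
        congr 1; noncomm_ring
    _ ≤ _ := norm_add_le _ _
    _ < ε := by linarith

/-- Giving up `ε` of `a` leaves some `δ` of `b` to spare. This is the source of compact containment
in `Cu` and of the openness of comparison. -/
theorem CuntzSub.exists_cutDown {a b : B} (ha : 0 ≤ a) (hb : 0 ≤ b) (h : CuntzSub a b) {ε : ℝ}
    (hε : 0 < ε) : ∃ δ > 0, CuntzSub (cutDown a ε) (cutDown b δ) := by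
  obtain ⟨δ, hδ, w, hw⟩ := h.exists_conj_cutDown hb hε
  refine ⟨δ, hδ, CuntzSub.trans ?_ (CuntzSub.conj w (cutDown b δ))⟩
  rw [norm_sub_rev] at hw
  exact cuntzSub_cutDown_of_norm_sub_le (.of_nonneg ha)
    ((isSelfAdjoint_cutDown b δ).conjugate w) hw.le

/-- In `w a³ w* = (w a) a (w a)*` the outer factors are absorbed into the conjugating element, which
then respects orthogonality. -/
theorem CuntzSub.cube {a : B} (ha : 0 ≤ a) : CuntzSub a (a * a * a) := by
  have hid : cfcₙ (fun t : ℝ => t) a = a := cfcₙ_id' ℝ a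
  have e : a * a * a = cfcₙ (fun t : ℝ => t * t * t) a := by
    rw [cfcₙ_mul (fun t => t * t) (fun t => t) a (by fun_prop) (by simp) (by fun_prop) rfl,
      cfcₙ_mul (fun t => t) (fun t => t) a (by fun_prop) rfl (by fun_prop) rfl, hid]
  rw [e]
  nth_rw 1 [← hid]
  exact cuntzSub_cfcₙ ha (by fun_prop) rfl (by fun_prop) (by simp) (fun t ht => ht)
    (fun t ht => by positivity) (fun t _ ht => by positivity)

theorem CuntzSub.mul_self {a : B} (ha : 0 ≤ a) : CuntzSub a (a * a) := by
  have hid : cfcₙ (fun t : ℝ => t) a = a := cfcₙ_id' ℝ a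
  have e : a * a = cfcₙ (fun t : ℝ => t * t) a := by
    rw [cfcₙ_mul (fun t => t) (fun t => t) a (by fun_prop) rfl (by fun_prop) rfl, hid]
  rw [e]
  nth_rw 1 [← hid]
  exact cuntzSub_cfcₙ ha (by fun_prop) rfl (by fun_prop) (by simp) (fun t ht => ht)
    (fun t ht => by positivity) (fun t _ ht => by positivity)

theorem CuntzSub.mul_self_self {a : B} (ha : 0 ≤ a) : CuntzSub (a * a) a := by
  have hid : cfcₙ (fun t : ℝ => t) a = a := cfcₙ_id' ℝ a
  have e : a * a = cfcₙ (fun t : ℝ => t * t) a := by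
    rw [cfcₙ_mul (fun t => t) (fun t => t) a (by fun_prop) rfl (by fun_prop) rfl, hid]
  rw [e]
  nth_rw 2 [← hid]
  exact cuntzSub_cfcₙ ha (by fun_prop) (by simp) (by fun_prop) rfl
    (fun t ht => by positivity) (fun t ht => ht) fun t ht h => by
      rcases ht.eq_or_lt with rfl | h'
      · simp at h
      · exact h'

/-- The reason is `(c* c)² = c* (c c*) c`. -/
theorem CuntzSub.star_mul_self (c : B) : CuntzSub (star c * c) (c * star c) := by
  refine (CuntzSub.mul_self (star_mul_self_nonneg c)).trans ?_
  have := CuntzSub.star_conj c (c * star c)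
  rwa [show star c * (c * star c) * c = star c * c * (star c * c) by noncomm_ring] at this

theorem cuntzEquiv_star_mul_self (c : B) : CuntzEquiv (star c * c) (c * star c) :=
  ⟨.star_mul_self c, by simpa using CuntzSub.star_mul_self (star c)⟩

/-- Only `a'` and `b'` have to be orthogonal. After passing to their cubes, the conjugating elements
`w a'` and `v b'` can be added, since all cross terms contain `a' b'` or `b' a'`. -/
theorem CuntzSub.add_of_mul_eq_zero {a b a' b' : B} (ha' : 0 ≤ a') (hb' : 0 ≤ b')
    (h : a' * b' = 0) (ha : CuntzSub a a') (hb : CuntzSub b b') : CuntzSub (a + b) (a' + b') := by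
  have hsa := (IsSelfAdjoint.of_nonneg ha').star_eq
  have hsb := (IsSelfAdjoint.of_nonneg hb').star_eq
  have h' : b' * a' = 0 := by rw [← hsa, ← hsb, ← star_mul, h, star_zero]
  obtain ⟨w, hw⟩ := ha.trans (CuntzSub.cube ha')
  obtain ⟨v, hv⟩ := hb.trans (CuntzSub.cube hb')
  refine ⟨fun n => w n * a' + v n * b', (hw.add hv).congr fun n => ?_⟩
  rw [star_add, star_mul, star_mul, hsa, hsb]
  have e1 : (w n * a' + v n * b') * (a' + b') = w n * (a' * a') + v n * (b' * b') := by
    calc _ = w n * (a' * a') + w n * (a' * b') + v n * (b' * a') + v n * (b' * b') := by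
          noncomm_ring
      _ = _ := by rw [h, h']; simp
  rw [e1]
  calc _ = w n * (a' * a') * (a' * star (w n)) + w n * a' * (a' * b') * star (v n)
        + v n * b' * (b' * a') * star (w n) + v n * (b' * b') * (b' * star (v n)) := by
        rw [h, h']; simp [mul_assoc]
    _ = _ := by noncomm_ring

end CutDown

/-! ### Row shifts, and moving representatives inside a stable algebra -/

section Shift

attribute [local instance] CStarAlgebra.spectralOrder CStarAlgebra.spectralOrderedRing

variable {A : Type*} [NonUnitalCStarAlgebra A]

namespace FinMat

theorem rowShift_add (σ : ℕ → ℕ) (hσ : Function.Injective σ) (u v : FinMat A) :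
    rowShift σ hσ (u + v) = rowShift σ hσ u + rowShift σ hσ v := by
  refine ext' fun k j => ?_
  change Function.extend σ (fun i => u.entry i j + v.entry i j) 0 k =
    Function.extend σ (fun i => u.entry i j) 0 k + Function.extend σ (fun i => v.entry i j) 0 k
  by_cases hk : ∃ i, σ i = k
  · obtain ⟨i, rfl⟩ := hk
    simp only [hσ.extend_apply]
  · simp only [Function.extend_apply' _ _ _ hk, Pi.zero_apply, add_zero]

theorem norm_rowShift (σ : ℕ → ℕ) (hσ : Function.Injective σ) (u : FinMat A) :
    ‖rowShift σ hσ u‖ = ‖u‖ := by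
  have h := congrArg norm (star_rowShift_mul_rowShift σ hσ u u)
  rw [CStarRing.norm_star_mul_self, CStarRing.norm_star_mul_self] at h
  exact (mul_self_inj (norm_nonneg _) (norm_nonneg _)).1 h

theorem mul_rowShift_eq_zero (σ : ℕ → ℕ) (hσ : Function.Injective σ) {s : Finset ℕ}
    {w : FinMat A} (hw : SuppOn w s) (h : ∀ i, σ i ∉ s) (u : FinMat A) :
    star w * rowShift σ hσ u = 0 := by
  refine ext' fun i j => ?_
  rw [entry_mul_of_suppOn hw.star, entry_zero]
  refine Finset.sum_eq_zero fun k hk => ?_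
  have : (rowShift σ hσ u).entry k j = 0 := by
    change Function.extend σ (fun i => u.entry i j) 0 k = 0
    rw [Function.extend_apply']
    · rfl
    · rintro ⟨i, rfl⟩
      exact h i hk
  rw [this, mul_zero]

end FinMat

namespace Stab

/-- Left multiplication by the isometry with `i ↦ σ i`. -/
def rowShift (σ : ℕ → ℕ) (hσ : Function.Injective σ) : Stab A → Stab A :=
  UniformSpace.Completion.map (FinMat.rowShift σ hσ)

theorem continuous_rowShift (σ : ℕ → ℕ) (hσ : Function.Injective σ) :
    Continuous (rowShift (A := A) σ hσ) := UniformSpace.Completion.continuous_map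

theorem rowShift_ofFin (σ : ℕ → ℕ) (hσ : Function.Injective σ) (u : FinMat A) :
    rowShift σ hσ (ofFin u) = ofFin (FinMat.rowShift σ hσ u) := by
  refine UniformSpace.Completion.map_coe ?_ u
  exact (AddMonoidHomClass.isometry_of_norm
    (AddMonoidHom.mk' (FinMat.rowShift σ hσ) (FinMat.rowShift_add σ hσ))
    (FinMat.norm_rowShift σ hσ)).uniformContinuous

theorem star_rowShift_mul_rowShift (σ : ℕ → ℕ) (hσ : Function.Injective σ) (x y : Stab A) :
    star (rowShift σ hσ x) * rowShift σ hσ y = star x * y := by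
  have hc := continuous_rowShift (A := A) σ hσ
  refine denseRange_ofFin.induction_on₂ (p := fun x y : Stab A =>
    star (rowShift σ hσ x) * rowShift σ hσ y = star x * y) (isClosed_eq ?_ ?_) (fun u v => ?_) x y
  · exact (hc.comp continuous_fst).star.mul (hc.comp continuous_snd)
  · exact continuous_fst.star.mul continuous_snd
  · rw [rowShift_ofFin, rowShift_ofFin, ← map_star, ← map_mul,
      FinMat.star_rowShift_mul_rowShift, map_mul, map_star]

theorem star_ofFin_mul_rowShift (σ : ℕ → ℕ) (hσ : Function.Injective σ) {s : Finset ℕ}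
    {w : FinMat A} (hw : FinMat.SuppOn w s) (h : ∀ i, σ i ∉ s) (x : Stab A) :
    star (ofFin w) * rowShift σ hσ x = 0 := by
  refine denseRange_ofFin.induction_on (p := fun x : Stab A =>
    star (ofFin w) * rowShift σ hσ x = 0) x (isClosed_eq ?_ continuous_const) fun u => ?_
  · exact (continuous_rowShift σ hσ).const_mul _
  · rw [rowShift_ofFin, ← map_star, ← map_mul, FinMat.mul_rowShift_eq_zero σ hσ hw h, map_zero]

theorem exists_norm_ofFin_sub_lt (x : Stab A) {ε : ℝ} (hε : 0 < ε) :
    ∃ u : FinMat A, ‖ofFin u - x‖ < ε := by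
  obtain ⟨u, hu⟩ := denseRange_ofFin.exists_dist_lt x hε
  exact ⟨u, by rwa [dist_comm, dist_eq_norm] at hu⟩

end Stab

/-- In a stable algebra, `a ≾ b` iff `a` is a limit of elements equivalent to `b`. -/
theorem CuntzSub.exists_cuntzEquiv_near {a b : Stab A} (hb : IsPos b) (h : CuntzSub a b)
    {ε : ℝ} (hε : 0 < ε) : ∃ b', IsPos b' ∧ CuntzEquiv b' b ∧ ‖b' - a‖ < ε := by
  obtain ⟨w, hw⟩ : ∃ w : FinMat A, ‖Stab.ofFin w * b * star (Stab.ofFin w) - a‖ < ε / 2 := by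
    obtain ⟨w, hw⟩ := cuntzSub_iff.1 h _ (half_pos hε)
    have hc : Continuous fun w : Stab A => ‖w * b * star w - a‖ := by fun_prop
    obtain ⟨u, hu⟩ := Stab.denseRange_ofFin.exists_mem_open
      (isOpen_lt hc (continuous_const (y := ε / 2))) ⟨w, hw⟩
    exact ⟨u, hu⟩
  obtain ⟨c, rfl⟩ := hb
  obtain ⟨s, hs⟩ := w.exists_suppOn
  -- Shifting past the support of `w` makes the ranges of `W` and `S` orthogonal, so `Z* Z` below
  -- has no cross terms.
  let σ : ℕ → ℕ := fun n => n + (s.sup id + 1)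
  have hσ : Function.Injective σ := fun m n h => by simpa [σ] using h
  have hσs : ∀ i, σ i ∉ s := fun i hi => by
    have : σ i ≤ s.sup id := Finset.le_sup (f := id) hi
    simp only [σ] at this
    omega
  set W := Stab.ofFin w
  let S := Stab.rowShift σ hσ (star c)
  have hWS : star W * S = 0 := Stab.star_ofFin_mul_rowShift σ hσ hs hσs _
  have hSS : star S * S = c * star c := by
    rw [Stab.star_rowShift_mul_rowShift, star_star]
  -- `Z = W c* + η S c*` for small `η`
  have hlim : Tendsto (fun η : ℝ => (W * star c + η • S) * star (W * star c + η • S)) (𝓝[>] 0)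
      (𝓝 (W * (star c * c) * star W)) := by
    have hc : Continuous fun η : ℝ => (W * star c + η • S) * star (W * star c + η • S) := by
      fun_prop
    have := hc.tendsto 0
    simp only [zero_smul, add_zero, star_mul, star_star] at this
    rw [show W * (star c * c) * star W = W * star c * (c * star W) by noncomm_ring]
    simpa only [star_add, star_mul, star_star] using this.mono_left nhdsWithin_le_nhds
  obtain ⟨η, hη, hη0⟩ := (((Metric.tendsto_nhds.1 hlim) _ (half_pos hε)).and
    self_mem_nhdsWithin).exists
  rw [dist_eq_norm] at hη
  have hη0 : 0 < η := hη0
  set Z := W * star c + η • S with hZ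
  have hZZ : star Z * Z = c * (star W * W) * star c + (η * η) • (c * star c) := by
    have hSW : star S * W = 0 := by
      rw [← star_star (star S * W), star_mul, star_star, hWS, star_zero]
    rw [hZ, star_add, star_mul, star_star, star_smul, star_trivial η, add_mul, mul_add, mul_add,
      smul_mul_assoc, smul_mul_smul_comm, hSS, mul_smul_comm, mul_assoc c (star W) S, hWS,
      ← mul_assoc (star S), hSW]
    simp [mul_assoc]
  refine ⟨Z * star Z, ⟨star Z, by simp⟩, ?_, ?_⟩
  -- `Z* Z = c (W* W + η²) c*` lies between `η² c c*` and `(‖W‖² + η²) c c*`, so `Z Z* ~ Z* Z ~ c c*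
  -- ~ c* c`. The summand `η S` supplies the lower bound and costs little in norm.
  · have hcc : CuntzEquiv (c * star c) (star c * c) := (cuntzEquiv_star_mul_self c).symm
    refine ((cuntzEquiv_star_mul_self Z).symm).trans (CuntzEquiv.trans ?_ hcc)
    constructor
    · refine CuntzSub.trans (b := (‖W‖ * ‖W‖ + η * η) • (c * star c)) ?_
        ((CuntzSub.refl _).smul_left (by positivity))
      refine .of_le (star_mul_self_nonneg Z) ?_
      rw [hZZ, add_smul]
      gcongr
      have := CStarAlgebra.star_left_conjugate_le_norm_smul (a := star c) (b := star W * W)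
        (.star_mul_self W)
      rwa [star_star, CStarRing.norm_star_mul_self] at this
    · refine (CuntzSub.smul_right _ (mul_pos hη0 hη0)).trans (.of_le ?_ ?_)
      · exact smul_nonneg (mul_pos hη0 hη0).le (mul_star_self_nonneg c)
      · rw [hZZ, le_add_iff_nonneg_left]
        rw [show c * (star W * W) * star c = star (W * star c) * (W * star c) by
          rw [star_mul, star_star]; noncomm_ring]
        exact star_mul_self_nonneg _
  · calc ‖Z * star Z - a‖ = ‖(Z * star Z - W * (star c * c) * star W) +
          (W * (star c * c) * star W - a)‖ := by congr 1; abel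
      _ ≤ _ := norm_add_le _ _
      _ < ε := by linarith

end Shift

/-! ### Existence of suprema -/

section Supremum

attribute [local instance] CStarAlgebra.spectralOrder CStarAlgebra.spectralOrderedRing

variable {A : Type*} [NonUnitalCStarAlgebra A]

theorem isClosed_isPos {B : Type*} [NonUnitalCStarAlgebra B] : IsClosed {a : B | IsPos a} := by
  simp only [isPos_iff_nonneg]
  exact CStarAlgebra.isClosed_nonneg

/-- Cuntz comparison from below is an open condition, after cutting down. -/
theorem CuntzSub.eventually_cutDown {B : Type*} [NonUnitalCStarAlgebra B] {a b : B} (ha : 0 ≤ a)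
    (hb : 0 ≤ b) (h : CuntzSub a b) {ε : ℝ} (hε : 0 < ε) :
    ∀ᶠ s in 𝓝 b, IsPos s → CuntzSub (cutDown a ε) s := by
  obtain ⟨δ, hδ, h1⟩ := h.exists_cutDown ha hb hε
  filter_upwards [Metric.ball_mem_nhds b hδ] with s hs hs'
  refine h1.trans (cuntzSub_cutDown_of_norm_sub_le (.of_nonneg hb)
    (.of_nonneg (isPos_iff_nonneg.1 hs')) ?_)
  rw [Metric.mem_ball, dist_comm, dist_eq_norm] at hs
  exact hs.le

/-- Suprema of increasing sequences of classes, in a form which also gives compact containment. -/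
theorem exists_sup_of_cuntzSub {a : ℕ → Stab A} (ha : ∀ n, IsPos (a n))
    (h : ∀ n, CuntzSub (a n) (a (n + 1))) : ∃ s, IsPos s ∧ (∀ n, CuntzSub (a n) s) ∧
      ∀ ε > 0, ∃ n, CuntzSub (cutDown s ε) (a n) := by
  have hmono : ∀ m n, m ≤ n → CuntzSub (a m) (a n) := fun m n hmn =>
    Nat.le_induction (.refl _) (fun k _ hk => hk.trans (h k)) n hmn
  -- a nested sequence of balls
  let P : ℕ → Stab A × ℝ → Prop := fun m p => IsPos p.1 ∧ CuntzEquiv p.1 (a m) ∧ 0 < p.2 ∧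
    p.2 ≤ 1 / ((m : ℝ) + 1) ∧ ∀ s ∈ Metric.closedBall p.1 p.2, IsPos s → ∀ n ≤ m,
      CuntzSub (cutDown (a n) (1 / ((m : ℝ) + 1))) s
  -- Comparison from below is open after a cut-down, so a whole ball around a representative of `[a
  -- m]` still dominates the finitely many `(a n - 1/(m+1))₊` with `n ≤ m`.
  have hexist : ∀ m (c : Stab A) (U : Set (Stab A)), IsPos c → CuntzEquiv c (a m) → U ∈ 𝓝 c →
      ∃ r, P m (c, r) ∧ Metric.closedBall c r ⊆ U := by
    intro m c U hc hcm hU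
    have h1 : ∀ᶠ s in 𝓝 c, ∀ n ∈ Finset.range (m + 1),
        IsPos s → CuntzSub (cutDown (a n) (1 / ((m : ℝ) + 1))) s := by
      refine (Finset.eventually_all _).2 fun n hn => ?_
      exact CuntzSub.eventually_cutDown (isPos_iff_nonneg.1 (ha n)) (isPos_iff_nonneg.1 hc)
        ((hmono n m (by simpa [Nat.lt_succ_iff] using hn)).trans hcm.2) (by positivity)
    obtain ⟨r, hr, hrs⟩ := Metric.nhds_basis_closedBall.mem_iff.1 (inter_mem h1 hU)
    refine ⟨min r (1 / ((m : ℝ) + 1)), ⟨hc, hcm, lt_min hr (by positivity), min_le_right _ _,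
      fun s hs hs' n hn => ?_⟩, fun s hs => ?_⟩
    · exact (hrs (Metric.closedBall_subset_closedBall (min_le_left _ _) hs)).1 n
        (by simpa [Nat.lt_succ_iff] using hn) hs'
    · exact (hrs (Metric.closedBall_subset_closedBall (min_le_left _ _) hs)).2
  have hstep : ∀ m (p : Stab A × ℝ), P m p → ∃ q : Stab A × ℝ, P (m + 1) q ∧
      Metric.closedBall q.1 q.2 ⊆ Metric.closedBall p.1 p.2 := by
    rintro m ⟨c, r⟩ ⟨hc, hcm, hr, -, -⟩
    -- Stability is used here: `a (m + 1)` has an equivalent copy inside the current ball, so the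
    -- balls can be nested and their centres converge.
    obtain ⟨c', hc', hcm', hcc⟩ := (hcm.1.trans (h m)).exists_cuntzEquiv_near (ha (m + 1)) hr
    obtain ⟨r', hr', hsub⟩ := hexist (m + 1) c' (Metric.closedBall c r) hc' hcm'
      (Metric.closedBall_mem_nhds_of_mem (by rwa [Metric.mem_ball, dist_eq_norm]))
    exact ⟨(c', r'), hr', hsub⟩
  choose! next hnext1 hnext2 using hstep
  obtain ⟨r0, hr0, -⟩ := hexist 0 (a 0) Set.univ (ha 0) (CuntzEquiv.refl _) univ_mem
  let p : ℕ → Stab A × ℝ := fun n => Nat.rec (a 0, r0) (fun m q => next m q) n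
  have hp : ∀ n, P n (p n) := fun n => by
    induction n with
    | zero => exact hr0
    | succ n ih => exact hnext1 n _ ih
  have hball : ∀ m n, m ≤ n → Metric.closedBall (p n).1 (p n).2 ⊆
      Metric.closedBall (p m).1 (p m).2 := fun m n hmn =>
    Nat.le_induction subset_rfl (fun k _ hk => (hnext2 k _ (hp k)).trans hk) n hmn
  have hmem : ∀ m n, m ≤ n → (p n).1 ∈ Metric.closedBall (p m).1 (p m).2 := fun m n hmn =>
    hball m n hmn (Metric.mem_closedBall_self (hp n).2.2.1.le)
  have hcauchy : CauchySeq fun n => (p n).1 := by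
    refine cauchySeq_of_le_tendsto_0 (fun n : ℕ => 2 * (1 / ((n : ℝ) + 1))) (fun n m N hn hm => ?_) ?_
    · have h1 := Metric.mem_closedBall.1 (hmem N n hn)
      have h2 := Metric.mem_closedBall.1 (hmem N m hm)
      have h3 := (hp N).2.2.2.1
      have := dist_triangle_right (p n).1 (p m).1 (p N).1
      linarith
    · simpa using (tendsto_one_div_add_atTop_nhds_zero_nat (𝕜 := ℝ)).const_mul 2
  obtain ⟨s, hs⟩ := cauchySeq_tendsto_of_complete hcauchy
  have hspos : IsPos s := isClosed_isPos.mem_of_tendsto hs (.of_forall fun n => (hp n).1)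
  have hsm : ∀ m, s ∈ Metric.closedBall (p m).1 (p m).2 := fun m =>
    Metric.isClosed_closedBall.mem_of_tendsto hs
      ((eventually_ge_atTop m).mono fun n hn => hmem m n hn)
  refine ⟨s, hspos, fun n => ?_, fun ε hε => ?_⟩
  · refine CuntzSub.of_forall_cutDown (isPos_iff_nonneg.1 (ha n)) fun ε hε => ?_
    obtain ⟨m, hm⟩ := exists_nat_one_div_lt hε
    have h1 := (hp (max m n)).2.2.2.2 s (hsm _) hspos n (le_max_right _ _)
    refine (CuntzSub.cutDown_anti _ (by positivity) ?_).trans h1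
    refine le_trans ?_ hm.le
    gcongr
    exact le_max_left _ _
  -- The limit lies within `1/(m+1) < ε` of a centre equivalent to `a m`, which bounds its cut-down
  -- from above.
  · obtain ⟨m, hm⟩ := exists_nat_one_div_lt hε
    refine ⟨m, CuntzSub.trans ?_ (hp m).2.1.1⟩
    refine cuntzSub_cutDown_of_norm_sub_le (.of_nonneg (isPos_iff_nonneg.1 hspos))
      (.of_nonneg (isPos_iff_nonneg.1 (hp m).1)) ?_
    rw [← dist_eq_norm]
    exact ((Metric.mem_closedBall.1 (hsm m)).trans (hp m).2.2.2.1).trans hm.le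

end Supremum

/-! ### The axioms (O1)–(O4) and functoriality -/

section CuSemigroup

attribute [local instance] CStarAlgebra.spectralOrder CStarAlgebra.spectralOrderedRing

variable {A B : Type*} [NonUnitalCStarAlgebra A] [NonUnitalCStarAlgebra B]

theorem PosStab.nonneg (a : PosStab A) : 0 ≤ a.1 := isPos_iff_nonneg.1 a.2

/-- The element `(a - ε)₊` of the positive cone of `A ⊗ K`. -/
def PosStab.cut (a : PosStab A) (ε : ℝ) : PosStab A := ⟨cutDown a.1 ε, isPos_cutDown a.1 ε⟩

namespace Cu

theorem cut_le (a : PosStab A) {ε : ℝ} (hε : 0 ≤ ε) : mk (a.cut ε) ≤ mk a :=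
  mk_le_mk.2 (.cutDown_self a.nonneg hε)

theorem cut_le_cut (a : PosStab A) {ε δ : ℝ} (hδ : 0 ≤ δ) (h : δ ≤ ε) :
    mk (a.cut ε) ≤ mk (a.cut δ) := mk_le_mk.2 (.cutDown_anti a.1 hδ h)

theorem cut_cut (a : PosStab A) {ε δ : ℝ} (hε : 0 ≤ ε) (hδ : 0 ≤ δ) :
    (a.cut ε).cut δ = a.cut (ε + δ) :=
  Subtype.ext (cutDown_cutDown (.of_nonneg a.nonneg) hε hδ)

theorem mk_le_of_forall_cut {a : PosStab A} {x : Cu A} (h : ∀ ε > 0, mk (a.cut ε) ≤ x) :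
    mk a ≤ x := by
  obtain ⟨b, rfl⟩ := mk_surjective x
  exact mk_le_mk.2 (.of_forall_cutDown a.nonneg fun ε hε => mk_le_mk.1 (h ε hε))

theorem exists_isLUB (u : ℕ → Cu A) (hu : Monotone u) :
    ∃ s : PosStab A, IsLUB (Set.range u) (mk s) ∧ ∀ ε > 0, ∃ n, mk (s.cut ε) ≤ u n := by
  choose a ha using fun n => mk_surjective (u n)
  obtain ⟨s, hs, h1, h2⟩ := exists_sup_of_cuntzSub (a := fun n => (a n).1) (fun n => (a n).2)
    fun n => by
      have := hu n.le_succ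
      rw [← ha, ← ha] at this
      exact mk_le_mk.1 this
  have h3 : ∀ ε > 0, ∃ n, mk (PosStab.cut ⟨s, hs⟩ ε) ≤ u n := fun ε hε => by
    obtain ⟨n, hn⟩ := h2 ε hε
    exact ⟨n, by rw [← ha]; exact mk_le_mk.2 hn⟩
  refine ⟨⟨s, hs⟩, ⟨?_, fun x hx => mk_le_of_forall_cut fun ε hε => ?_⟩, h3⟩
  · rintro _ ⟨n, rfl⟩
    rw [← ha]
    exact mk_le_mk.2 (h1 n)
  · obtain ⟨n, hn⟩ := h3 ε hε
    exact hn.trans (hx ⟨n, rfl⟩)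

/-- The supremum of an increasing sequence has a representative `s` all of whose cut-downs lie below
terms of the sequence. If `a ≾ s`, then `(a - ε)₊ ≾ (s - δ)₊` for some `δ > 0`. -/
theorem wayBelow_cut (a : PosStab A) {ε : ℝ} (hε : 0 < ε) : WayBelow (mk (a.cut ε)) (mk a) := by
  intro u x hu hx hax
  obtain ⟨s, hs, h⟩ := exists_isLUB u hu
  obtain rfl := hx.unique hs
  obtain ⟨δ, hδ, h1⟩ := CuntzSub.exists_cutDown a.nonneg s.nonneg (mk_le_mk.1 hax) hε
  obtain ⟨n, hn⟩ := h δ hδ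
  exact ⟨n, (mk_le_mk.2 h1 : mk (a.cut ε) ≤ mk (s.cut δ)).trans hn⟩

theorem monotone_cut (a : PosStab A) : Monotone fun n : ℕ => mk (a.cut (1 / ((n : ℝ) + 1))) := by
  intro m n hmn
  exact cut_le_cut a (by positivity) (by gcongr)

theorem isLUB_cut (a : PosStab A) :
    IsLUB (Set.range fun n : ℕ => mk (a.cut (1 / ((n : ℝ) + 1)))) (mk a) := by
  refine ⟨?_, fun x hx => mk_le_of_forall_cut fun ε hε => ?_⟩
  · rintro _ ⟨n, rfl⟩
    exact cut_le a (by positivity)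
  · obtain ⟨n, hn⟩ := exists_nat_one_div_lt hε
    exact (cut_le_cut a (by positivity) hn.le).trans (hx ⟨n, rfl⟩)

theorem _root_.CuntzSemigroup.WayBelow.exists_le_cut {x : Cu A} {a : PosStab A}
    (h : WayBelow x (mk a)) : ∃ ε > 0, x ≤ mk (a.cut ε) := by
  obtain ⟨n, hn⟩ := h _ _ (monotone_cut a) (isLUB_cut a) le_rfl
  exact ⟨_, by positivity, hn⟩

theorem _root_.CuntzSemigroup.WayBelow.of_le_of_wayBelow {S : Type*} [PartialOrder S] {x y z : S}
    (h : x ≤ y) (h' : WayBelow y z) : WayBelow x z := fun u s hu hs hzs => by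
  obtain ⟨n, hn⟩ := h' u s hu hs hzs
  exact ⟨n, h.trans hn⟩

theorem add_le_add {x y x' y' : Cu A} (h : x ≤ y) (h' : x' ≤ y') : x + x' ≤ y + y' := by
  obtain ⟨a, rfl⟩ := mk_surjective x
  obtain ⟨b, rfl⟩ := mk_surjective y
  obtain ⟨c, rfl⟩ := mk_surjective x'
  obtain ⟨d, rfl⟩ := mk_surjective y'
  exact mk_le_mk.2 (CuntzSub.osum (mk_le_mk.1 h) (mk_le_mk.1 h'))

/-- The orthogonal sum as a homomorphism. -/
def osumHom : Stab A × Stab A →⋆ₙₐ[ℂ] Stab A where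
  toFun x := osum x.1 x.2
  map_smul' c x := by simp [osum]
  map_zero' := by simp [osum]
  map_add' x y := by
    simp only [osum, Prod.fst_add, Prod.snd_add, map_add]
    abel
  map_mul' x y := by
    simp [osum, mul_add, add_mul, even_mul_odd, odd_mul_even]
  map_star' x := by simp [osum, map_star]

/-- Functional calculus in the product algebra is componentwise, and the orthogonal sum is a
⋆-homomorphism on the product. Axioms (O3) and (O4) both rest on this. -/
theorem osum_cutDown {a b : Stab A} (ha : 0 ≤ a) (hb : 0 ≤ b) {ε : ℝ} (hε : 0 ≤ ε) :
    osum (cutDown a ε) (cutDown b ε) = cutDown (osum a b) ε := by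
  have hab : IsSelfAdjoint (a, b) :=
    Prod.ext (IsSelfAdjoint.of_nonneg ha).star_eq (IsSelfAdjoint.of_nonneg hb).star_eq
  have h1 : cutDown (a, b) ε = (cutDown a ε, cutDown b ε) :=
    cfcₙ_map_prod (S := ℝ) _ a b (by fun_prop) hab (IsSelfAdjoint.of_nonneg ha)
      (IsSelfAdjoint.of_nonneg hb)
  have h2 := map_cutDown osumHom hab hε
  rw [h1] at h2
  exact h2

theorem mk_cut_add_mk_cut (a b : PosStab A) {ε : ℝ} (hε : 0 ≤ ε) :
    mk (a.cut ε) + mk (b.cut ε) =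
      mk (PosStab.cut ⟨osum a.1 b.1, a.2.osum b.2⟩ ε) := by
  rw [mk_add_mk]
  exact congrArg mk (Subtype.ext (osum_cutDown a.nonneg b.nonneg hε))

variable (A) in
theorem isCuSemigroup : IsCuSemigroup (Cu A) where
  zero_le x := by
    obtain ⟨a, rfl⟩ := mk_surjective x
    exact mk_le_mk.2 (.zero a.1)
  add_le_add _ _ _ _ := add_le_add
  exists_sup u hu := (exists_isLUB u hu).imp' mk fun _ h => h.1
  exists_wayBelow x := by
    obtain ⟨a, rfl⟩ := mk_surjective x
    refine ⟨_, fun n => ?_, isLUB_cut a⟩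
    have h0 : (0 : ℝ) < 1 / (n + 1) - 1 / ((n + 1 : ℕ) + 1) := by
      rw [sub_pos]
      push_cast
      gcongr
      linarith
    have h := wayBelow_cut (a.cut (1 / (((n + 1 : ℕ) : ℝ) + 1))) h0
    rwa [cut_cut a (by positivity) h0.le, add_sub_cancel] at h
  wayBelow_add x' x y' y hx hy := by
    obtain ⟨a, rfl⟩ := mk_surjective x
    obtain ⟨b, rfl⟩ := mk_surjective y
    obtain ⟨ε, hε, h1⟩ := hx.exists_le_cut
    obtain ⟨δ, hδ, h2⟩ := hy.exists_le_cut
    have hm : 0 < min ε δ := lt_min hε hδ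
    refine .of_le_of_wayBelow (add_le_add
      (h1.trans (cut_le_cut a hm.le (min_le_left _ _)))
      (h2.trans (cut_le_cut b hm.le (min_le_right _ _)))) ?_
    rw [mk_cut_add_mk_cut a b hm.le]
    exact wayBelow_cut _ hm
  sup_add u v x y hu hv hx hy := by
    obtain ⟨a, rfl⟩ := mk_surjective x
    obtain ⟨b, rfl⟩ := mk_surjective y
    refine ⟨?_, fun z hz => mk_le_of_forall_cut fun ε hε => ?_⟩
    · rintro _ ⟨n, rfl⟩
      exact add_le_add (hx.1 ⟨n, rfl⟩) (hy.1 ⟨n, rfl⟩)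
    · obtain ⟨m, hm⟩ := wayBelow_cut a hε u _ hu hx le_rfl
      obtain ⟨n, hn⟩ := wayBelow_cut b hε v _ hv hy le_rfl
      rw [← mk_cut_add_mk_cut a b hε.le]
      refine (add_le_add (hm.trans (hu (le_max_left m n)))
        (hn.trans (hv (le_max_right m n)))).trans (hz ⟨max m n, rfl⟩)

theorem map_mk_cut (φ : A →⋆ₙₐ[ℂ] B) (a : PosStab A) {ε : ℝ} (hε : 0 ≤ ε) :
    map φ (mk (a.cut ε)) = mk (PosStab.cut ⟨Stab.map φ a.1, a.2.map (Stab.map φ)⟩ ε) := by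
  rw [map_mk]
  exact congrArg mk (Subtype.ext (map_cutDown (Stab.map φ) (.of_nonneg a.nonneg) hε))

theorem isCuMorphism_map (φ : A →⋆ₙₐ[ℂ] B) : IsCuMorphism (Cu.map φ) := by
  have hle : ∀ x y : Cu A, x ≤ y → map φ x ≤ map φ y := fun x y h => by
    obtain ⟨a, rfl⟩ := mk_surjective x
    obtain ⟨b, rfl⟩ := mk_surjective y
    exact mk_le_mk.2 (CuntzSub.map (mk_le_mk.1 h) _)
  refine ⟨isCuSemigroup A, isCuSemigroup B, ?_, fun x y => ?_, hle, fun x y h => ?_,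
    fun u s hu hs => ?_⟩
  · exact congrArg mk (Subtype.ext (map_zero (Stab.map φ)))
  · obtain ⟨a, rfl⟩ := mk_surjective x
    obtain ⟨b, rfl⟩ := mk_surjective y
    refine congrArg mk (Subtype.ext ?_)
    change Stab.map φ (evenEmb a.1 + oddEmb b.1) = evenEmb _ + oddEmb _
    rw [map_add, evenEmb, oddEmb, Stab.map_reindex, Stab.map_reindex]
    rfl
  · obtain ⟨b, rfl⟩ := mk_surjective y
    obtain ⟨ε, hε, h1⟩ := h.exists_le_cut
    refine .of_le_of_wayBelow (hle _ _ h1) ?_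
    rw [map_mk_cut φ b hε.le]
    exact wayBelow_cut _ hε
  · obtain ⟨a, rfl⟩ := mk_surjective s
    refine ⟨?_, fun z hz => mk_le_of_forall_cut fun ε hε => ?_⟩
    · rintro _ ⟨n, rfl⟩
      exact hle _ _ (hs.1 ⟨n, rfl⟩)
    · obtain ⟨n, hn⟩ := wayBelow_cut a hε u _ hu hs le_rfl
      rw [← map_mk_cut φ a hε.le]
      exact (hle _ _ hn).trans (hz ⟨n, rfl⟩)

end Cu

end CuSemigroup

/-! ### Descent to the fixed point algebra through invariant matrices -/

section FixedPoint

attribute [local instance] CStarAlgebra.spectralOrder CStarAlgebra.spectralOrderedRing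

variable {B C : Type*} [NonUnitalCStarAlgebra B] [NonUnitalCStarAlgebra C]
variable {G : Type*} [Group G] [Fintype G]

/-- `j` identifies `B` with the fixed point algebra of the action `γ` on `C`. -/
structure IsFixedPointEmbedding (γ : G → C →⋆ₙₐ[ℂ] C) (j : B →⋆ₙₐ[ℂ] C) : Prop where
  norm_map : ∀ b, ‖j b‖ = ‖b‖
  mul_apply : ∀ g h x, γ (g * h) x = γ g (γ h x)
  one_apply : ∀ x, γ 1 x = x
  fixed : ∀ g b, γ g (j b) = j b
  exists_eq : ∀ c, (∀ g, γ g c = c) → ∃ b, j b = c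

/-- The matrices over `C`, indexed by `G`, which are invariant under the diagonal action. -/
def invMatrices (γ : G → C →⋆ₙₐ[ℂ] C) : NonUnitalStarSubalgebra ℂ (CStarMatrix G G C) where
  carrier := {M | ∀ g h k, γ g (M h k) = M (g * h) (g * k)}
  add_mem' := fun ha hb g h k => by
    rw [CStarMatrix.add_apply, map_add, ha, hb, CStarMatrix.add_apply]
  zero_mem' := fun g h k => map_zero (γ g)
  mul_mem' := fun {M N} ha hb g h k => by
    rw [CStarMatrix.mul_apply, CStarMatrix.mul_apply, map_sum]
    refine Fintype.sum_equiv (Equiv.mulLeft g) _ _ fun m => ?_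
    rw [map_mul, ha, hb]
    rfl
  smul_mem' := fun c M ha g h k => by
    rw [CStarMatrix.smul_apply, map_smul, ha, CStarMatrix.smul_apply]
  star_mem' := fun ha g h k => by
    rw [CStarMatrix.star_apply, map_star, ha, CStarMatrix.star_apply]

instance isClosed_invMatrices (γ : G → C →⋆ₙₐ[ℂ] C) :
    IsClosed (invMatrices γ : Set (CStarMatrix G G C)) := by
  have h : (invMatrices γ : Set (CStarMatrix G G C)) =
      ⋂ (g : G) (h : G) (k : G), {M | γ g (M h k) = M (g * h) (g * k)} := by
    ext M
    simp only [Set.mem_iInter]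
    exact Iff.rfl
  have hc : ∀ h k : G, Continuous fun M : CStarMatrix G G C => M h k := fun h k =>
    (continuous_apply k).comp (continuous_apply (A := fun _ => G → C) h)
  rw [h]
  exact isClosed_iInter fun g => isClosed_iInter fun h => isClosed_iInter fun k =>
    isClosed_eq ((map_continuous (γ g)).comp (hc h k)) (hc _ _)

open Classical in
/-- The diagonal embedding of `C` into the invariant matrices. -/
def diagInv (γ : G → C →⋆ₙₐ[ℂ] C) (hγ : ∀ g h x, γ (g * h) x = γ g (γ h x)) :
    C →⋆ₙₐ[ℂ] invMatrices γ where
  toFun c := ⟨CStarMatrix.ofMatrix fun g k => if g = k then γ g c else 0, fun g h k => by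
    change γ g (if h = k then γ h c else 0) = if g * h = g * k then γ (g * h) c else 0
    simp only [mul_right_inj]
    split_ifs
    · rw [hγ]
    · exact map_zero _⟩
  map_smul' c x := Subtype.ext (CStarMatrix.ext fun g k => by
    change (if g = k then γ g (c • x) else 0) = c • (if g = k then γ g x else 0)
    rw [map_smul, smul_ite, smul_zero])
  map_zero' := Subtype.ext (CStarMatrix.ext fun g k => by
    change (if g = k then γ g 0 else 0) = 0
    rw [map_zero, ite_self])
  map_add' x y := Subtype.ext (CStarMatrix.ext fun g k => by
    change (if g = k then γ g (x + y) else 0) =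
      (if g = k then γ g x else 0) + (if g = k then γ g y else 0)
    rw [map_add]
    split_ifs <;> simp)
  map_mul' x y := Subtype.ext (CStarMatrix.ext fun g k => by
    change (if g = k then γ g (x * y) else 0) =
      ∑ m, (if g = m then γ g x else 0) * (if m = k then γ m y else 0)
    rw [map_mul]
    by_cases h : g = k
    · subst h; simp
    · simp [h])
  map_star' x := Subtype.ext (CStarMatrix.ext fun g k => by
    change (if g = k then γ g (star x) else 0) = star (if k = g then γ k x else 0)
    by_cases h : g = k
    · subst h; simp [map_star]
    · simp [h, Ne.symm h])

/-- The C⋆-norm of a finite matrix algebra induces the product topology, so small entries force a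
small norm. -/
theorem exists_entry_bound (ι C : Type*) [Fintype ι] [NonUnitalCStarAlgebra C] {ε : ℝ}
    (hε : 0 < ε) : ∃ ε' > 0, ∀ M : CStarMatrix ι ι C, (∀ i k, ‖M i k‖ < ε') → ‖M‖ < ε := by
  have hc : Continuous fun f : ι → ι → C => (CStarMatrix.ofMatrix f : CStarMatrix ι ι C) :=
    continuous_id
  have h0 : Continuous fun f : ι → ι → C => ‖(CStarMatrix.ofMatrix f : CStarMatrix ι ι C)‖ :=
    hc.norm
  obtain ⟨ε', hε', h⟩ := Metric.mem_nhds_iff.1 (h0.continuousAt (x := 0) |>.preimage_mem_nhds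
    (Iio_mem_nhds (show ‖(0 : CStarMatrix ι ι C)‖ < ε by rwa [norm_zero])))
  refine ⟨ε', hε', fun M hM => ?_⟩
  refine h (?_ : (fun i k => M i k) ∈ _)
  rw [mem_ball_zero_iff, pi_norm_lt_iff hε']
  intro i
  rw [pi_norm_lt_iff hε']
  exact hM i

/-- Comparison with `(z* h z - ε)₊` in `C` passes to comparison with `h` in the fixed point
algebra if the translates of `z` are almost orthogonal with respect to `h`. -/
theorem IsFixedPointEmbedding.cuntzSub_of_cuntzSub_conj {γ : G → C →⋆ₙₐ[ℂ] C} {j : B →⋆ₙₐ[ℂ] C}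
    (H : IsFixedPointEmbedding γ j) {ε ε' : ℝ} (hε : 0 < ε) (hε' : 0 < ε')
    (hbd : ∀ M : CStarMatrix G G C, (∀ i k, ‖M i k‖ < ε') → ‖M‖ < ε) {h : B} (hh : 0 ≤ h)
    {z : C} (hz : ∀ k, k ≠ 1 → ‖star z * j h * γ k z‖ < ε') {c : B}
    (hc : CuntzSub (j c) (cutDown (star z * j h * z) ε)) : CuntzSub c h := by
  classical
  have hjh : star (j h) = j h := by rw [← map_star, (IsSelfAdjoint.of_nonneg hh).star_eq]
  set y := star z * j h * z with hy
  set x := cutDown y ε with hx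
  have hys : IsSelfAdjoint y := by
    rw [hy, isSelfAdjoint_iff, star_mul, star_mul, star_star, hjh, mul_assoc]
  -- `Y` is `Z* h Z` for the row `Z = (γ_k z)_k`, and `Δ y` is its diagonal. Off-diagonal entries
  -- are translates of `z* h γ_k(z)` with `k ≠ 1`, hence small. So `‖Δ y - Y‖ ≤ ε` and `Δ x ≾ Y`,
  -- with conjugating matrices that are themselves invariant.
  let Y : invMatrices γ := ⟨CStarMatrix.ofMatrix fun g k => star (γ g z) * j h * γ k z,
    fun g h k => by
      change γ g (star (γ h z) * j _ * γ k z) = star (γ (g * h) z) * j _ * γ (g * k) z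
      simp only [map_mul, map_star, H.fixed, H.mul_apply]⟩
  have hYa : ∀ g k, (Y : CStarMatrix G G C) g k = star (γ g z) * j h * γ k z := fun _ _ => rfl
  have hYs : IsSelfAdjoint Y := by
    refine Subtype.ext (CStarMatrix.ext fun g k => ?_)
    change star (star (γ k z) * j h * γ g z) = star (γ g z) * j h * γ k z
    rw [star_mul, star_mul, star_star, hjh, mul_assoc]
  let Δ := diagInv γ H.mul_apply
  have hDY : ‖Δ y - Y‖ ≤ ε := by
    refine (hbd _ fun g k => ?_).le
    change ‖(if g = k then γ g y else 0) - star (γ g z) * j h * γ k z‖ < ε'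
    split_ifs with hgk
    · subst hgk
      rw [hy, map_mul, map_mul, map_star, H.fixed, sub_self, norm_zero]
      exact hε'
    · have e : star (γ g z) * j h * γ k z = γ g (star z * j h * γ (g⁻¹ * k) z) := by
        rw [map_mul, map_mul, map_star, H.fixed, ← H.mul_apply, mul_inv_cancel_left]
      rw [zero_sub, norm_neg, e]
      exact (NonUnitalStarAlgHom.norm_apply_le _ _).trans_lt
        (hz _ fun h1 => hgk (inv_mul_eq_one.1 h1))
  have hsub : CuntzSub (Δ x) Y := by
    rw [hx, map_cutDown Δ hys hε.le]
    exact cuntzSub_cutDown_of_norm_sub_le (hys.map Δ) hYs hDY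
  have hN : 0 < (Fintype.card G : ℝ) := by exact_mod_cast Fintype.card_pos
  set N : ℝ := (Fintype.card G : ℝ) with hNdef
  -- Averaging over `G` will produce `∑ γ_g(j c) = N • j c`, so the multiple `N • c` is the natural
  -- element to compare.
  refine (CuntzSub.smul_right c hN).trans (cuntzSub_iff.2 fun κ hκ => ?_)
  obtain ⟨w, hw⟩ := cuntzSub_iff.1 hc (κ / (2 * N)) (by positivity)
  obtain ⟨R, hR⟩ := cuntzSub_iff.1 hsub (κ / (2 * (N * (N * (‖w‖ * ‖w‖)) + 1))) (by positivity)
  set E : CStarMatrix G G C := ((R * Y * star R - Δ x : invMatrices γ) : CStarMatrix G G C)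
    with hE
  replace hR : ‖E‖ < κ / (2 * (N * (N * (‖w‖ * ‖w‖)) + 1)) := hR
  let r : G → G → C := fun g k => (R : CStarMatrix G G C) g k
  have hr : ∀ g h k, γ g (r h k) = r (g * h) (g * k) := R.2
  -- The column `p = R Z*`: the products `p_g h p_k*` are the entries of `R Y R*`, which is the
  -- diagonal matrix `Δ x` up to the error `E`.
  let p : G → C := fun g => ∑ l, r g l * star (γ l z)
  have hEa : ∀ g k, p g * j h * star (p k) = E g k + if g = k then γ g x else 0 := by
    intro g k
    have e1 : E g k = ((R : CStarMatrix G G C) * (Y : CStarMatrix G G C) *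
        star (R : CStarMatrix G G C)) g k - if g = k then γ g x else 0 := rfl
    rw [e1, sub_add_cancel, CStarMatrix.mul_apply]
    simp only [p, star_sum, star_mul, star_star, Finset.mul_sum]
    refine Finset.sum_congr rfl fun m _ => ?_
    rw [CStarMatrix.mul_apply, CStarMatrix.star_apply]
    simp only [hYa, Finset.sum_mul]
    refine Finset.sum_congr rfl fun l _ => ?_
    change r g l * star (γ l z) * j h * (γ m z * star (r k m)) =
      r g l * (star (γ l z) * j h * γ m z) * star (r k m)
    simp only [mul_assoc]
  -- Invariance of `R` gives `γ_k(p_g) = p_{kg}`, so the sum is fixed. As `p_g h p_k*` is nearly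
  -- zero for `g ≠ k`, `u h u*` is close to `∑ γ_g(w x w*)`, hence to `N • c`.
  obtain ⟨u, hu⟩ := H.exists_eq (∑ g, γ g w * p g) fun g => by
    rw [map_sum]
    refine Fintype.sum_equiv (Equiv.mulLeft g) _ _ fun m => ?_
    simp only [p, map_mul, map_sum, map_star, Equiv.coe_mulLeft, H.mul_apply, hr]
    congr 1
    refine Fintype.sum_equiv (Equiv.mulLeft g) _ _ fun l => ?_
    simp only [Equiv.coe_mulLeft, H.mul_apply]
  refine ⟨u, ?_⟩
  have e : j (u * h * star u - N • c) =
      (∑ g, ∑ k, γ g w * E g k * star (γ k w)) + ∑ g, γ g (w * x * star w - j c) := by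
    have e1 : j (N • c) = ∑ _g : G, j c := by
      rw [Finset.sum_const, Finset.card_univ, ← Nat.cast_smul_eq_nsmul ℝ, hNdef]
      exact LinearMap.map_smul_of_tower (j : B →ₗ[ℂ] C) (Fintype.card G : ℝ) c
    rw [map_sub, map_mul, map_mul, map_star, hu, e1, star_sum, Finset.sum_mul, Finset.sum_mul_sum]
    simp only [map_sub, H.fixed, Finset.sum_sub_distrib]
    rw [← add_sub_assoc]
    congr 1
    rw [← Finset.sum_add_distrib]
    refine Finset.sum_congr rfl fun g _ => ?_
    have e2 : ∀ k, γ g w * p g * j h * star (γ k w * p k) = γ g w * E g k * star (γ k w) +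
        if g = k then γ g (w * x * star w) else 0 := by
      intro k
      have e3 : γ g w * p g * j h * star (γ k w * p k) =
          γ g w * (p g * j h * star (p k)) * star (γ k w) := by
        rw [star_mul]; simp only [mul_assoc]
      rw [e3, hEa, mul_add, add_mul]
      congr 1
      split_ifs with hgk
      · subst hgk
        rw [map_mul, map_mul, map_star]
      · simp
    simp only [e2, Finset.sum_add_distrib]
    simp
  rw [← H.norm_map, e]
  have hγ : ∀ g x, ‖γ g x‖ ≤ ‖x‖ := fun g x => NonUnitalStarAlgHom.norm_apply_le _ _
  have b1 : ‖∑ g, ∑ k, γ g w * E g k * star (γ k w)‖ ≤ N * (N * (‖w‖ * ‖w‖)) * ‖E‖ := by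
    have : ∀ g k, ‖γ g w * E g k * star (γ k w)‖ ≤ ‖w‖ * ‖E‖ * ‖w‖ := fun g k => by
      refine (norm_mul_le _ _).trans ?_
      rw [norm_star]
      refine mul_le_mul ((norm_mul_le _ _).trans ?_) (hγ _ _) (norm_nonneg _) (by positivity)
      exact mul_le_mul (hγ _ _) CStarMatrix.norm_entry_le_norm (norm_nonneg _) (norm_nonneg _)
    refine (norm_sum_le_of_le _ fun g _ => norm_sum_le_of_le _ fun k _ => this g k).trans ?_
    simp only [Finset.sum_const, Finset.card_univ, nsmul_eq_mul]
    exact le_of_eq (by ring)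
  have b2 : ‖∑ g, γ g (w * x * star w - j c)‖ ≤ N * (κ / (2 * N)) := by
    refine (norm_sum_le_of_le _ fun g _ => (hγ g _).trans hw.le).trans ?_
    simp [hNdef]
  have b3 : N * (N * (‖w‖ * ‖w‖)) * ‖E‖ < κ / 2 := by
    set T := N * (N * (‖w‖ * ‖w‖)) with hT
    have hT0 : 0 ≤ T := by positivity
    calc T * ‖E‖ ≤ T * (κ / (2 * (T + 1))) := by gcongr
      _ < (T + 1) * (κ / (2 * (T + 1))) := by gcongr; linarith
      _ = κ / 2 := by field_simp
  have b4 : N * (κ / (2 * N)) = κ / 2 := by field_simp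
  exact (norm_add_le _ _).trans_lt (by linarith)

end FixedPoint

/-! ### Averaging over a tower -/

section Injectivity

attribute [local instance] CStarAlgebra.spectralOrder CStarAlgebra.spectralOrderedRing

variable {B C : Type*} [NonUnitalCStarAlgebra B] [NonUnitalCStarAlgebra C]
variable {G : Type*} [Group G] [Fintype G]

/-- The weak tracial Rokhlin property, without the condition on the norm, and with the condition
on the remainder in a form which passes to stabilizations. -/
def HasCentralTowers (γ : G → C →⋆ₙₐ[ℂ] C) : Prop :=
  ∀ ε : ℝ, 0 < ε → ∀ F : Finset C, ∀ y x : C, IsPos x → x ≠ 0 → ∃ f : G → C,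
    (∀ g, IsPos (f g) ∧ ‖f g‖ ≤ 1) ∧ (∀ g h, g ≠ h → f g * f h = 0) ∧
    (∀ g, ∀ a ∈ F, ‖a * f g - f g * a‖ < ε) ∧ (∀ g h, ‖γ g (f h) - f (g * h)‖ < ε) ∧
    ∃ r, CuntzSub r x ∧ IsPos r ∧ ‖star y * y - star y * (∑ g, f g) * y - r‖ < ε

theorem norm_conj_sub_conj_le (x y b : B) :
    ‖x * b * star x - y * b * star y‖ ≤ ‖x - y‖ * ‖b‖ * (‖x‖ + ‖y‖) := by
  have e : x * b * star x - y * b * star y =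
      (x - y) * b * star x + y * b * star (x - y) := by
    rw [star_sub]; noncomm_ring
  rw [e]
  refine (norm_add_le _ _).trans ?_
  have h1 : ‖(x - y) * b * star x‖ ≤ ‖x - y‖ * ‖b‖ * ‖x‖ := by
    refine (norm_mul_le _ _).trans ?_
    rw [norm_star]
    gcongr
    exact norm_mul_le _ _
  have h2 : ‖y * b * star (x - y)‖ ≤ ‖y‖ * ‖b‖ * ‖x - y‖ := by
    refine (norm_mul_le _ _).trans ?_
    rw [norm_star]
    gcongr
    exact norm_mul_le _ _
  nlinarith

/-- Averaging a Cuntz comparison `w b w* ≈ c* c` of fixed elements over a tower. -/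
theorem norm_average_sub_le {γ : G → C →⋆ₙₐ[ℂ] C} {f : G → C} {w b c : C} {κ η : ℝ} (hκ : 0 ≤ κ)
    (hη : 0 ≤ η) (hγb : ∀ g, γ g b = b) (hγc : ∀ g, γ g c = c)
    (hf : ∀ g, IsPos (f g) ∧ ‖f g‖ ≤ 1) (hff : ∀ g h, g ≠ h → f g * f h = 0)
    (hγf : ∀ g, ‖γ g (f 1) - f g‖ ≤ η)
    (hfm : ∀ g h k, ‖γ g w * b * star (γ h w) * f k - f k * (γ g w * b * star (γ h w))‖ ≤ η)
    (hfc : ∀ g, ‖c * f g - f g * c‖ ≤ η) (hfc' : ∀ g, ‖star c * f g - f g * star c‖ ≤ η)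
    (hw : ‖w * b * star w - star c * c‖ ≤ κ) :
    ‖(∑ g, γ g (f 1 * w)) * b * star (∑ g, γ g (f 1 * w)) - star c * (∑ g, f g * f g) * c‖ ≤
      (Fintype.card G : ℝ) ^ 2 * κ +
        (Fintype.card G : ℝ) ^ 2 * (2 * ‖w‖ ^ 2 * ‖b‖ + 1 + 2 * ‖c‖) * η := by
  classical
  have hγ : ∀ g x, ‖γ g x‖ ≤ ‖x‖ := fun g x => NonUnitalStarAlgHom.norm_apply_le _ _
  have hfs : ∀ g, star (f g) = f g := fun g =>
    (IsSelfAdjoint.of_nonneg (isPos_iff_nonneg.1 (hf g).1)).star_eq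
  set N : ℝ := (Fintype.card G : ℝ) with hN
  have hN0 : 0 ≤ N := by positivity
  set v₀ := ∑ g, γ g (f 1 * w) with hv₀
  set v₁ := ∑ g, f g * γ g w with hv₁
  -- The element `v₀` is the one to be shown fixed later; `v₁`, with `γ_g(f_1)` replaced by `f_g`,
  -- is the one for which orthogonality can be used.
  have hv : ‖v₀ - v₁‖ ≤ N * (η * ‖w‖) := by
    rw [hv₀, hv₁, ← Finset.sum_sub_distrib]
    refine (norm_sum_le_of_le _ fun g _ => (?_ : _ ≤ η * ‖w‖)).trans (by simp [hN])
    rw [map_mul, ← sub_mul]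
    exact (norm_mul_le _ _).trans (mul_le_mul (hγf g) (hγ g w) (norm_nonneg _) hη)
  have hv₀n : ‖v₀‖ ≤ N * ‖w‖ := by
    refine (norm_sum_le_of_le _ fun g _ => (?_ : _ ≤ ‖w‖)).trans (by simp [hN])
    exact (hγ _ _).trans ((norm_mul_le _ _).trans
      (mul_le_of_le_one_left (norm_nonneg _) (hf 1).2))
  have hv₁n : ‖v₁‖ ≤ N * ‖w‖ := by
    refine (norm_sum_le_of_le _ fun g _ => (?_ : _ ≤ ‖w‖)).trans (by simp [hN])
    exact (norm_mul_le _ _).trans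
      ((mul_le_of_le_one_left (norm_nonneg _) (hf g).2).trans (hγ _ _))
  have h1 : ‖v₀ * b * star v₀ - v₁ * b * star v₁‖ ≤ N ^ 2 * (2 * ‖w‖ ^ 2 * ‖b‖) * η := by
    refine (norm_conj_sub_conj_le _ _ _).trans ?_
    calc _ ≤ N * (η * ‖w‖) * ‖b‖ * (N * ‖w‖ + N * ‖w‖) := by gcongr
      _ = _ := by ring
  have hc0 := norm_nonneg c
  have h2 : ‖v₁ * b * star v₁ - star c * (∑ g, f g * f g) * c‖ ≤
      N ^ 2 * (κ + (1 + 2 * ‖c‖) * η) := by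
    have e : v₁ * b * star v₁ - star c * (∑ g, f g * f g) * c =
        ∑ g, ∑ k, (f g * (γ g w * b * star (γ k w)) * f k -
          if g = k then star c * (f g * f g) * c else 0) := by
      simp only [Finset.sum_sub_distrib, Finset.sum_ite_eq, Finset.mem_univ, if_true]
      rw [hv₁, star_sum, Finset.sum_mul, Finset.sum_mul_sum, Finset.mul_sum, Finset.sum_mul]
      congr 1
      refine Finset.sum_congr rfl fun g _ => Finset.sum_congr rfl fun k _ => ?_
      rw [star_mul, hfs]
      simp only [mul_assoc]
    rw [e]
    -- For `g ≠ k`, moving `f k` to the left past the middle factor makes it meet `f g` and vanish.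
    -- For `g = k`, the middle factor is close to `c* c`, because `b` and `c` are fixed, and `f g`
    -- almost commutes with `c` and `c*`.
    have hterm : ∀ g k, ‖f g * (γ g w * b * star (γ k w)) * f k -
        if g = k then star c * (f g * f g) * c else 0‖ ≤ κ + (1 + 2 * ‖c‖) * η := by
      intro g k
      split_ifs with hgk
      · subst hgk
        have e1 : γ g w * b * star (γ g w) =
            γ g (w * b * star w - star c * c) + star c * c := by
          rw [map_sub, map_mul, map_mul, map_mul, map_star, map_star, hγb, hγc, sub_add_cancel]
        have e2 : f g * (γ g w * b * star (γ g w)) * f g - star c * (f g * f g) * c =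
            f g * γ g (w * b * star w - star c * c) * f g -
            (star c * f g - f g * star c) * (c * f g) +
            star c * f g * (c * f g - f g * c) := by
          rw [e1]; noncomm_ring
        rw [e2]
        have hfg := (hf g).2
        have t1 : ‖f g * γ g (w * b * star w - star c * c) * f g‖ ≤ κ := by
          refine (norm_mul_le _ _).trans ((mul_le_of_le_one_right (norm_nonneg _) hfg).trans ?_)
          refine (norm_mul_le _ _).trans ((mul_le_of_le_one_left (norm_nonneg _) hfg).trans ?_)
          exact (hγ _ _).trans hw
        have t2 : ‖(star c * f g - f g * star c) * (c * f g)‖ ≤ η * ‖c‖ := by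
          refine (norm_mul_le _ _).trans (mul_le_mul (hfc' g) ?_ (norm_nonneg _) hη)
          exact (norm_mul_le _ _).trans (mul_le_of_le_one_right (norm_nonneg _) hfg)
        have t3 : ‖star c * f g * (c * f g - f g * c)‖ ≤ ‖c‖ * η := by
          refine (norm_mul_le _ _).trans (mul_le_mul ?_ (hfc g) (norm_nonneg _) hc0)
          refine (norm_mul_le _ _).trans ((mul_le_of_le_one_right (norm_nonneg _) hfg).trans ?_)
          rw [norm_star]
        refine (norm_add_le _ _).trans ((add_le_add_left (norm_sub_le _ _) _).trans ?_)
        nlinarith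
      · have e1 : f g * (γ g w * b * star (γ k w)) * f k - 0 =
            f g * (γ g w * b * star (γ k w) * f k - f k * (γ g w * b * star (γ k w))) := by
          rw [mul_sub, ← mul_assoc (f g) (f k), hff g k hgk]
          simp [mul_assoc]
        rw [e1]
        refine (norm_mul_le _ _).trans ((mul_le_of_le_one_left (norm_nonneg _) (hf g).2).trans ?_)
        refine (hfm g k k).trans ?_
        nlinarith [mul_nonneg hc0 hη]
    refine (norm_sum_le_of_le _ fun g _ => norm_sum_le_of_le _ fun k _ => hterm g k).trans ?_
    simp only [Finset.sum_const, Finset.card_univ, nsmul_eq_mul]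
    exact le_of_eq (by ring)
  calc _ = ‖(v₀ * b * star v₀ - v₁ * b * star v₁) +
        (v₁ * b * star v₁ - star c * (∑ g, f g * f g) * c)‖ := by congr 1; abel
    _ ≤ _ := norm_add_le _ _
    _ ≤ _ := by
      refine (add_le_add h1 h2).trans (le_of_eq (by ring))

-- The fixed element `v` obtained by averaging accounts for the part of `a` seen by the tower. What
-- is left is small in `C`, and by `hsmall` it fits, inside `B`, into the part `h` of `b` below `δ`,
-- which is orthogonal to `(b - δ)₊`. The assumption `hlim` says that this part is never zero.
set_option maxHeartbeats 800000 in
theorem IsFixedPointEmbedding.cuntzSub_of_map {γ : G → C →⋆ₙₐ[ℂ] C} {j : B →⋆ₙₐ[ℂ] C}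
    (H : IsFixedPointEmbedding γ j) (hT : HasCentralTowers γ)
    (hsmall : ∀ h : B, IsPos h → h ≠ 0 → ∃ x : C, IsPos x ∧ x ≠ 0 ∧
      ∀ c : B, CuntzSub (j c) x → CuntzSub c h)
    {a b : B} (ha : IsPos a) (hb : IsPos b) (hab : CuntzSub (j a) (j b))
    (hlim : ∀ δ > 0, cfcₙ (fun t : ℝ => max 0 (min t (δ - t))) b ≠ 0) : CuntzSub a b := by
  classical
  have ha0 := isPos_iff_nonneg.1 ha
  have hb0 := isPos_iff_nonneg.1 hb
  obtain ⟨c, hac⟩ := ha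
  refine CuntzSub.of_forall_cutDown ha0 fun ε hε => ?_
  set N : ℝ := (Fintype.card G : ℝ) with hN
  have hN0 : 0 ≤ N := by positivity
  -- This tolerance enters the average `N²` times and so contributes at most `ε / 2`. The choice of
  -- `η` below makes `(K + 2) η = ε / 2`, where `2 η` comes from the remainder `2 r`.
  obtain ⟨δ, hδ, w, hw⟩ := hab.exists_conj_cutDown (isPos_iff_nonneg.1 (hb.map j))
    (ε := ε / (2 * (N ^ 2 + 1))) (by positivity)
  rw [← map_cutDown j (.of_nonneg hb0) hδ.le, hac, map_mul, map_star] at hw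
  set b' := cutDown b δ with hb'
  set h := cfcₙ (fun t : ℝ => max 0 (min t (δ - t))) b with hh
  have hhpos : 0 ≤ h := cfcₙ_nonneg fun t _ => le_max_left _ _
  obtain ⟨x, hx, hx0, hxh⟩ := hsmall h (isPos_iff_nonneg.2 hhpos) (hlim δ hδ)
  set K := N ^ 2 * (2 * ‖w‖ ^ 2 * ‖j b'‖ + 1 + 2 * ‖j c‖) with hK
  have hK0 : 0 ≤ K := by positivity
  set η := ε / (2 * (K + 2)) with hη
  have hη0 : 0 < η := by positivity
  obtain ⟨f, hf, hff, hfF, hγf, r, hrx, hr, hyr⟩ := hT η hη0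
    (insert (j c) (insert (star (j c)) (Finset.univ.image fun p : G × G =>
      γ p.1 w * j b' * star (γ p.2 w)))) (j c) x hx hx0
  have hmain := norm_average_sub_le (b := j b') (c := j c) (w := w)
    (κ := ε / (2 * (N ^ 2 + 1))) (η := η) (by positivity)
    hη0.le (fun g => H.fixed g b') (fun g => H.fixed g c) hf hff
    (fun g => by simpa using (hγf g 1).le)
    (fun g k l => (hfF l _ (by simp)).le)
    (fun g => (hfF g _ (by simp)).le) (fun g => (hfF g _ (by simp)).le) hw.le
  rw [← hN, ← hK] at hmain
  obtain ⟨v, hv⟩ := H.exists_eq (∑ g, γ g (f 1 * w)) fun g => by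
    rw [map_sum]
    refine Fintype.sum_equiv (Equiv.mulLeft g) _ _ fun m => ?_
    rw [← H.mul_apply]
    rfl
  rw [← hv] at hmain
  set F := ∑ g, f g with hF
  have hfs : ∀ g, star (f g) = f g := fun g =>
    (IsSelfAdjoint.of_nonneg (isPos_iff_nonneg.1 (hf g).1)).star_eq
  have hFs : star F = F := by rw [hF, star_sum]; simp only [hfs]
  have hFF : F * F = ∑ g, f g * f g := by
    rw [hF, Finset.sum_mul_sum]
    refine Finset.sum_congr rfl fun g _ => ?_
    exact Finset.sum_eq_single g (fun k _ hk => hff g k hk.symm) (by simp)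
  rw [← hFF] at hmain
  set q := a - v * b' * star v with hq
  have hb'0 : 0 ≤ b' := cutDown_nonneg b δ
  have hqs : IsSelfAdjoint q :=
    (IsSelfAdjoint.of_nonneg ha0).sub ((IsSelfAdjoint.of_nonneg hb'0).conjugate v)
  -- `j q` is dominated, up to `ε`, by `2 r`
  have hqx : CuntzSub (j (cutDown q ε)) x := by
    rw [map_cutDown j hqs hε.le]
    refine CuntzSub.trans (b := (2 : ℝ) • r) ?_ (hrx.smul_left zero_le_two)
    -- Formally `d = c* (1 - F)² c`. From `(1 - F²) + (1 - F)² = 2 (1 - F)`, the sum `j q + d` is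
    -- within `ε` of `2 r`, and `j q ≤ j q + d`.
    set d := star (j c - F * j c) * (j c - F * j c) with hd
    refine cuntzSub_cutDown_of_le (hqs.map j)
      (.of_nonneg (smul_nonneg zero_le_two (isPos_iff_nonneg.1 hr)))
      (s := j q + d) (by rw [le_add_iff_nonneg_right]; exact star_mul_self_nonneg _) hε.le ?_
    have e : j q + d - (2 : ℝ) • r =
        (2 : ℝ) • (star (j c) * j c - star (j c) * F * j c - r) -
          (j v * j b' * star (j v) - star (j c) * (F * F) * j c) := by
      rw [hd, hq, hac, map_sub, map_mul, map_mul, map_mul, map_star, map_star, star_sub, star_mul,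
        hFs, two_smul, two_smul]
      noncomm_ring
    rw [e]
    refine (norm_sub_le _ _).trans ?_
    rw [norm_smul, Real.norm_of_nonneg zero_le_two]
    have e1 : N ^ 2 * (ε / (2 * (N ^ 2 + 1))) ≤ ε / 2 := by
      rw [show N ^ 2 * (ε / (2 * (N ^ 2 + 1))) = N ^ 2 / (N ^ 2 + 1) * (ε / 2) by field_simp]
      refine mul_le_of_le_one_left (by positivity) ?_
      rw [div_le_one (by positivity)]
      linarith
    have e2 : (K + 2) * η = ε / 2 := by rw [hη]; field_simp
    nlinarith
  have hqh := hxh _ hqx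
  -- reassemble
  have hq1 : q ≤ cutDown q 0 := by
    nth_rw 1 [← cfcₙ_id' ℝ q hqs]
    exact cfcₙ_mono (fun t _ => by simp) (by fun_prop) (by fun_prop) rfl (by simp)
  have hstep : CuntzSub (cutDown a ε) (v * b' * star v + cutDown q ε) := by
    refine cuntzSub_cutDown_of_le (s := v * b' * star v + cutDown q 0) (.of_nonneg ha0)
      (((IsSelfAdjoint.of_nonneg hb'0).conjugate v).add (isSelfAdjoint_cutDown q ε)) ?_ hε.le ?_
    · rw [← sub_le_iff_le_add']
      exact hq1
    · rw [add_sub_add_left_eq_sub, norm_sub_rev]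
      have := norm_cutDown_sub_le (cutDown_nonneg q 0) hε.le
      rwa [cutDown_cutDown hqs le_rfl hε.le, zero_add] at this
  -- The functions defining `b'` and `h` live on `(δ, ∞)` and `(0, δ)`, so `b'` and `h` are
  -- orthogonal and their sum is still `≾ b`.
  have hb'h : b' * h = 0 := by
    rw [hb', hh, cutDown, ← cfcₙ_mul (fun t : ℝ => max 0 (t - δ))
      (fun t : ℝ => max 0 (min t (δ - t))) b (by fun_prop) (by simp [hδ.le]) (by fun_prop)
      (by simp [hδ.le])]
    rw [← cfcₙ_zero ℝ b]
    refine cfcₙ_congr fun t _ => ?_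
    rcases le_total t δ with h | h
    · rw [max_eq_left (by linarith : t - δ ≤ 0), zero_mul]; rfl
    · rw [max_eq_left ((min_le_right _ _).trans (by linarith : δ - t ≤ 0)), mul_zero]; rfl
  refine hstep.trans ((CuntzSub.add_of_mul_eq_zero hb'0 hhpos hb'h (CuntzSub.conj v b') hqh).trans ?_)
  rw [hb', hh, cutDown, ← cfcₙ_add (fun t : ℝ => max 0 (t - δ))
      (fun t : ℝ => max 0 (min t (δ - t))) b (by fun_prop) (by simp [hδ.le]) (by fun_prop)
      (by simp [hδ.le])]
  nth_rw 2 [← cfcₙ_id' ℝ b (.of_nonneg hb0)]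
  refine cuntzSub_cfcₙ hb0 (by fun_prop) (by simp [hδ.le]) (by fun_prop) rfl
    (fun t _ => by positivity) (fun t ht => ht) fun t ht h => ?_
  rcases ht.eq_or_lt with rfl | h'
  · simp [hδ.le] at h
  · exact h'

end Injectivity

/-! ### Halving in simple C⋆-algebras not of type I -/

section Simple

attribute [local instance] CStarAlgebra.spectralOrder CStarAlgebra.spectralOrderedRing

variable {A : Type*} [NonUnitalCStarAlgebra A]

/-- A simple C⋆-algebra is prime. -/
theorem IsSimpleCStar.eq_zero_or_eq_zero (hA : IsSimpleCStar A) {a b : A}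
    (h : ∀ t, a * t * b = 0) : a = 0 ∨ b = 0 := by
  let I : TwoSidedIdeal A := TwoSidedIdeal.mk' {c | ∀ t, c * t * b = 0}
    (fun t => by simp) (fun {x y} hx hy t => by rw [add_mul, add_mul, hx, hy, add_zero])
    (fun {x} hx t => by rw [neg_mul, neg_mul, hx, neg_zero])
    (fun {x y} hy t => by rw [mul_assoc x, mul_assoc x, hy, mul_zero])
    (fun {x y} hx t => by rw [mul_assoc x, hx])
  have hI : ∀ c, c ∈ I ↔ ∀ t, c * t * b = 0 := fun c => TwoSidedIdeal.mem_mk' _ _ _ _ _ _ c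
  have hcl : IsClosed (I : Set A) := by
    have e : (I : Set A) = ⋂ t, {c | c * t * b = 0} := by
      ext c
      simp only [Set.mem_iInter]
      exact hI c
    rw [e]
    exact isClosed_iInter fun t => isClosed_eq (by fun_prop) continuous_const
  rcases hA.2 I hcl with h0 | h0
  · left
    have : a ∈ I := (hI a).2 h
    rw [h0] at this
    exact (TwoSidedIdeal.mem_bot A).1 this
  · right
    -- If the left annihilator is everything, it contains `b*`, so `b* (b b*) b = (b* b)² = 0`.
    have h1 : star b ∈ I := by rw [h0]; trivial
    have h2 := (hI _).1 h1 (b * star b)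
    rw [← CStarRing.star_mul_self_eq_zero_iff, ← CStarRing.star_mul_self_eq_zero_iff, star_mul,
      star_star]
    simpa [mul_assoc] using h2

/-- If `x A x` has no nonzero elements of square zero, then its self-adjoint elements have at most
one nonzero spectral value. -/
theorem IsSimpleCStar.exists_mul_self_eq_smul (hA : IsSimpleCStar A) {x : A}
    (hx : ∀ t, x * t * x * (x * t * x) = 0 → x * t * x = 0) {a : A}
    (hk : IsSelfAdjoint (x * a * x)) :
    ∃ r : ℝ, x * a * x * (x * a * x) = r • (x * a * x) := by
  set k := x * a * x with hkdef
  have hid : cfcₙ (fun t : ℝ => t) k = k := cfcₙ_id' ℝ k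
  by_cases hspec : ∀ r ∈ quasispectrum ℝ k, r = 0
  · have : k = 0 := by
      rw [← hid, ← cfcₙ_zero ℝ k]
      exact cfcₙ_congr fun t ht => hspec t ht
    exact ⟨0, by simp [this]⟩
  push Not at hspec
  obtain ⟨r, hr, hr0⟩ := hspec
  suffices hs : ∀ s ∈ quasispectrum ℝ k, s = 0 ∨ s = r by
    refine ⟨r, ?_⟩
    nth_rw 1 2 3 [← hid]
    rw [← cfcₙ_mul (fun t => t) (fun t => t) k (by fun_prop) rfl (by fun_prop) rfl,
      ← cfcₙ_const_mul r (fun t => t) k (by fun_prop) rfl]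
    refine cfcₙ_congr fun t ht => ?_
    rcases hs t ht with rfl | rfl <;> simp
  intro s hs
  by_contra! hcon
  obtain ⟨hs0, hsr⟩ := hcon
  -- With this width the bumps at `r` and `s` vanish at `0` and have disjoint supports.
  let d := min (min |r| |s|) (|r - s| / 2)
  have hd : 0 < d := lt_min (lt_min (abs_pos.2 hr0) (abs_pos.2 hs0))
    (half_pos (abs_pos.2 (sub_ne_zero.2 hsr.symm)))
  let φ : ℝ → ℝ → ℝ := fun p t => max 0 (d - |t - p|)
  have hφc : ∀ p, Continuous (φ p) := fun p => by fun_prop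
  have hφr0 : φ r 0 = 0 := by
    have : d ≤ |r| := (min_le_left _ _).trans (min_le_left _ _)
    simpa [φ] using this
  have hφs0 : φ s 0 = 0 := by
    have : d ≤ |s| := (min_le_left _ _).trans (min_le_right _ _)
    simpa [φ] using this
  have hφp : ∀ p, φ p p = d := fun p => by simp [φ, hd.le]
  have hmul : ∀ t, φ s t * φ r t = 0 := by
    intro t
    have h1 : d ≤ |r - s| / 2 := min_le_right _ _
    have h2 : |r - s| ≤ |t - s| + |t - r| := by
      have := abs_sub_le r t s
      rw [abs_sub_comm r t] at this
      linarith
    rcases le_total |t - s| |t - r| with h | h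
    · have : φ r t = 0 := max_eq_left (by linarith)
      rw [this, mul_zero]
    · have : φ s t = 0 := max_eq_left (by linarith)
      rw [this, zero_mul]
  have hne : ∀ p ∈ quasispectrum ℝ k, p ≠ 0 → φ p 0 = 0 → k * cfcₙ (φ p) k ≠ 0 := by
    intro p hp hp0 hφ0 h0
    nth_rw 1 [← hid] at h0
    rw [← cfcₙ_mul (fun t => t) (φ p) k (by fun_prop) rfl (hφc p).continuousOn hφ0] at h0
    have h1 := norm_apply_le_norm_cfcₙ (fun t => t * φ p t) k hp (by fun_prop) (by simp)
    rw [h0, norm_zero, hφp, norm_le_zero_iff, mul_eq_zero] at h1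
    exact h1.elim hp0 hd.ne'
  have hcomm : ∀ p, φ p 0 = 0 → cfcₙ (φ p) k * k = k * cfcₙ (φ p) k := fun p hp => by
    nth_rw 2 3 [← hid]
    rw [← cfcₙ_mul (φ p) (fun t => t) k (hφc p).continuousOn hp (by fun_prop) rfl,
      ← cfcₙ_mul (fun t => t) (φ p) k (by fun_prop) rfl (hφc p).continuousOn hp]
    simp only [mul_comm]
  have hzero : cfcₙ (φ s) k * cfcₙ (φ r) k = 0 := by
    rw [← cfcₙ_mul (φ s) (φ r) k (hφc s).continuousOn hφs0 (hφc r).continuousOn hφr0,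
      ← cfcₙ_zero ℝ k]
    exact cfcₙ_congr fun t _ => hmul t
  -- Each such element lies in `x A x`. Its square contains `φ_s(k) φ_r(k) = 0` in the middle, so
  -- the element itself vanishes by `hx`. Primeness then kills one of the two outer factors,
  -- although neither is zero.
  have hall : ∀ t, (k * cfcₙ (φ r) k) * t * (k * cfcₙ (φ s) k) = 0 := by
    intro t
    have hform : (k * cfcₙ (φ r) k) * t * (k * cfcₙ (φ s) k) =
        x * (a * x * cfcₙ (φ r) k * t * cfcₙ (φ s) k * x * a) * x := by
      rw [← hcomm s hφs0]
      nth_rw 1 4 [hkdef]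
      simp only [mul_assoc]
    rw [hform]
    refine hx _ ?_
    rw [← hform]
    calc _ = k * cfcₙ (φ r) k * t * (k * (cfcₙ (φ s) k * k) * cfcₙ (φ r) k) * t *
          (k * cfcₙ (φ s) k) := by simp only [mul_assoc]
      _ = k * cfcₙ (φ r) k * t * (k * k * (cfcₙ (φ s) k * cfcₙ (φ r) k)) * t *
          (k * cfcₙ (φ s) k) := by rw [hcomm s hφs0]; simp only [mul_assoc]
      _ = 0 := by rw [hzero]; simp
  rcases hA.eq_zero_or_eq_zero hall with h | h
  · exact hne r hr hr0 hφr0 h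
  · exact hne s hs hs0 hφs0 h

/-- In a simple C⋆-algebra which is not of type I, every nonzero hereditary subalgebra contains a
nonzero element of square zero. -/
theorem IsSimpleCStar.exists_mul_self_eq_zero (hA : IsSimpleCStar A) (hI : ¬ IsTypeI A) {x : A}
    (hx : IsPos x) (hx0 : x ≠ 0) : ∃ t, x * t * x * (x * t * x) = 0 ∧ x * t * x ≠ 0 := by
  by_contra! hno
  refine hI fun I hIc hItop => ?_
  obtain rfl : I = ⊥ := (hA.2 I hIc).resolve_right hItop
  have hxs : star x = x := (IsSelfAdjoint.of_nonneg (isPos_iff_nonneg.1 hx)).star_eq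
  refine ⟨x, hx, fun h => hx0 ((TwoSidedIdeal.mem_bot A).1 h), fun a b => ?_⟩
  rw [TwoSidedIdeal.mem_bot, sub_eq_zero]
  have hform : ∀ a, IsSelfAdjoint a → IsSelfAdjoint (x * a * x) := fun a ha => by
    rw [isSelfAdjoint_iff, star_mul, star_mul, hxs, ha.star_eq, mul_assoc]
  have hsa : ∀ a b, IsSelfAdjoint a → IsSelfAdjoint b →
      x * a * x * (x * b * x) = x * b * x * (x * a * x) := by
    intro a b ha hb
    obtain ⟨r, hr⟩ := hA.exists_mul_self_eq_smul hno (hform a ha)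
    by_cases hr0 : r = 0
    · rw [hr0, zero_smul] at hr
      rw [hno a hr, zero_mul, mul_zero]
    -- When `k² = r k`, the element `r l k - k l k` is annihilated by `k` on the left, so its square
    -- is zero. Hence `r l k = k l k`; comparing with the adjoint gives `k l = l k`. Thus `x A x` is
    -- commutative and `x` is abelian, contrary to the assumption on `A`.
    have hsq : ∀ k l : A, k * k = r • k →
        (r • (l * k) - k * l * k) * (r • (l * k) - k * l * k) = 0 := by
      intro k l hk
      have h1 : k * (r • (l * k) - k * l * k) = 0 := by
        rw [mul_sub, mul_smul_comm, ← mul_assoc k (k * l), ← mul_assoc k k, hk, smul_mul_assoc,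
          smul_mul_assoc, mul_assoc, sub_self]
      rw [sub_mul, smul_mul_assoc, mul_assoc l k, mul_assoc (k * l) k, h1]
      simp
    have hks := (hform a ha).star_eq
    have hls := (hform b hb).star_eq
    have hv : r • (x * b * x * (x * a * x)) - x * a * x * (x * b * x) * (x * a * x) = 0 := by
      have e : r • (x * b * x * (x * a * x)) - x * a * x * (x * b * x) * (x * a * x) =
          x * (r • (b * x * x * a) - a * x * x * b * x * x * a) * x := by
        rw [mul_sub, sub_mul, mul_smul_comm, smul_mul_assoc]
        simp only [mul_assoc]
      rw [e]
      refine hno _ ?_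
      rw [← e]
      exact hsq _ _ hr
    rw [sub_eq_zero] at hv
    have hv' := congrArg star hv
    rw [star_smul, star_trivial r, star_mul (x * b * x), star_mul (x * a * x * (x * b * x)),
      star_mul (x * a * x) (x * b * x), hks, hls] at hv'
    have h2 : r • (x * a * x * (x * b * x)) = r • (x * b * x * (x * a * x)) :=
      hv'.trans ((mul_assoc _ _ _).symm.trans hv.symm)
    exact smul_right_injective A hr0 h2
  have key : ∀ a b, IsSelfAdjoint a → x * a * x * (x * b * x) = x * b * x * (x * a * x) := by
    intro a b ha
    rw [← realPart_add_I_smul_imaginaryPart b]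
    simp only [mul_add, add_mul, mul_smul_comm, smul_mul_assoc]
    rw [hsa a _ ha (realPart b).2, hsa a _ ha (imaginaryPart b).2]
  rw [← realPart_add_I_smul_imaginaryPart a]
  simp only [mul_add, add_mul, mul_smul_comm, smul_mul_assoc]
  rw [key _ b (realPart a).2, key _ b (imaginaryPart a).2]

/-- Halving of positive elements in a simple C⋆-algebra which is not of type I. -/
theorem IsSimpleCStar.exists_add_cuntzSub (hA : IsSimpleCStar A) (hI : ¬ IsTypeI A) {x : A}
    (hx : IsPos x) (hx0 : x ≠ 0) : ∃ p q : A, IsPos p ∧ IsPos q ∧ p ≠ 0 ∧ CuntzEquiv p q ∧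
      p * q = 0 ∧ CuntzSub (p + q) x := by
  obtain ⟨t, hv, hv0⟩ := hA.exists_mul_self_eq_zero hI hx hx0
  have hxs : star x = x := (IsSelfAdjoint.of_nonneg (isPos_iff_nonneg.1 hx)).star_eq
  set v := x * t * x with hvdef
  refine ⟨star v * v, v * star v, ⟨v, rfl⟩, ⟨star v, by simp⟩, ?_, cuntzEquiv_star_mul_self v, ?_,
    ?_⟩
  · rwa [Ne, CStarRing.star_mul_self_eq_zero_iff]
  · rw [mul_assoc, ← mul_assoc v, hv]
    simp
  -- An element of the form `x M x` with `M` self-adjoint is at most `‖M‖ x²`, which is `≾ x`.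
  · have e : star v * v + v * star v = star x * (star t * x * x * t + t * x * x * star t) * x := by
      rw [hvdef, star_mul, star_mul, hxs]
      noncomm_ring
    have hsa : IsSelfAdjoint (star t * x * x * t + t * x * x * star t) := by
      rw [isSelfAdjoint_iff]
      simp only [star_add, star_mul, star_star, hxs, mul_assoc]
    have hle := CStarAlgebra.star_left_conjugate_le_norm_smul (a := x) hsa
    rw [← e, hxs] at hle
    exact (CuntzSub.of_le (add_nonneg (star_mul_self_nonneg v) (mul_star_self_nonneg v)) hle).trans
      ((CuntzSub.mul_self_self (isPos_iff_nonneg.1 hx)).smul_left (norm_nonneg _))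

end Simple

/-! ### Matrix units, diagonals and divisibility -/

section MatrixUnits

attribute [local instance] CStarAlgebra.spectralOrder CStarAlgebra.spectralOrderedRing

variable {A B : Type*} [NonUnitalCStarAlgebra A] [NonUnitalCStarAlgebra B]

namespace FinMat

/-- The matrix with the single entry `a` at the position `(i, j)`. -/
def unit (i j : ℕ) : A →ₗ[ℂ] FinMat A where
  toFun a := mk (fun k l => if k = i ∧ l = j then a else 0) {i, j} fun k l h => by
    by_contra h0
    exact h (if_neg fun h1 => h0 (by simp [h1.1, h1.2]))
  map_add' a b := ext' fun k l => by
    simp only [entry_mk, entry_add]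
    split_ifs <;> simp
  map_smul' c a := ext' fun k l => by
    simp only [entry_mk, entry_smul, RingHom.id_apply]
    split_ifs <;> simp

theorem entry_unit (i j : ℕ) (a : A) (k l : ℕ) :
    (unit i j a).entry k l = if k = i ∧ l = j then a else 0 := rfl

theorem unit_mul_unit (i j k l : ℕ) (a b : A) :
    unit i j a * unit k l b = if j = k then unit i l (a * b) else 0 := by
  refine ext' fun m n => ?_
  rw [entry_mul, finsum_eq_single _ j]
  · by_cases hjk : j = k
    · subst hjk
      simp only [entry_unit, if_true]
      by_cases hm : m = i <;> by_cases hn : n = l <;> simp [hm, hn]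
    · simp [entry_unit, hjk]
  · intro r hr
    simp [entry_unit, hr]

theorem star_unit (i j : ℕ) (a : A) : star (unit i j a) = unit j i (star a) := by
  refine ext' fun m n => ?_
  rw [entry_star, entry_unit, entry_unit]
  by_cases hm : m = j <;> by_cases hn : n = i <;> simp [hm, hn]

theorem entry_sum {ι : Type*} (s : Finset ι) (f : ι → FinMat A) (k l : ℕ) :
    (∑ i ∈ s, f i).entry k l = ∑ i ∈ s, (f i).entry k l := by
  classical
  induction s using Finset.induction_on with
  | empty => rfl
  | insert i s hi ih => rw [Finset.sum_insert hi, Finset.sum_insert hi, entry_add, ih]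

theorem SuppOn.eq_sum {u : FinMat A} {s : Finset ℕ} (hu : SuppOn u s) :
    u = ∑ i ∈ s, ∑ j ∈ s, unit i j (u.entry i j) := by
  refine ext' fun k l => ?_
  simp only [entry_sum, entry_unit]
  by_cases h : k ∈ s ∧ l ∈ s
  · rw [Finset.sum_eq_single k, Finset.sum_eq_single l]
    · simp
    · intro j _ hj; simp [hj.symm]
    · exact fun h' => absurd h.2 h'
    · intro i _ hi; simp [hi.symm]
    · exact fun h' => absurd h.1 h'
  · rw [not_imp_comm.1 (hu k l) h, eq_comm]
    refine Finset.sum_eq_zero fun i hi => Finset.sum_eq_zero fun j hj => if_neg ?_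
    rintro ⟨rfl, rfl⟩
    exact h ⟨hi, hj⟩

theorem map_unit (φ : A →⋆ₙₐ[ℂ] B) (i j : ℕ) (a : A) : map φ (unit i j a) = unit i j (φ a) := by
  refine ext' fun k l => ?_
  change φ (if k = i ∧ l = j then a else 0) = if k = i ∧ l = j then φ a else 0
  split_ifs <;> simp

end FinMat

theorem map_real_smul (φ : A →⋆ₙₐ[ℂ] B) (c : ℝ) (a : A) : φ (c • a) = c • φ a :=
  LinearMap.map_smul_of_tower (φ : A →ₗ[ℂ] B) c a

namespace Stab

/-- The element of `A ⊗ K` with the single entry `a` at the position `(i, j)`. -/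
def unit (i j : ℕ) : A →ₗ[ℂ] Stab A where
  toFun a := ofFin (FinMat.unit i j a)
  map_add' a b := by rw [map_add, map_add]
  map_smul' c a := by rw [map_smul, map_smul]; rfl

theorem unit_eq (i j : ℕ) (a : A) : unit i j a = ofFin (FinMat.unit i j a) := rfl

theorem unit_mul_unit (i j k l : ℕ) (a b : A) :
    unit i j a * unit k l b = if j = k then unit i l (a * b) else 0 := by
  rw [unit_eq, unit_eq, ← map_mul, FinMat.unit_mul_unit]
  split_ifs
  · rfl
  · exact map_zero ofFin

@[simp] theorem unit_mul_unit_same (i j l : ℕ) (a b : A) :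
    unit i j a * unit j l b = unit i l (a * b) := by rw [unit_mul_unit, if_pos rfl]

@[simp] theorem star_unit (i j : ℕ) (a : A) : star (unit i j a) = unit j i (star a) := by
  rw [unit_eq, ← map_star, FinMat.star_unit]
  rfl

theorem ofFin_eq_sum {u : FinMat A} {s : Finset ℕ} (hu : FinMat.SuppOn u s) :
    ofFin u = ∑ i ∈ s, ∑ j ∈ s, unit i j (u.entry i j) := by
  conv_lhs => rw [hu.eq_sum]
  simp only [map_sum]
  rfl

/-- The diagonal embedding of `A` in the rows indexed by `s`. -/
def diag (s : Finset ℕ) : A →⋆ₙₐ[ℂ] Stab A where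
  toFun a := ∑ i ∈ s, unit i i a
  map_smul' c a := by simp only [map_smul, Finset.smul_sum]; rfl
  map_zero' := by simp
  map_add' a b := by simp only [map_add, Finset.sum_add_distrib]
  map_mul' a b := by
    rw [Finset.sum_mul_sum]
    refine Finset.sum_congr rfl fun i hi => ?_
    rw [Finset.sum_eq_single_of_mem i hi fun k _ hk => by rw [unit_mul_unit, if_neg hk.symm],
      unit_mul_unit_same]
  map_star' a := by simp only [star_sum, star_unit]

theorem diag_apply (s : Finset ℕ) (a : A) : diag s a = ∑ i ∈ s, unit i i a := rfl

theorem diag_singleton (i : ℕ) (a : A) : diag {i} a = unit i i a := by simp [diag_apply]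

theorem diag_mul_unit {s : Finset ℕ} {i : ℕ} (hi : i ∈ s) (j : ℕ) (a b : A) :
    diag s a * unit i j b = unit i j (a * b) := by
  rw [diag_apply, Finset.sum_mul,
    Finset.sum_eq_single_of_mem i hi fun k _ hk => by rw [unit_mul_unit, if_neg hk],
    unit_mul_unit_same]

theorem unit_mul_diag {s : Finset ℕ} {j : ℕ} (hj : j ∈ s) (i : ℕ) (a b : A) :
    unit i j b * diag s a = unit i j (b * a) := by
  rw [diag_apply, Finset.mul_sum,
    Finset.sum_eq_single_of_mem j hj fun k _ hk => by rw [unit_mul_unit, if_neg hk.symm],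
    unit_mul_unit_same]

theorem norm_unit_le (i j : ℕ) (a : A) : ‖unit i j a‖ ≤ ‖a‖ := by
  have h : ‖unit i j a‖ * ‖unit i j a‖ ≤ ‖a‖ * ‖a‖ := by
    rw [← CStarRing.norm_star_mul_self, ← CStarRing.norm_star_mul_self, star_unit,
      unit_mul_unit_same, ← diag_singleton]
    exact NonUnitalStarAlgHom.norm_apply_le _ _
  exact le_of_sq_le_sq (by simpa only [sq] using h) (norm_nonneg _)

theorem unit_injective (i j : ℕ) : Function.Injective (unit (A := A) i j) := by
  rw [injective_iff_map_eq_zero]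
  intro a ha
  have h1 : ‖ofFin (FinMat.unit i j a)‖ = 0 := by rw [← unit_eq, ha, norm_zero]
  rw [norm_ofFin, norm_eq_zero] at h1
  have h2 := congrArg (fun u : FinMat A => u.entry i j) h1
  simpa [FinMat.entry_unit] using h2

theorem norm_unit_self (i : ℕ) (a : A) : ‖unit i i a‖ = ‖a‖ := by
  rw [← diag_singleton]
  refine NonUnitalStarAlgHom.norm_map (diag {i}) (fun x y h => ?_) a
  rw [diag_singleton, diag_singleton] at h
  exact unit_injective i i h

theorem map_ofFin (φ : A →⋆ₙₐ[ℂ] B) (u : FinMat A) :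
    map φ (ofFin u) = ofFin (FinMat.map φ u) := lift_ofFin _ _ u

theorem continuous_map (φ : A →⋆ₙₐ[ℂ] B) : Continuous (map φ) := continuous_lift _ _

theorem map_unit (φ : A →⋆ₙₐ[ℂ] B) (i j : ℕ) (a : A) : map φ (unit i j a) = unit i j (φ a) := by
  rw [unit_eq, map_ofFin, FinMat.map_unit]
  rfl

theorem map_diag (φ : A →⋆ₙₐ[ℂ] B) (s : Finset ℕ) (a : A) :
    map φ (diag s a) = diag s (φ a) := by
  simp only [diag_apply, map_sum, map_unit]

theorem isClosed_range_unit (i : ℕ) : IsClosed (Set.range (unit (A := A) i i)) :=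
  (AddMonoidHomClass.isometry_of_norm (unit (A := A) i i)
    (norm_unit_self i)).isClosedEmbedding.isClosed_range

/-- Corners of elements of `A ⊗ K` come from `A`. -/
theorem unit_mul_mul_unit_mem_range (i k : ℕ) (a b : A) (x : Stab A) :
    unit k i a * x * unit i k b ∈ Set.range (unit (A := A) k k) := by
  refine denseRange_ofFin.induction_on (p := fun x : Stab A =>
    unit k i a * x * unit i k b ∈ Set.range (unit (A := A) k k)) x
    ((isClosed_range_unit k).preimage (by fun_prop)) fun u => ?_
  obtain ⟨s, hs⟩ := u.exists_suppOn
  rw [ofFin_eq_sum hs]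
  simp only [Finset.mul_sum, Finset.sum_mul]
  change _ ∈ LinearMap.range (unit (A := A) k k)
  refine Submodule.sum_mem _ fun m _ => Submodule.sum_mem _ fun n _ => ?_
  rw [unit_mul_unit]
  split_ifs
  · rw [unit_mul_unit]
    split_ifs
    · exact ⟨_, rfl⟩
    · exact Submodule.zero_mem _
  · rw [zero_mul]
    exact Submodule.zero_mem _

/-- Every nonzero positive element of `A ⊗ K` dominates a nonzero positive element of `A`. -/
theorem exists_unit_cuntzSub {h : Stab A} (hh : IsPos h) (h0 : h ≠ 0) :
    ∃ x : A, IsPos x ∧ x ≠ 0 ∧ CuntzSub (unit 0 0 x) h := by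
  obtain ⟨c, hc⟩ := hh
  obtain ⟨i, e, hie⟩ : ∃ (i : ℕ) (e : A), c * unit i 0 e ≠ 0 := by
    by_contra! hcon
    -- The column index is irrelevant: `e_ij(a) e_ij(a)* = e_i0(a) e_i0(a)*`. So `c` would
    -- annihilate a dense set, hence `c*`, and `h = c* c` would be zero.
    have h1 : ∀ i j (a : A), c * unit i j a = 0 := by
      intro i j a
      have : c * unit i j a * star (c * unit i j a) = c * unit i 0 a * unit 0 i (star a) * star c := by
        have e : unit i j a * unit j i (star a) = unit i 0 a * unit 0 i (star a) := by
          rw [unit_mul_unit_same, unit_mul_unit_same]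
        calc _ = c * (unit i j a * unit j i (star a)) * star c := by
              rw [star_mul, star_unit]; simp only [mul_assoc]
          _ = _ := by rw [e]; simp only [mul_assoc]
      rwa [hcon, zero_mul, zero_mul, CStarRing.mul_star_self_eq_zero_iff] at this
    have h2 : ∀ x : Stab A, c * x = 0 := fun x => by
      refine denseRange_ofFin.induction_on (p := fun x : Stab A => c * x = 0) x
        (isClosed_eq (by fun_prop) continuous_const) fun u => ?_
      obtain ⟨s, hs⟩ := u.exists_suppOn
      rw [ofFin_eq_sum hs, Finset.mul_sum]
      refine Finset.sum_eq_zero fun i _ => ?_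
      rw [Finset.mul_sum]
      exact Finset.sum_eq_zero fun j _ => h1 i j _
    have h3 := h2 (star c)
    rw [CStarRing.mul_star_self_eq_zero_iff] at h3
    rw [hc, h3, mul_zero] at h0
    exact h0 rfl
  obtain ⟨x, hx⟩ := unit_mul_mul_unit_mem_range i 0 (star e) e h
  have hd : unit 0 0 x = star (c * unit i 0 e) * (c * unit i 0 e) := by
    rw [hx, hc, star_mul, star_unit]
    noncomm_ring
  have hd0 : (0 : Stab A) ≤ unit 0 0 x := by rw [hd]; exact star_mul_self_nonneg _
  have hds := (IsSelfAdjoint.of_nonneg hd0).star_eq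
  -- Using `x* x` as the witness makes its positivity in `A` immediate; its matrix is the square of
  -- the positive element `e_00(x)`.
  have hsq : unit 0 0 (star x * x) = unit 0 0 x * unit 0 0 x := by
    rw [← unit_mul_unit_same 0 0 0, ← star_unit, hds]
  refine ⟨star x * x, ⟨x, rfl⟩, ?_, ?_⟩
  · rw [Ne, CStarRing.star_mul_self_eq_zero_iff]
    rintro rfl
    rw [map_zero] at hd
    exact hie ((CStarRing.star_mul_self_eq_zero_iff _).1 hd.symm)
  · rw [hsq]
    refine (CuntzSub.mul_self_self hd0).trans ?_
    rw [hx]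
    have := CuntzSub.star_conj (unit i 0 e) h
    rwa [star_unit] at this

end Stab

theorem IsPos.real_smul {a : A} (ha : IsPos a) {c : ℝ} (hc : 0 ≤ c) : IsPos (c • a) :=
  isPos_iff_nonneg.2 (smul_nonneg hc (isPos_iff_nonneg.1 ha))

namespace Cu

/-- Addition in `Cu` can be computed with any orthogonal representatives, by applying subadditivity
in both directions. -/
theorem mk_add_mk_of_mul_eq_zero {a b c : PosStab A} (h : a.1 * b.1 = 0)
    (hc : a.1 + b.1 = c.1) : mk a + mk b = mk c := by
  obtain ⟨c, hc'⟩ := c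
  subst hc
  have ha := cuntzEquiv_reindex _ two_mul_injective a.1
  have hb := cuntzEquiv_reindex _ two_mul_add_one_injective b.1
  refine mk_eq_mk.2 ⟨?_, ?_⟩
  · exact CuntzSub.add_of_mul_eq_zero a.nonneg b.nonneg h ha.1 hb.1
  · exact CuntzSub.add_of_mul_eq_zero (isPos_iff_nonneg.1 (a.2.map evenEmb))
      (isPos_iff_nonneg.1 (b.2.map oddEmb)) (even_mul_odd _ _) ha.2 hb.2

/-- The class in `Cu(A)` of the diagonal matrix with entries `a` in the rows indexed by `s`. -/
def diag (s : Finset ℕ) {a : A} (ha : IsPos a) : Cu A := mk ⟨Stab.diag s a, ha.map _⟩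

theorem diag_singleton (i j : ℕ) {a : A} (ha : IsPos a) : diag {i} ha = diag {j} ha := by
  refine mk_eq_mk_of_reindex (Equiv.swap i j) (Equiv.swap i j).injective ?_
  change Stab.reindex _ _ (Stab.diag {i} a) = Stab.diag {j} a
  rw [Stab.diag_singleton, Stab.diag_singleton, Stab.unit_eq, Stab.reindex_ofFin, Stab.unit_eq]
  congr 1
  refine FinMat.ext' fun k l => ?_
  rw [FinMat.entry_reindex]
  obtain ⟨k, rfl⟩ := (Equiv.swap i j).surjective k
  obtain ⟨l, rfl⟩ := (Equiv.swap i j).surjective l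
  rw [spread_apply (Equiv.swap i j).injective, FinMat.entry_unit, FinMat.entry_unit]
  simp only [Equiv.swap_apply_eq_iff, Equiv.swap_apply_right]

theorem diag_eq_nsmul (s : Finset ℕ) {a : A} (ha : IsPos a) :
    diag s ha = s.card • diag {0} ha := by
  induction s using Finset.induction_on with
  | empty =>
    rw [Finset.card_empty, zero_nsmul]
    exact congrArg mk (Subtype.ext (show Stab.diag ∅ a = 0 by
      rw [Stab.diag_apply, Finset.sum_empty]))
  | insert i s hi ih =>
    have e : Stab.diag {i} a + Stab.diag s a = Stab.diag (insert i s) a := by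
      rw [Stab.diag_singleton, Stab.diag_apply, Stab.diag_apply, Finset.sum_insert hi]
    have h0 : Stab.diag {i} a * Stab.diag s a = 0 := by
      rw [Stab.diag_singleton, Stab.diag_apply, Finset.mul_sum]
      refine Finset.sum_eq_zero fun k hk => ?_
      rw [Stab.unit_mul_unit, if_neg]
      rintro rfl
      exact hi hk
    rw [Finset.card_insert_of_notMem hi, succ_nsmul', ← ih, ← diag_singleton i]
    exact (mk_add_mk_of_mul_eq_zero (a := ⟨Stab.diag {i} a, ha.map _⟩)
      (b := ⟨Stab.diag s a, ha.map _⟩) (c := ⟨Stab.diag (insert i s) a, ha.map _⟩) h0 e).symm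

theorem diag_le_diag (s : Finset ℕ) {a b : A} (ha : IsPos a) (hb : IsPos b) (h : CuntzSub a b) :
    diag s ha ≤ diag s hb := mk_le_mk.2 (h.map _)

theorem nsmul_le_nsmul {m n : ℕ} (h : m ≤ n) (x : Cu A) : m • x ≤ n • x := by
  obtain ⟨k, rfl⟩ := Nat.exists_eq_add_of_le h
  rw [add_nsmul]
  have := add_le_add (le_refl (m • x)) ((isCuSemigroup A).zero_le (k • x))
  rwa [add_zero] at this

theorem nsmul_le_nsmul_right {x y : Cu A} (h : x ≤ y) (n : ℕ) : n • x ≤ n • y := by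
  induction n with
  | zero => rw [zero_nsmul, zero_nsmul]
  | succ n ih => rw [succ_nsmul, succ_nsmul]; exact add_le_add ih h

/-- In a simple C⋆-algebra not of type I, nonzero elements can be divided in `Cu(A)`. -/
theorem exists_nsmul_le (hA : IsSimpleCStar A) (hI : ¬ IsTypeI A) (n : ℕ) {x : A} (hx : IsPos x)
    (hx0 : x ≠ 0) : ∃ (y : A) (hy : IsPos y), y ≠ 0 ∧ 2 ^ n • diag {0} hy ≤ diag {0} hx := by
  induction n with
  | zero => exact ⟨x, hx, hx0, by rw [pow_zero, one_nsmul]⟩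
  | succ n ih =>
    obtain ⟨y, hy, hy0, hyx⟩ := ih
    obtain ⟨p, q, hp, hq, hp0, hpq, hpq0, hpqy⟩ := hA.exists_add_cuntzSub hI hy hy0
    refine ⟨p, hp, hp0, ?_⟩
    rw [pow_succ, mul_nsmul']
    refine (nsmul_le_nsmul_right ?_ _).trans hyx
    have hs : IsPos (p + q) := isPos_iff_nonneg.2
      (add_nonneg (isPos_iff_nonneg.1 hp) (isPos_iff_nonneg.1 hq))
    have h1 : diag {0} hp + diag {0} hq = diag {0} hs :=
      mk_add_mk_of_mul_eq_zero (a := ⟨Stab.diag {0} p, hp.map _⟩)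
        (b := ⟨Stab.diag {0} q, hq.map _⟩) (c := ⟨Stab.diag {0} (p + q), hs.map _⟩)
        (by rw [← map_mul, hpq0, map_zero]) (map_add _ _ _).symm
    have h2 : diag {0} hp = diag {0} hq := (diag_le_diag _ hp hq hpq.1).antisymm
      (diag_le_diag _ hq hp hpq.2)
    rw [two_nsmul]
    nth_rw 2 [h2]
    rw [h1]
    exact diag_le_diag _ hs hy hpqy

end Cu

/-- In a simple C⋆-algebra not of type I, each nonzero positive element of `A ⊗ K` dominates
diagonal matrices of any given size. -/
theorem exists_diag_cuntzSub (hA : IsSimpleCStar A) (hI : ¬ IsTypeI A) (s : Finset ℕ)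
    {x : Stab A} (hx : IsPos x) (hx0 : x ≠ 0) :
    ∃ y : A, IsPos y ∧ ‖y‖ = 1 ∧ CuntzSub (Stab.diag s y) x := by
  obtain ⟨x₁, hx₁, hx₁0, hx₁x⟩ := Stab.exists_unit_cuntzSub hx hx0
  obtain ⟨y, hy, hy0, hyx⟩ := Cu.exists_nsmul_le hA hI s.card hx₁ hx₁0
  have h2 : CuntzSub (Stab.diag s y) (Stab.diag {0} x₁) := by
    have h1 : Cu.diag s hy ≤ Cu.diag {0} hx₁ := by
      rw [Cu.diag_eq_nsmul]
      -- Halving `n` times yields `2 ^ n` copies, more than the `n = s.card` that are needed.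
      exact (Cu.nsmul_le_nsmul Nat.lt_two_pow_self.le (Cu.diag {0} hy)).trans hyx
    exact (Cu.mk_le_mk (a := ⟨Stab.diag s y, hy.map _⟩) (b := ⟨Stab.diag {0} x₁, hx₁.map _⟩)).1 h1
  rw [Stab.diag_singleton] at h2
  refine ⟨‖y‖⁻¹ • y, hy.real_smul (by positivity), ?_, ?_⟩
  · rw [norm_smul, norm_inv, norm_norm, inv_mul_cancel₀ (norm_ne_zero_iff.2 hy0)]
  · have e : Stab.diag s (‖y‖⁻¹ • y) = ‖y‖⁻¹ • Stab.diag s y :=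
      map_real_smul _ _ _
    rw [e]
    exact (h2.trans hx₁x).smul_left (by positivity)

end MatrixUnits

/-! ### Passing from `A` to `A ⊗ K` -/

section Stabilization

attribute [local instance] CStarAlgebra.spectralOrder CStarAlgebra.spectralOrderedRing

variable {A B : Type*} [NonUnitalCStarAlgebra A] [NonUnitalCStarAlgebra B]
variable {G : Type*} [Group G]

/-- The action on `A ⊗ K` induced by an action on `A`. -/
def stabAct (α : G →* (A ≃⋆ₐ[ℂ] A)) (g : G) : Stab A →⋆ₙₐ[ℂ] Stab A :=
  Stab.map (α g : A →⋆ₙₐ[ℂ] A)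

theorem stabAct_unit (α : G →* (A ≃⋆ₐ[ℂ] A)) (g : G) (i j : ℕ) (a : A) :
    stabAct α g (Stab.unit i j a) = Stab.unit i j (α g a) := Stab.map_unit _ i j a

theorem stabAct_diag (α : G →* (A ≃⋆ₐ[ℂ] A)) (g : G) (s : Finset ℕ) (a : A) :
    stabAct α g (Stab.diag s a) = Stab.diag s (α g a) := Stab.map_diag _ s a

namespace Stab

theorem continuous_unit (i j : ℕ) : Continuous (unit (A := A) i j) :=
  AddMonoidHomClass.continuous_of_bound (unit i j) 1 fun a => by
    rw [one_mul]; exact norm_unit_le i j a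

theorem norm_map_of_injective (φ : A →⋆ₙₐ[ℂ] B) (hφ : Function.Injective φ) (x : Stab A) :
    ‖map φ x‖ = ‖x‖ := by
  refine denseRange_ofFin.induction_on (p := fun x : Stab A => ‖map φ x‖ = ‖x‖) x
    (isClosed_eq (continuous_map φ).norm continuous_norm) fun u => ?_
  rw [map_ofFin, norm_ofFin, norm_ofFin]
  obtain ⟨s, hs⟩ := u.exists_suppOn
  have h : FinMat.SuppOn (FinMat.map φ u) s := fun i j h => hs i j fun h0 => h (by
    change φ (u.entry i j) = 0
    rw [h0, map_zero])
  rw [FinMat.norm_eq h, FinMat.norm_eq hs]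
  refine NonUnitalStarAlgHom.norm_map (CStarMatrix.mapₙₐ φ : CStarMatrix s s A →⋆ₙₐ[ℂ] _)
    (fun M N hMN => ?_) (FinMat.corner s u)
  ext i j
  exact hφ (congrFun (congrFun hMN i) j)

/-- As `A` may have no unit, a diagonal of approximate unit elements replaces the unit of the matrix
algebra indexed by `s`. -/
theorem exists_diag_mul_near {u : FinMat A} {s : Finset ℕ} (hu : FinMat.SuppOn u s) {κ : ℝ}
    (hκ : 0 < κ) : ∃ e : A, IsPos e ∧ ‖e‖ ≤ 1 ∧ ‖diag s e * ofFin u - ofFin u‖ < κ := by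
  have hl := CStarAlgebra.increasingApproximateUnit A
  have h1 : Tendsto (fun e : A => diag s e * ofFin u) (CStarAlgebra.approximateUnit A)
      (𝓝 (ofFin u)) := by
    have h2 : ∀ e : A, diag s e * ofFin u = ∑ i ∈ s, ∑ j ∈ s, unit i j (e * u.entry i j) := by
      intro e
      rw [ofFin_eq_sum hu, Finset.mul_sum]
      refine Finset.sum_congr rfl fun i hi => ?_
      rw [Finset.mul_sum]
      exact Finset.sum_congr rfl fun j _ => diag_mul_unit hi j _ _
    simp only [h2]
    rw [ofFin_eq_sum hu]
    exact tendsto_finsetSum _ fun i _ => tendsto_finsetSum _ fun j _ =>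
      ((continuous_unit i j).tendsto _).comp (hl.tendsto_mul_right _)
  obtain ⟨e, ⟨he1, he2⟩, he3⟩ := (((Metric.tendsto_nhds.1 h1 κ hκ).and hl.eventually_nonneg).and
    hl.eventually_norm).exists
  exact ⟨e, isPos_iff_nonneg.2 he2, he3, by rwa [dist_eq_norm] at he1⟩

theorem ofFin_mul_diag_sub {u : FinMat A} {s : Finset ℕ} (hu : FinMat.SuppOn u s) (f : A) :
    ofFin u * diag s f - diag s f * ofFin u =
      ∑ i ∈ s, ∑ j ∈ s, unit i j (u.entry i j * f - f * u.entry i j) := by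
  rw [ofFin_eq_sum hu]
  simp only [Finset.mul_sum, Finset.sum_mul]
  rw [← Finset.sum_sub_distrib]
  refine Finset.sum_congr rfl fun i hi => ?_
  rw [← Finset.sum_sub_distrib]
  refine Finset.sum_congr rfl fun j hj => ?_
  rw [unit_mul_diag hj, diag_mul_unit hi, map_sub]

end Stab

variable [Fintype G]

/-- `A^α ⊗ K` is the fixed point algebra of `A ⊗ K`. -/
theorem isFixedPointEmbedding_stab (α : G →* (A ≃⋆ₐ[ℂ] A)) :
    IsFixedPointEmbedding (stabAct α) (Stab.map (fixedIncl α)) where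
  norm_map := Stab.norm_map_of_injective _ Subtype.val_injective
  mul_apply g h := Stab.hom_ext (Stab.continuous_map _)
    ((Stab.continuous_map _).comp (Stab.continuous_map _)) fun u => by
      simp only [stabAct, Stab.map_ofFin]
      congr 1
      refine FinMat.ext' fun i j => ?_
      change α (g * h) (u.entry i j) = α g (α h (u.entry i j))
      rw [map_mul]
      rfl
  one_apply := Stab.hom_ext (Stab.continuous_map _) continuous_id fun u => by
    simp only [stabAct, Stab.map_ofFin]
    congr 1
    refine FinMat.ext' fun i j => ?_
    change α 1 (u.entry i j) = u.entry i j
    rw [map_one]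
    rfl
  fixed g := Stab.hom_ext ((Stab.continuous_map _).comp (Stab.continuous_map _))
    (Stab.continuous_map _) fun u => by
      simp only [stabAct, Stab.map_ofFin]
      congr 1
      exact FinMat.ext' fun i j => (u.entry i j).2 g
  exists_eq c hc := by
    -- The range of an isometric homomorphism is closed, so approximating `c` suffices. Averaging a
    -- finite matrix near `c` over `G` gives entries in `A^α`, and the average is still near `c`
    -- because `c` is its own average.
    have hcl : IsClosed (Set.range (Stab.map (fixedIncl α))) :=
      (AddMonoidHomClass.isometry_of_norm (Stab.map (fixedIncl α))
        (Stab.norm_map_of_injective _ Subtype.val_injective)).isClosedEmbedding.isClosed_range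
    rw [← Set.mem_range, ← hcl.closure_eq, Metric.mem_closure_iff]
    intro ε hε
    obtain ⟨u, hu⟩ := Stab.exists_norm_ofFin_sub_lt c hε
    have hN : (Fintype.card G : ℂ) ≠ 0 := Nat.cast_ne_zero.2 Fintype.card_ne_zero
    obtain ⟨s, hs⟩ := u.exists_suppOn
    let E : ℕ → ℕ → A := fun i j => (Fintype.card G : ℂ)⁻¹ • ∑ g, α g (u.entry i j)
    have hE : ∀ i j g, α g (E i j) = E i j := by
      intro i j g
      simp only [E, map_smul, map_sum]
      congr 1
      refine Fintype.sum_equiv (Equiv.mulLeft g) _ _ fun h => ?_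
      rw [Equiv.coe_mulLeft, map_mul]
      rfl
    let v : FinMat (fixedPoints α) := FinMat.mk (fun i j => ⟨E i j, hE i j⟩) s fun i j h => by
      refine hs i j fun h0 => h (Subtype.ext ?_)
      simp [E, h0]
    have hv : Stab.map (fixedIncl α) (Stab.ofFin v) =
        (Fintype.card G : ℂ)⁻¹ • ∑ g, stabAct α g (Stab.ofFin u) := by
      simp only [stabAct, Stab.map_ofFin]
      rw [← map_sum, ← map_smul]
      congr 1
      refine FinMat.ext' fun i j => ?_
      rw [FinMat.entry_smul, FinMat.entry_sum]
      rfl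
    refine ⟨_, ⟨Stab.ofFin v, rfl⟩, ?_⟩
    have hc' : c = (Fintype.card G : ℂ)⁻¹ • ∑ g, stabAct α g c := by
      simp only [hc, Finset.sum_const, Finset.card_univ]
      rw [← Nat.cast_smul_eq_nsmul ℂ, smul_smul, inv_mul_cancel₀ hN, one_smul]
    rw [dist_comm, dist_eq_norm, hv]
    nth_rw 1 [hc']
    rw [← smul_sub, ← Finset.sum_sub_distrib, norm_smul, norm_inv, Complex.norm_natCast]
    have hN' : (0 : ℝ) < (Fintype.card G : ℝ) := by exact_mod_cast Fintype.card_pos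
    rw [inv_mul_lt_iff₀ hN']
    have hlt : ∀ g, ‖stabAct α g (Stab.ofFin u) - stabAct α g c‖ < ε := fun g => by
      rw [← map_sub]
      exact (NonUnitalStarAlgHom.norm_apply_le _ _).trans_lt hu
    calc _ ≤ ∑ g, ‖stabAct α g (Stab.ofFin u) - stabAct α g c‖ := norm_sum_le _ _
      _ < ∑ _g : G, ε := Finset.sum_lt_sum_of_nonempty Finset.univ_nonempty fun g _ => hlt g
      _ = _ := by simp

/-- By orthogonality `F² = ∑ f_i² ≤ ∑ f_i = F`, hence `‖F‖² ≤ ‖F‖`. -/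
theorem norm_sum_le_one_of_mul_eq_zero {ι : Type*} [Fintype ι] {f : ι → A}
    (hf : ∀ i, IsPos (f i) ∧ ‖f i‖ ≤ 1) (hff : ∀ i k, i ≠ k → f i * f k = 0) :
    IsPos (∑ i, f i) ∧ ‖∑ i, f i‖ ≤ 1 := by
  have h0 : 0 ≤ ∑ i, f i := Finset.sum_nonneg fun i _ => isPos_iff_nonneg.1 (hf i).1
  refine ⟨isPos_iff_nonneg.2 h0, ?_⟩
  set F := ∑ i, f i with hF
  have hs := (IsSelfAdjoint.of_nonneg h0).star_eq
  have hFF : star F * F = ∑ i, f i * f i := by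
    rw [hs, hF, Finset.sum_mul_sum]
    exact Finset.sum_congr rfl fun i _ =>
      Finset.sum_eq_single i (fun k _ hk => hff i k hk.symm) (by simp)
  have hle : star F * F ≤ F := by
    rw [hFF]
    refine Finset.sum_le_sum fun i _ => ?_
    have hi := isPos_iff_nonneg.1 (hf i).1
    have his := IsSelfAdjoint.of_nonneg hi
    have hid : cfcₙ (fun t : ℝ => t) (f i) = f i := cfcₙ_id' ℝ (f i) his
    nth_rw 1 2 3 [← hid]
    rw [← cfcₙ_mul (fun t => t) (fun t => t) (f i) (by fun_prop) rfl (by fun_prop) rfl]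
    refine cfcₙ_mono (fun t ht => ?_) (by fun_prop) (by fun_prop) (by simp) rfl
    have h1 := quasispectrum_nonneg_of_nonneg (𝕜 := ℝ) (f i) hi t ht
    have h2 := norm_apply_le_norm_cfcₙ (fun t : ℝ => t) (f i) ht (by fun_prop) rfl his
    rw [hid, Real.norm_of_nonneg h1] at h2
    have := h2.trans (hf i).2
    nlinarith
  have hn := CStarAlgebra.norm_le_norm_of_nonneg_of_le (star_mul_self_nonneg F) hle
  rw [CStarRing.norm_star_mul_self] at hn
  nlinarith [norm_nonneg F]

/-- The weak tracial Rokhlin property passes to the stabilization. -/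
theorem hasCentralTowers_stab (hA : IsSimpleCStar A) (hI : ¬ IsTypeI A)
    {α : G →* (A ≃⋆ₐ[ℂ] A)} (hα : WeakTracialRokhlin α) : HasCentralTowers (stabAct α) := by
  classical
  intro ε hε F y x hx hx0
  choose u hu using fun a : Stab A => Stab.exists_norm_ofFin_sub_lt a
    (show 0 < ε / 8 by positivity)
  set κ := min 1 (ε / (16 * (2 * ‖y‖ + 1))) with hκ
  have hκ0 : 0 < κ := by positivity
  have hκ2 : κ * (16 * (2 * ‖y‖ + 1)) ≤ ε := by
    rw [← le_div_iff₀ (by positivity)]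
    exact min_le_right _ _
  obtain ⟨uy, huy⟩ := Stab.exists_norm_ofFin_sub_lt y hκ0
  choose S hS using FinMat.exists_suppOn (A := A)
  -- One finite block supports the approximants of `y` and of all elements of `F`. The tower in `A ⊗
  -- K` is the diagonal over `s` of a tower in `A`.
  set s : Finset ℕ := F.biUnion (fun a => S (u a)) ∪ S uy with hs
  have hus : ∀ a ∈ F, FinMat.SuppOn (u a) s := fun a ha => (hS (u a)).mono
    ((Finset.subset_biUnion_of_mem (fun a => S (u a)) ha).trans Finset.subset_union_left)
  have huys : FinMat.SuppOn uy s := (hS uy).mono Finset.subset_union_right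
  obtain ⟨e, he, he1, hey⟩ := Stab.exists_diag_mul_near huys hκ0
  -- The remainder will be repeated `s.card` times, so condition (3) is applied with an `x₀` of
  -- which that many copies fit below `x`.
  obtain ⟨x₀, hx₀, hx₀1, hx₀x⟩ := exists_diag_cuntzSub hA hI s hx hx0
  set ε' := min (ε / (4 * ((s.card : ℝ) ^ 2 + 1))) (ε / (4 * (‖y‖ + 1) ^ 2)) with hε'
  have hε'0 : 0 < ε' := by positivity
  have hε'1 : (s.card : ℝ) ^ 2 * ε' + ε' ≤ ε / 4 := by
    have : ε' ≤ ε / (4 * ((s.card : ℝ) ^ 2 + 1)) := min_le_left _ _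
    rw [le_div_iff₀ (by positivity)] at this
    linarith
  have hε'2 : (‖y‖ + 1) ^ 2 * ε' ≤ ε / 4 := by
    have : ε' ≤ ε / (4 * (‖y‖ + 1) ^ 2) := min_le_right _ _
    rw [le_div_iff₀ (by positivity)] at this
    linarith
  have hε'3 : ε' ≤ ε / 4 := by nlinarith [sq_nonneg (s.card : ℝ)]
  -- The tower in `A` almost commutes with all matrix entries of the approximants, and the
  -- approximate unit element `e` plays the role of `y` in condition (3).
  obtain ⟨f, hf, hff, hfF, hαf, hr, -⟩ := hα ε' hε'0
    (F.biUnion fun a => s.biUnion fun i => s.image fun j => (u a).entry i j) x₀ e hx₀ he hx₀1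
  obtain ⟨hfpos, hf1⟩ := norm_sum_le_one_of_mul_eq_zero hf hff
  set f₀ := ∑ g, f g with hf₀
  have hDn : ∀ a : A, ‖Stab.diag s a‖ ≤ ‖a‖ := fun a => NonUnitalStarAlgHom.norm_apply_le _ _
  refine ⟨fun g => Stab.diag s (f g), fun g => ⟨(hf g).1.map _, (hDn _).trans (hf g).2⟩,
    fun g h hgh => by rw [← map_mul, hff g h hgh, map_zero], fun g a ha => ?_, fun g h => ?_, ?_⟩
  · have e1 : a * Stab.diag s (f g) - Stab.diag s (f g) * a =
        (Stab.ofFin (u a) * Stab.diag s (f g) - Stab.diag s (f g) * Stab.ofFin (u a)) -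
          ((Stab.ofFin (u a) - a) * Stab.diag s (f g) -
            Stab.diag s (f g) * (Stab.ofFin (u a) - a)) := by noncomm_ring
    have b1 : ‖Stab.ofFin (u a) * Stab.diag s (f g) - Stab.diag s (f g) * Stab.ofFin (u a)‖ ≤
        (s.card : ℝ) ^ 2 * ε' := by
      rw [Stab.ofFin_mul_diag_sub (hus a ha)]
      refine (norm_sum_le_of_le _ fun i hi => norm_sum_le_of_le _ fun j hj =>
        (Stab.norm_unit_le i j _).trans (hfF g _ ?_).le).trans ?_
      · simp only [Finset.mem_biUnion, Finset.mem_image]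
        exact ⟨a, ha, i, hi, j, hj, rfl⟩
      · simp only [Finset.sum_const, nsmul_eq_mul]
        exact le_of_eq (by ring)
    have hD1 : ‖Stab.diag s (f g)‖ ≤ 1 := (hDn _).trans (hf g).2
    have b2 : ‖(Stab.ofFin (u a) - a) * Stab.diag s (f g)‖ ≤ ε / 8 :=
      (norm_mul_le _ _).trans ((mul_le_of_le_one_right (norm_nonneg _) hD1).trans (hu a).le)
    have b3 : ‖Stab.diag s (f g) * (Stab.ofFin (u a) - a)‖ ≤ ε / 8 :=
      (norm_mul_le _ _).trans ((mul_le_of_le_one_left (norm_nonneg _) hD1).trans (hu a).le)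
    rw [e1]
    have b4 := norm_sub_le (Stab.ofFin (u a) * Stab.diag s (f g) -
      Stab.diag s (f g) * Stab.ofFin (u a)) ((Stab.ofFin (u a) - a) * Stab.diag s (f g) -
            Stab.diag s (f g) * (Stab.ofFin (u a) - a))
    have b5 := norm_sub_le ((Stab.ofFin (u a) - a) * Stab.diag s (f g))
      (Stab.diag s (f g) * (Stab.ofFin (u a) - a))
    linarith
  · rw [stabAct_diag, ← map_sub]
    exact (hDn _).trans_lt ((hαf g h).trans (by linarith))
  · have he0 := isPos_iff_nonneg.1 he
    have hes := (IsSelfAdjoint.of_nonneg he0).star_eq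
    have hDe : star (Stab.diag s e) = Stab.diag s e := by rw [← map_star, hes]
    set y' := Stab.ofFin uy with hy'
    set r₀ := e * e - e * f₀ * e with hr₀
    have hr₀0 : 0 ≤ r₀ := by
      have h1 := CStarAlgebra.star_left_conjugate_le_norm_smul (a := e) (b := f₀)
        (.of_nonneg (isPos_iff_nonneg.1 hfpos))
      rw [hes] at h1
      have h2 : 0 ≤ e * e := by simpa only [hes] using star_mul_self_nonneg e
      have h3 : ‖f₀‖ • (e * e) ≤ (1 : ℝ) • (e * e) := smul_le_smul_of_nonneg_right hf1 h2
      rw [one_smul] at h3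
      exact sub_nonneg.2 (h1.trans h3)
    -- Since `diag(e) y'` is close to `y`, the remainder is close to `y'* diag(e² - e f₀ e) y'`.
    -- Cutting `e² - e f₀ e` down by `ε'` puts it below `x₀` by condition (3).
    refine ⟨star y' * Stab.diag s (cutDown r₀ ε') * y',
      (CuntzSub.star_conj _ _).trans ((hr.map (Stab.diag s)).trans hx₀x),
      isPos_iff_nonneg.2 (star_left_conjugate_nonneg
        (isPos_iff_nonneg.1 ((isPos_cutDown r₀ ε').map _)) _), ?_⟩
    have hsum : ∑ g, Stab.diag s (f g) = Stab.diag s f₀ := (map_sum _ _ _).symm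
    rw [hsum]
    set y'' := Stab.diag s e * y' with hy''
    have hD1 : ‖Stab.diag s f₀‖ ≤ 1 := (hDn _).trans hf1
    have hyy : ‖y - y''‖ ≤ 2 * κ := by
      calc ‖y - y''‖ = ‖(y' - y) + (y'' - y')‖ := by
            rw [← norm_neg]; congr 1; abel
        _ ≤ _ := norm_add_le _ _
        _ ≤ 2 * κ := by linarith
    have hy'n : ‖y'‖ ≤ ‖y‖ + 1 := by
      have h1 : ‖y'‖ ≤ ‖y' - y‖ + ‖y‖ := by simpa using norm_add_le (y' - y) y
      have h2 : κ ≤ 1 := min_le_left _ _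
      linarith
    have hy''n : ‖y''‖ ≤ ‖y‖ + 1 :=
      (norm_mul_le _ _).trans ((mul_le_of_le_one_left (norm_nonneg _)
        ((hDn e).trans he1)).trans hy'n)
    have e1 : star y * y - star y * Stab.diag s f₀ * y -
        star y' * Stab.diag s (cutDown r₀ ε') * y' =
        ((star y * y - star y'' * y'') - (star y * Stab.diag s f₀ * y -
          star y'' * Stab.diag s f₀ * y'')) - star y' * Stab.diag s (cutDown r₀ ε' - r₀) * y' := by
      have h1 : star y'' * y'' = star y' * Stab.diag s (e * e) * y' := by
        rw [hy'', star_mul, hDe, map_mul]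
        noncomm_ring
      have h2 : star y'' * Stab.diag s f₀ * y'' = star y' * Stab.diag s (e * f₀ * e) * y' := by
        rw [hy'', star_mul, hDe, map_mul, map_mul]
        noncomm_ring
      rw [h1, h2, hr₀, map_sub, map_sub]
      noncomm_ring
    have b1 : ‖star y * y - star y'' * y''‖ ≤ 2 * κ * (2 * ‖y‖ + 1) := by
      have h1 : star y * y - star y'' * y'' = star y * (y - y'') + star (y - y'') * y'' := by
        rw [star_sub]; noncomm_ring
      rw [h1]
      refine (norm_add_le _ _).trans ?_
      have h2 : ‖star y * (y - y'')‖ ≤ ‖y‖ * (2 * κ) := by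
        refine (norm_mul_le _ _).trans ?_
        rw [norm_star]
        gcongr
      have h3 : ‖star (y - y'') * y''‖ ≤ (2 * κ) * (‖y‖ + 1) := by
        refine (norm_mul_le _ _).trans ?_
        rw [norm_star]
        gcongr
      linarith
    have b2 : ‖star y * Stab.diag s f₀ * y - star y'' * Stab.diag s f₀ * y''‖ ≤
        2 * κ * (2 * ‖y‖ + 1) := by
      have h1 := norm_conj_sub_conj_le (star y) (star y'') (Stab.diag s f₀)
      rw [star_star, star_star, ← star_sub, norm_star, norm_star, norm_star] at h1
      refine h1.trans ?_
      calc ‖y - y''‖ * ‖Stab.diag s f₀‖ * (‖y‖ + ‖y''‖)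
          ≤ 2 * κ * 1 * (‖y‖ + (‖y‖ + 1)) := by gcongr
        _ = _ := by ring
    have b3 : ‖star y' * Stab.diag s (cutDown r₀ ε' - r₀) * y'‖ ≤ ε / 4 := by
      refine (norm_mul_le _ _).trans ?_
      calc _ ≤ (‖star y'‖ * ‖Stab.diag s (cutDown r₀ ε' - r₀)‖) * ‖y'‖ := by
            gcongr
            exact norm_mul_le _ _
        _ ≤ ((‖y‖ + 1) * ε') * (‖y‖ + 1) := by
            rw [norm_star]
            gcongr
            exact (hDn _).trans (norm_cutDown_sub_le hr₀0 hε'0.le)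
        _ ≤ ε / 4 := by linarith
    rw [e1]
    have b4 := norm_sub_le ((star y * y - star y'' * y'') - (star y * Stab.diag s f₀ * y -
          star y'' * Stab.diag s f₀ * y'')) (star y' * Stab.diag s (cutDown r₀ ε' - r₀) * y')
    have b5 := norm_sub_le (star y * y - star y'' * y'') (star y * Stab.diag s f₀ * y -
          star y'' * Stab.diag s f₀ * y'')
    linarith

end Stabilization

/-! ### Pure positivity, room below fixed elements, and descent of comparison -/

section Injectivity

attribute [local instance] CStarAlgebra.spectralOrder CStarAlgebra.spectralOrderedRing

variable {A B : Type*} [NonUnitalCStarAlgebra A] [NonUnitalCStarAlgebra B]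
variable {G : Type*} [Group G] [Fintype G]

theorem ofFin_single (a : B) : Stab.ofFin (FinMat.single a) = Stab.diag {0} a := by
  rw [Stab.diag_singleton]
  rfl

/-- If `(0, δ)` misses the spectrum of `b`, then `b` is Cuntz equivalent to a projection. -/
theorem exists_isStarProjection_cuntzEquiv {b : B} (hb : 0 ≤ b) {δ : ℝ} (hδ : 0 < δ)
    (h : cfcₙ (fun t : ℝ => max 0 (min t (δ - t))) b = 0) :
    ∃ p : B, IsStarProjection p ∧ CuntzEquiv b p := by
  have hbs := IsSelfAdjoint.of_nonneg hb
  have hid : cfcₙ (fun t : ℝ => t) b = b := cfcₙ_id' ℝ b hbs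
  -- No spectral value lies in `(0, δ)`, so on the spectrum `ψ` takes only the values `0` and `1`
  -- and is positive exactly off `0`.
  let ψ : ℝ → ℝ := fun t => max 0 (min (t / δ) 1)
  have hψ : Continuous ψ := by fun_prop
  have hψ0 : ψ 0 = 0 := by simp [ψ]
  have hsp : ∀ t ∈ quasispectrum ℝ b, ψ t * ψ t = ψ t := by
    intro t ht
    have h0 := quasispectrum_nonneg_of_nonneg (𝕜 := ℝ) b hb t ht
    have h1 := norm_apply_le_norm_cfcₙ (fun t : ℝ => max 0 (min t (δ - t))) b ht (by fun_prop)
      (by simp [hδ.le]) hbs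
    rw [h, norm_zero, norm_le_zero_iff] at h1
    have h2 : min t (δ - t) ≤ 0 := h1 ▸ le_max_right _ _
    rcases min_le_iff.1 h2 with h3 | h3
    · rw [le_antisymm h3 h0, hψ0, mul_zero]
    · have h4 : 1 ≤ t / δ := (one_le_div hδ).2 (by linarith)
      have h5 : ψ t = 1 := by simp only [ψ]; rw [min_eq_right h4, max_eq_right zero_le_one]
      rw [h5, mul_one]
  refine ⟨cfcₙ ψ b, ⟨?_, cfcₙ_predicate ψ b⟩, ?_, ?_⟩
  · rw [IsIdempotentElem, ← cfcₙ_mul ψ ψ b]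
    exact cfcₙ_congr hsp
  · nth_rw 1 [← hid]
    exact cuntzSub_cfcₙ hb continuous_id rfl hψ hψ0 (fun t ht => ht)
      (fun t _ => le_max_left _ _) fun t _ h0 =>
        lt_max_of_lt_right (lt_min (div_pos h0 hδ) one_pos)
  · nth_rw 2 [← hid]
    refine cuntzSub_cfcₙ hb hψ hψ0 continuous_id rfl (fun t _ => le_max_left _ _)
      (fun t ht => ht) fun t ht h0 => ?_
    refine lt_of_le_of_ne ht fun h1 => ?_
    rw [← h1, hψ0] at h0
    exact lt_irrefl _ h0

/-- The spectrum of a purely positive element accumulates at zero. -/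
theorem PurelyPositive.cfcₙ_ne_zero {b : B} (hb : PurelyPositive b) {δ : ℝ} (hδ : 0 < δ) :
    cfcₙ (fun t : ℝ => max 0 (min t (δ - t))) b ≠ 0 := by
  intro h
  obtain ⟨p, hp, hbp⟩ := exists_isStarProjection_cuntzEquiv (isPos_iff_nonneg.1 hb.1) hδ h
  refine hb.2 (FinMat.single p) ⟨?_, ?_⟩ ?_
  · change FinMat.unit 0 0 p * FinMat.unit 0 0 p = FinMat.unit 0 0 p
    rw [FinMat.unit_mul_unit, if_pos rfl, hp.1]
  · change star (FinMat.unit 0 0 p) = FinMat.unit 0 0 p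
    rw [FinMat.star_unit, hp.2]
  · rw [ofFin_single, ofFin_single]
    exact ⟨hbp.1.map _, hbp.2.map _⟩

/-- In the expansion of the compression by `∑ f_g`, the terms `f_g x f_k` with `g ≠ k` are nearly
zero, as `x` almost commutes with the orthogonal `f_g`. Were all diagonal terms at most `1 / (2N)`,
the whole would have norm at most `3 / 4`, below `1 - ε`. -/
theorem exists_lt_norm_conj {ε : ℝ} (hε : (Fintype.card G : ℝ) ^ 2 * ε ≤ 1 / 4)
    {f : G → A} {x : A} (hf : ∀ g, ‖f g‖ ≤ 1) (hff : ∀ g h, g ≠ h → f g * f h = 0)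
    (hfx : ∀ g, ‖x * f g - f g * x‖ < ε)
    (hn : 1 - ε < ‖(∑ g, f g) * x * (∑ g, f g)‖) :
    ∃ g, 1 / (2 * (Fintype.card G : ℝ)) < ‖f g * x * f g‖ := by
  classical
  by_contra! hcon
  have hN : (1 : ℝ) ≤ Fintype.card G := by exact_mod_cast Fintype.card_pos
  have hε0 : 0 < ε := (norm_nonneg _).trans_lt (hfx (Classical.arbitrary G))
  have h1 : ∀ g k, ‖f g * x * f k‖ ≤ ε + if g = k then 1 / (2 * (Fintype.card G : ℝ)) else 0 := by
    intro g k
    split_ifs with h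
    · subst h
      linarith [hcon g]
    · have e : f g * x * f k = -((x * f g - f g * x) * f k) := by
        rw [sub_mul, mul_assoc x, hff g k h, mul_zero, zero_sub, neg_neg]
      rw [e, norm_neg, add_zero]
      exact (norm_mul_le _ _).trans
        ((mul_le_of_le_one_right (norm_nonneg _) (hf k)).trans (hfx g).le)
  have h2 : ‖(∑ g, f g) * x * (∑ g, f g)‖ ≤ (Fintype.card G : ℝ) ^ 2 * ε + 1 / 2 := by
    rw [Finset.sum_mul, Finset.sum_mul_sum]
    refine (norm_sum_le_of_le _ fun g _ => norm_sum_le_of_le _ fun k _ => h1 g k).trans ?_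
    simp only [Finset.sum_add_distrib, Finset.sum_ite_eq, Finset.mem_univ, if_true,
      Finset.sum_const, Finset.card_univ, nsmul_eq_mul]
    refine le_of_eq ?_
    field_simp
  have h3 : ε ≤ (Fintype.card G : ℝ) ^ 2 * ε := le_mul_of_one_le_left hε0.le (one_le_pow₀ hN)
  linarith

/-- Below each nonzero positive element of `A^α ⊗ K` there is room for all elements of
`A^α ⊗ K` which are small in `A ⊗ K`. -/
theorem exists_forall_cuntzSub_stab {α : G →* (A ≃⋆ₐ[ℂ] A)} (hα : WeakTracialRokhlin α)
    {h : Stab (fixedPoints α)} (hh : IsPos h) (h0 : h ≠ 0) :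
    ∃ x : Stab A, IsPos x ∧ x ≠ 0 ∧ ∀ c : Stab (fixedPoints α),
      CuntzSub (Stab.map (fixedIncl α) c) x → CuntzSub c h := by
  obtain ⟨a, ha, ha0, hah⟩ : ∃ a : fixedPoints α, IsPos a ∧ ‖a‖ = 1 ∧
      CuntzSub (Stab.unit 0 0 a) h := by
    obtain ⟨a, ha, ha0, hah⟩ := Stab.exists_unit_cuntzSub hh h0
    refine ⟨‖a‖⁻¹ • a, ha.real_smul (by positivity), ?_, ?_⟩
    · rw [norm_smul, norm_inv, norm_norm, inv_mul_cancel₀ (norm_ne_zero_iff.2 ha0)]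
    · rw [← Stab.diag_singleton] at hah ⊢
      rw [map_real_smul]
      exact hah.smul_left (by positivity)
  set b : A := fixedIncl α a with hb
  have hbpos : IsPos b := ha.map _
  have hb1 : ‖b‖ = 1 := ha0
  set N : ℝ := (Fintype.card G : ℝ) with hN
  have hN1 : (1 : ℝ) ≤ N := Nat.one_le_cast.2 Fintype.card_pos
  obtain ⟨ε', hε', hbd⟩ := exists_entry_bound G (Stab A) (show 0 < 1 / (4 * N) by positivity)
  -- The first bound makes the two errors in `f_g b α_k(f_g) ≈ f_g b f_{kg} ≈ 0` add up to less than
  -- `ε'`; the second gives a large diagonal term.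
  set ε := min (ε' / 3) (1 / (4 * N ^ 2)) with hε
  have hε0 : 0 < ε := by positivity
  have hε1 : N ^ 2 * ε ≤ 1 / 4 := by
    have : ε ≤ 1 / (4 * N ^ 2) := min_le_right _ _
    rw [le_div_iff₀ (by positivity)] at this
    linarith
  have hε2 : ε + ε < ε' := by
    have : ε ≤ ε' / 3 := min_le_left _ _
    linarith
  -- The tower is needed for its size on `b`, from condition (4), so `b` serves both as the element
  -- of norm one and as the element to commute with.
  obtain ⟨f, hf, hff, hfb, hαf, -, hn⟩ := hα ε hε0 {b} b 0 hbpos ⟨0, by simp⟩ hb1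
  have hfb' : ∀ g, ‖b * f g - f g * b‖ < ε := fun g => hfb g b (Finset.mem_singleton_self b)
  obtain ⟨g, hg⟩ := exists_lt_norm_conj hε1 (fun g => (hf g).2) hff hfb' hn
  have hfs : star (f g) = f g := (IsSelfAdjoint.of_nonneg (isPos_iff_nonneg.1 (hf g).1)).star_eq
  have hjb : Stab.map (fixedIncl α) (Stab.unit 0 0 a) = Stab.unit 0 0 b := Stab.map_unit _ _ _ _
  set z : Stab A := Stab.unit 0 0 (f g) with hz
  have hzk : ∀ k, k ≠ 1 →
      ‖star z * Stab.map (fixedIncl α) (Stab.unit 0 0 a) * stabAct α k z‖ < ε' := by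
    intro k hk
    rw [hjb, hz, stabAct_unit, Stab.star_unit, hfs, Stab.unit_mul_unit_same,
      Stab.unit_mul_unit_same, Stab.norm_unit_self]
    have hgk : f g * f (k * g) = 0 := hff _ _ fun h => hk (by simpa using h.symm)
    have e : f g * b * α k (f g) = f g * b * (α k (f g) - f (k * g)) -
        (b * f g - f g * b) * f (k * g) := by
      have h1 : b * f g * f (k * g) = 0 := by rw [mul_assoc, hgk, mul_zero]
      rw [mul_sub, sub_mul, h1]
      abel
    rw [e]
    have b1 : ‖f g * b * (α k (f g) - f (k * g))‖ ≤ ε := by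
      have h1 : ‖f g * b‖ ≤ 1 := (norm_mul_le _ _).trans (by rw [hb1, mul_one]; exact (hf g).2)
      exact (norm_mul_le _ _).trans
        ((mul_le_of_le_one_left (norm_nonneg _) h1).trans (hαf k g).le)
    have b2 : ‖(b * f g - f g * b) * f (k * g)‖ ≤ ε := (norm_mul_le _ _).trans
      ((mul_le_of_le_one_right (norm_nonneg _) (hf _).2).trans (hfb' g).le)
    exact (norm_sub_le _ _).trans_lt (by linarith)
  set y := star z * Stab.map (fixedIncl α) (Stab.unit 0 0 a) * z with hy
  have hy1 : y = Stab.unit 0 0 (f g * b * f g) := by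
    rw [hy, hjb, hz, Stab.star_unit, hfs, Stab.unit_mul_unit_same, Stab.unit_mul_unit_same]
  have hapos : IsPos (Stab.unit 0 0 a) := by
    rw [← Stab.diag_singleton]
    exact ha.map _
  have hy0 : 0 ≤ y := star_left_conjugate_nonneg (isPos_iff_nonneg.1 (hapos.map _)) _
  -- The cut at `1 / (4N)` leaves something nonzero because `‖f_g b f_g‖ > 1 / (2N)`, and it matches
  -- the bound `1 / (4N)` on the off-diagonal part provided by `exists_entry_bound`.
  refine ⟨cutDown y (1 / (4 * N)), isPos_cutDown _ _, fun hcut => ?_, fun c hc =>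
    ((isFixedPointEmbedding_stab α).cuntzSub_of_cuntzSub_conj (by positivity) hε' hbd
      (isPos_iff_nonneg.1 hapos) hzk hc).trans hah⟩
  have h1 := norm_cutDown_sub_le hy0 (show 0 ≤ 1 / (4 * N) by positivity)
  rw [hcut, zero_sub, norm_neg, hy1, Stab.norm_unit_self] at h1
  have h2 : 1 / (4 * N) ≤ 1 / (2 * N) := one_div_le_one_div_of_le (by positivity) (by linarith)
  exact absurd (hg.trans_le (h1.trans h2)) (lt_irrefl _)

/-- Only the larger element has to be purely positive, since it is the one that must leave room.
Injectivity on `Cu₊` follows by using this in both directions. -/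
theorem cuntzSub_of_map_fixedIncl (hA : IsSimpleCStar A) (hI : ¬ IsTypeI A)
    {α : G →* (A ≃⋆ₐ[ℂ] A)} (hα : WeakTracialRokhlin α) {a b : Stab (fixedPoints α)}
    (ha : IsPos a) (hb : PurelyPositive b)
    (hab : CuntzSub (Stab.map (fixedIncl α) a) (Stab.map (fixedIncl α) b)) : CuntzSub a b :=
  (isFixedPointEmbedding_stab α).cuntzSub_of_map (hasCentralTowers_stab hA hI hα)
    (fun _ hh h0 => exists_forall_cuntzSub_stab hα hh h0) ha hb.1 hab fun _ hδ =>
      hb.cfcₙ_ne_zero hδ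

end Injectivity

end CuntzSemigroup

end

/-! ### The main theorem -/

theorem mainTheorem8 {A : Type*} [NonUnitalCStarAlgebra A] {G : Type*} [Group G] [Fintype G]
    (hsimple : CuntzSemigroup.IsSimpleCStar A) (hnotI : ¬ CuntzSemigroup.IsTypeI A)
    (α : G →* (A ≃⋆ₐ[ℂ] A)) (hα : CuntzSemigroup.WeakTracialRokhlin α) :
    CuntzSemigroup.IsCuMorphism (CuntzSemigroup.Cu.map (CuntzSemigroup.fixedIncl α)) ∧
      Set.InjOn (CuntzSemigroup.Cu.map (CuntzSemigroup.fixedIncl α))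
        (CuntzSemigroup.CuPlus (CuntzSemigroup.fixedPoints α)) := by
  refine ⟨CuntzSemigroup.Cu.isCuMorphism_map _, ?_⟩
  rintro _ ⟨a, ha, rfl⟩ _ ⟨b, hb, rfl⟩ hab
  have h := CuntzSemigroup.Cu.mk_eq_mk.1 hab
  exact CuntzSemigroup.Cu.mk_eq_mk.2
    ⟨CuntzSemigroup.cuntzSub_of_map_fixedIncl hsimple hnotI hα a.2 hb h.1,
      CuntzSemigroup.cuntzSub_of_map_fixedIncl hsimple hnotI hα b.2 ha h.2⟩
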